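/- **Conventions.** All functions are non-negative and measurable. A *weight* is a non-negative measurable function on $(0,\infty)$. Integrals take values in $[0,\infty]$, with $0\cdot\infty=0$, $c/0=\infty$ for $c>0$, and $\inf\emptyset=\infty$. An *N-function* is a function $\Phi(x)=\int_0^x p(t)\,dt$ $(x\ge 0)$, where the generator $p:[0,\infty)\to[0,\infty)$ is non-decreasing and right-continuous, $p(0)=0$, $p(s)>0$ for $s>0$, and $p(s)\to\infty$ as $s\to\infty$; we put $\Phi(\infty)=\Phi^{-1}(\infty)=\infty$. Its *complementary function* is $\tilde\Phi(x)=\int_0^x\tilde p(t)\,dt$ with $\tilde p(t)=\sup\{s: p(s)\le t\}$. We write $\Phi\in\Delta_2$ if there is $\beta>0$ with $\Phi(2t)\le\beta\,\Phi(t)$ for all $t>0$, and $\Phi\prec\Psi$ if there is $C>0$ with $\sum_i\Psi(\Phi^{-1}(a_i))\le C\,\Psi\big(\Phi^{-1}(\sum_i a_i)\big)$ for every non-negative sequence $(a_i)$. For a weight $u$ and $g\ge0$ on $(0,\infty)$ put $$\|g\|_{\Phi(u)}=\inf\Big\{\tau>0:\int_0^\infty\Phi\Big(\frac{g(x)}{\tau}\Big)u(x)\,dx\le1\Big\},\qquad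 (Iu)(x)=\int_0^x u(t)\,dt .$$ **Theorem 2.2.** Let $\Phi,\Psi$ be N-functions with $\Phi,\tilde\Phi\in\Delta_2$ and $\Phi\prec\Psi$. Let $v,w_0,w_1$ be weights with $(Iv)(x)<\infty$ for all $x>0$ and $\lim_{x\to\infty}(Iv)(x)=\infty$. Let $\alpha\in\mathbb R$, and let $\phi\ge 0$ be locally integrable on $(0,\infty)$ such that, for some constants $C_1,C_2,C_3,C_4>0$, $$C_1\le\frac{\phi(x)}{x^{2\alpha}}\le C_2\quad(x\ge1),\qquad C_3\le\frac{\phi(x)}{x^{2\alpha+1}}\le C_4\quad(0<x<1).$$ Define the quasi Dunkl–Hausdorff operator (the adjoint of the Dunkl–Hausdorff operator $(\mathcal H_{\alpha,\phi}f)(x)=\int_0^\infty \frac{\phi(t)}{t^{2\alpha+2}}f(x/t)\,dt$) by $$(\mathcal H^*_{\alpha,\phi}f)(x)=x^{2\alpha}\int_0^\infty\frac{\phi(y/x)}{y^{2\alpha+1}}f(y)\,dy,\qquad x>0.$$ Then there is a constant $C>0$ such that $$\Psi^{-1}\Big\{\int_0^\infty\Psi\big[w_1(x)(\mathcal H^*_{\alpha,\phi}f)(x)\big]w_0(x)\,dx\Big\}\le\Phi^{-1}\Big\{\int_0^\infty\Phi[Cf(x)]\,v(x)\,dx\Big\}$$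 for all non-negative non-increasing $f$ on $(0,\infty)$, if and only if there are constants $A_1,A_2,A_3>0$ such that for all $r>0$ and $\varepsilon>0$ the following four inequalities hold: $$\Psi^{-1}\Big\{\int_r^\infty\Psi\Big[\frac{w_1(x)}{A_1x}\Big\|\frac{x\,\chi_{(0,r)}}{\varepsilon (Iv)}\Big\|_{\tilde\Phi(\varepsilon v)}\Big]w_0(x)\,dx\Big\}\le\Phi^{-1}(1/\varepsilon),\tag{2.3}$$ $$\Psi^{-1}\Big\{\int_0^r\Psi\Big[\frac{w_1(x)}{A_2}\Big\|\frac{\chi_{(r,\infty)}}{\varepsilon (Iv)}\Big\|_{\tilde\Phi(\varepsilon v)}\Big]w_0(x)\,dx\Big\}\le\Phi^{-1}(1/\varepsilon),\tag{2.4}$$ $$\Psi^{-1}\Big\{\int_0^r\Psi\Big[\frac{w_1(x)}{A_3}\Big\|\frac{\chi_{(r,\infty)}\ln(\cdot/r)}{\varepsilon (Iv)}\Big\|_{\tilde\Phi(\varepsilon v)}\Big]w_0(x)\,dx\Big\}\le\Phi^{-1}(1/\varepsilon),\tag{2.5}$$ $$\Psi^{-1}\Big\{\int_0^r\Psi\Big[\frac{w_1(x)}{A_3}\Big\|\frac{\chi_{(r,\infty)}}{\varepsilon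 (Iv)}\Big\|_{\tilde\Phi(\varepsilon v)}\ln\Big(\frac rx\Big)\Big]w_0(x)\,dx\Big\}\le\Phi^{-1}(1/\varepsilon).\tag{2.6}$$ In (2.3) the $x$ inside the norm denotes the variable of the norm, while the factor $w_1(x)/(A_1x)$ refers to the variable of the outer integral. -/

import Mathlib

open MeasureTheory Set Filter Topology
open scoped NNReal ENNReal

namespace DunklOrlicz

noncomputable section

/-- `p : [0,∞) → [0,∞)` generates an N-function: `p 0 = 0`, `p s > 0` for `s > 0`,
`p s → ∞` as `s → ∞`, and `p` is right-continuous and non-decreasing. -/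
structure IsNGenerator (p : ℝ≥0 → ℝ≥0) : Prop where
  map_zero : p 0 = 0
  pos : ∀ s, 0 < s → 0 < p s
  tendsto_atTop : Tendsto p atTop atTop
  right_continuous : ∀ s, ContinuousWithinAt p (Ici s) s
  monotone : Monotone p

/-- The N-function `Φ(x) = ∫₀ˣ p(t) dt` generated by `p`, on `[0,∞]`
(for a generator `p`, its value at `∞` is `∞`). -/
def nFun (p : ℝ≥0 → ℝ≥0) (x : ℝ≥0∞) : ℝ≥0∞ :=
  ∫⁻ t in {t : ℝ | 0 ≤ t ∧ ENNReal.ofReal t ≤ x}, (p t.toNNReal : ℝ≥0∞)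

/-- The inverse of an increasing bijection `Φ` of `[0,∞]`, in particular of an N-function. -/
def nInv (Φ : ℝ≥0∞ → ℝ≥0∞) (y : ℝ≥0∞) : ℝ≥0∞ :=
  sSup {x | Φ x ≤ y}

/-- The generator `p̃(t) = sup {s : p(s) ≤ t}` of the complementary N-function. -/
def complGen (p : ℝ≥0 → ℝ≥0) (t : ℝ≥0) : ℝ≥0 :=
  sSup {s : ℝ≥0 | p s ≤ t}

/-- The `Δ₂` condition. -/
def Delta2 (Φ : ℝ≥0∞ → ℝ≥0∞) : Prop :=
  ∃ β : ℝ≥0, 0 < β ∧ ∀ t : ℝ≥0, 0 < t → Φ (2 * (t : ℝ≥0∞)) ≤ (β : ℝ≥0∞) * Φ (t : ℝ≥0∞)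

/-- The relation `Φ ≺ Ψ`: for some constant `C > 0`,
`∑ Ψ(Φ⁻¹(aᵢ)) ≤ C Ψ(Φ⁻¹(∑ aᵢ))` for every non-negative sequence. -/
def Prec (Φ Ψ : ℝ≥0∞ → ℝ≥0∞) : Prop :=
  ∃ C : ℝ≥0, 0 < C ∧ ∀ a : ℕ → ℝ≥0,
    ∑' i, Ψ (nInv Φ (a i : ℝ≥0∞)) ≤ (C : ℝ≥0∞) * Ψ (nInv Φ (∑' i, (a i : ℝ≥0∞)))

/-- A weight on `(0,∞)`: a non-negative (Lebesgue) measurable function; its values outside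
`(0,∞)` play no role. -/
def IsWeight (v : ℝ → ℝ≥0) : Prop :=
  AEMeasurable v (volume.restrict (Ioi 0))

/-- `(Iv)(x) = ∫₀ˣ v`. -/
def primitive (v : ℝ → ℝ≥0) (x : ℝ) : ℝ≥0∞ :=
  ∫⁻ t in Ioo 0 x, (v t : ℝ≥0∞)

/-- The modular `∫₀^∞ Φ(g(x)) u(x) dx`. -/
def modular (Φ : ℝ≥0∞ → ℝ≥0∞) (u g : ℝ → ℝ≥0∞) : ℝ≥0∞ :=
  ∫⁻ x in Ioi (0 : ℝ), Φ (g x) * u x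

/-- The Luxemburg norm `‖g‖_{Φ(u)} = inf {τ > 0 : ∫₀^∞ Φ(g(x)/τ) u(x) dx ≤ 1}` of a non-negative
function `g`, with `inf ∅ = ∞`. -/
def luxNorm (Φ : ℝ≥0∞ → ℝ≥0∞) (u g : ℝ → ℝ≥0∞) : ℝ≥0∞ :=
  ⨅ (τ : ℝ≥0) (_ : 0 < τ) (_ : modular Φ u (fun x => g x / (τ : ℝ≥0∞)) ≤ 1), (τ : ℝ≥0∞)

/-- The quasi Dunkl–Hausdorff operator (adjoint of the Dunkl–Hausdorff operator)
`(H*f)(x) = x^{2α} ∫₀^∞ φ(y/x) / y^{2α+1} f(y) dy`, `x > 0`, for non-negative `φ` and `f`. -/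
def quasiDunklHausdorff (α : ℝ) (φ f : ℝ → ℝ≥0) (x : ℝ) : ℝ≥0∞ :=
  ENNReal.ofReal (x ^ (2 * α)) *
    ∫⁻ y in Ioi (0 : ℝ),
      (φ (y / x) : ℝ≥0∞) / ENNReal.ofReal (y ^ (2 * α + 1)) * (f y : ℝ≥0∞)

end

end DunklOrlicz

open DunklOrlicz

namespace DunklOrlicz

/-! ### N-functions: convexity, the inverse, and growth. -/

section NFunction

variable {p : ℝ≥0 → ℝ≥0}

/-! Write `μ` for the measure `v dx` and `V` for its primitive. The bounds on `φ` make the kernel of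
the quasi Dunkl–Hausdorff operator comparable to `1 / max x y` (`quasiDunklHausdorff_bounds`), so
only the Calderón operator matters.

The restriction to monotone functions is removed by writing them through `adjAverage μ g x = ∫_{t >
x} g / V dμ`. Such a function is non-increasing, and since `Φ ∈ Δ₂`, Hardy's inequality in modular
form (`exists_lintegral_nFun_adjAverage_le`) bounds its modular by that of a multiple of `g`.
Conversely, a non-increasing `f` lies below `adjAverage` of a function whose modular is at most that
of `4 f` (`le_adjAverage_primEnvelope`, `lintegral_nFun_primEnvelope_le`), provided `V > 0` on
`(0,∞)`; if `V` vanishes near `0`, the left side is shown to be zero. Hence the inequality on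
monotone functions amounts, up to constants, to one for the composition of the two operators on all
`g ≥ 0`. By Tonelli this has kernel `min(t,x)/x + log⁺(t/x)` against `g / V dμ`. It splits into the
part `t < x`, the plain tail and the logarithmic tail (`lintegral_calderonKernel_mul_eq`).

Necessity: restricting `x` to one side of `r` and `t` to the other bounds the composed kernel below
by each of the four product kernels. Duality turns the resulting inequality for all `g` into a
Luxemburg norm (`nInv_le_of_test`); rescaling the measure by `ε` normalises the modular of `g`.

Sufficiency: Hölder's inequality converts the norms back into test inequalities (`test_of_nInv_le`).
For each part of the operator, `(0,∞)` is cut at the points where that part takes the values `2^k`.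
By the doubling of levels, the integral over a single block recovers a quarter of the value at any
point between adjacent levels. Thus one test inequality per block suffices, and `Φ ≺ Ψ` sums them
over the disjoint blocks (`exists_majorant`). The logarithm is additive across a cut, `log(t/r) =
log(t/r') + log(r'/r)`, so its discretization leaves a plain tail with the coefficient `log(r'/r)`.
This is why two logarithmic conditions appear (`exists_majorant_log`). -/

theorem nFun_mono (p : ℝ≥0 → ℝ≥0) : Monotone (nFun p) := fun _ _ h =>
  lintegral_mono_set fun _ ht => ⟨ht.1, ht.2.trans h⟩

theorem measurable_nFun (p : ℝ≥0 → ℝ≥0) : Measurable (nFun p) := (nFun_mono p).measurable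

theorem nFun_zero (p : ℝ≥0 → ℝ≥0) : nFun p 0 = 0 := by
  have h : {t : ℝ | 0 ≤ t ∧ ENNReal.ofReal t ≤ 0} = {0} := by
    ext t
    simp only [mem_ofPred_eq, nonpos_iff_eq_zero, ENNReal.ofReal_eq_zero, mem_singleton_iff]
    exact ⟨fun h => le_antisymm h.2 h.1, fun h => by simp [h]⟩
  rw [nFun, h, Measure.restrict_singleton]
  simp

theorem measurable_generator (hp : Monotone p) :
    Measurable fun t : ℝ => (p t.toNNReal : ℝ≥0∞) :=
  (hp.measurable.comp measurable_real_toNNReal).coe_nnreal_ennreal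

theorem nFun_coe (p : ℝ≥0 → ℝ≥0) (x : ℝ≥0) :
    nFun p x = ∫⁻ t in Icc (0 : ℝ) x, (p t.toNNReal : ℝ≥0∞) := by
  rw [nFun]
  congr 2
  ext t
  simp only [mem_ofPred_eq, mem_Icc]
  refine and_congr_right fun ht => ?_
  rw [ENNReal.ofReal_le_iff_le_toReal (by simp)]
  simp

theorem nFun_add_setLIntegral {x y : ℝ≥0} (h : x ≤ y) :
    nFun p y = nFun p x + ∫⁻ t in Ioc (x : ℝ) y, (p t.toNNReal : ℝ≥0∞) := by
  rw [nFun_coe, nFun_coe, ← lintegral_union measurableSet_Ioc]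
  · rw [Icc_union_Ioc_eq_Icc x.coe_nonneg (NNReal.coe_le_coe.2 h)]
  · exact Set.disjoint_left.2 fun t h1 h2 => absurd h1.2 (not_le.2 h2.1)

theorem nFun_top (hp : Monotone p) {s : ℝ≥0} (hs : 0 < p s) : nFun p ∞ = ∞ := by
  rw [eq_top_iff]
  calc (∞ : ℝ≥0∞) = ∫⁻ _ in Ici (s : ℝ), (p s : ℝ≥0∞) := by
        rw [setLIntegral_const, Real.volume_Ici, ENNReal.mul_top]
        exact_mod_cast hs.ne'
    _ ≤ ∫⁻ t in Ici (s : ℝ), (p t.toNNReal : ℝ≥0∞) := by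
        refine setLIntegral_mono (measurable_generator hp) fun t ht => ?_
        exact_mod_cast hp (by simpa using Real.toNNReal_le_toNNReal (mem_Ici.1 ht))
    _ ≤ nFun p ∞ := lintegral_mono_set fun t ht => ⟨s.coe_nonneg.trans ht, le_top⟩

/-- The graph of `nFun p` lies above its supporting lines. -/
theorem nFun_supporting_line (hp : Monotone p) (x : ℝ≥0) (y : ℝ≥0∞) :
    nFun p x + p x * y ≤ nFun p y + p x * x := by
  induction y with
  | top =>
    rcases eq_or_ne (p x) 0 with h | h
    · simpa [h] using nFun_mono p le_top
    · simp [nFun_top hp (pos_iff_ne_zero.2 h)]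
  | coe y =>
    rcases le_total x y with h | h
    · rw [nFun_add_setLIntegral h]
      have h1 : (p x : ℝ≥0∞) * ((y - x : ℝ≥0) : ℝ≥0∞)
          ≤ ∫⁻ t in Ioc (x : ℝ) y, (p t.toNNReal : ℝ≥0∞) := by
        calc (p x : ℝ≥0∞) * ((y - x : ℝ≥0) : ℝ≥0∞)
            = ∫⁻ _ in Ioc (x : ℝ) y, (p x : ℝ≥0∞) := by
              rw [setLIntegral_const, Real.volume_Ioc, ← NNReal.coe_sub h, ENNReal.ofReal_coe_nnreal]
          _ ≤ _ := by
              refine setLIntegral_mono (measurable_generator hp) fun t ht => ?_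
              exact_mod_cast hp (by simpa using Real.toNNReal_le_toNNReal ht.1.le)
      have h2 : (p x : ℝ≥0∞) * y = p x * ((y - x : ℝ≥0) : ℝ≥0∞) + p x * x := by
        rw [← mul_add]; norm_cast; rw [tsub_add_cancel_of_le h]
      rw [h2, ← add_assoc]
      gcongr
    · rw [nFun_add_setLIntegral h]
      have h1 : ∫⁻ t in Ioc (y : ℝ) x, (p t.toNNReal : ℝ≥0∞)
          ≤ (p x : ℝ≥0∞) * ((x - y : ℝ≥0) : ℝ≥0∞) := by
        calc _ ≤ ∫⁻ _ in Ioc (y : ℝ) x, (p x : ℝ≥0∞) := by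
              refine setLIntegral_mono measurable_const fun t ht => ?_
              exact_mod_cast hp (by simpa using Real.toNNReal_le_toNNReal ht.2)
          _ = _ := by
              rw [setLIntegral_const, Real.volume_Ioc, ← NNReal.coe_sub h, ENNReal.ofReal_coe_nnreal]
      have h2 : (p x : ℝ≥0∞) * x = p x * ((x - y : ℝ≥0) : ℝ≥0∞) + p x * y := by
        rw [← mul_add]; norm_cast; rw [tsub_add_cancel_of_le h]
      rw [h2, ← add_assoc]
      gcongr

theorem nFun_le_mul (hp : Monotone p) (x : ℝ≥0) : nFun p x ≤ p x * x := by
  simpa [nFun_zero] using nFun_supporting_line hp x 0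

theorem nFun_lt_top (hp : Monotone p) (x : ℝ≥0) : nFun p x < ∞ :=
  (nFun_le_mul hp x).trans_lt (by finiteness)

theorem mul_generator_le (hp : Monotone p) (x : ℝ≥0) : (p x : ℝ≥0∞) * x ≤ nFun p (2 * x) := by
  have h := nFun_supporting_line hp x (2 * x)
  rw [two_mul, mul_add, ← add_assoc, ENNReal.add_le_add_iff_right (by finiteness)] at h
  rw [two_mul]
  exact le_add_self.trans h

/-- Convexity together with the value `0` at `0`: the supporting line at `x`, evaluated at `c * x`,
gains `(c - 1) * p x * x`, which is at least `(c - 1)` times the value at `x`. It is the device for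
moving outer constants into the argument. -/
theorem mul_nFun_le (hp : Monotone p) {c : ℝ≥0∞} (hc : 1 ≤ c) (x : ℝ≥0∞) :
    c * nFun p x ≤ nFun p (c * x) := by
  induction x with
  | top => rw [ENNReal.mul_top (by positivity)]
           rcases eq_or_ne (nFun p ∞) 0 with h | h
           · simp [h]
           · obtain ⟨s, hs⟩ : ∃ s, 0 < p s := by
               by_contra! hcon
               exact h (by simp [nFun, nonpos_iff_eq_zero.1 (hcon _)])
             rw [nFun_top hp hs]; exact le_top
  | coe x =>
    obtain ⟨d, rfl⟩ : ∃ d, c = 1 + d := ⟨c - 1, (add_tsub_cancel_of_le hc).symm⟩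
    have h := nFun_supporting_line hp x ((1 + d) * x)
    have h3 : (p x : ℝ≥0∞) * ((1 + d) * x) = d * (p x * x) + p x * x := by ring
    rw [h3, ← add_assoc, ENNReal.add_le_add_iff_right (by finiteness)] at h
    refine le_trans ?_ h
    rw [add_mul, one_mul]
    gcongr
    exact nFun_le_mul hp x

theorem nFun_add_le (p : ℝ≥0 → ℝ≥0) (a b : ℝ≥0∞) :
    nFun p (a + b) ≤ nFun p (2 * a) + nFun p (2 * b) := by
  rcases le_total a b with h | h
  · refine le_trans (nFun_mono p ?_) le_add_self
    rw [two_mul]; gcongr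
  · refine le_trans (nFun_mono p ?_) le_self_add
    rw [two_mul]; gcongr

/-- The integration sets increase to the limiting one up to at most the single point `⨆ n, u n`,
which is Lebesgue-null. -/
theorem nFun_iSup (p : ℝ≥0 → ℝ≥0) {u : ℕ → ℝ≥0∞} (hu : Monotone u) :
    nFun p (⨆ n, u n) = ⨆ n, nFun p (u n) := by
  have key : nFun p (⨆ n, u n) = ∫⁻ t in ⋃ n, {t : ℝ | 0 ≤ t ∧ ENNReal.ofReal t ≤ u n},
      (p t.toNNReal : ℝ≥0∞) := by
    rw [nFun]
    refine setLIntegral_congr ?_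
    have hsub : (⋃ n, {t : ℝ | 0 ≤ t ∧ ENNReal.ofReal t ≤ u n})
        ⊆ {t : ℝ | 0 ≤ t ∧ ENNReal.ofReal t ≤ ⨆ n, u n} :=
      iUnion_subset fun n t ht => ⟨ht.1, ht.2.trans (le_iSup u n)⟩
    have hdiff : {t : ℝ | 0 ≤ t ∧ ENNReal.ofReal t ≤ ⨆ n, u n} ⊆
        (⋃ n, {t : ℝ | 0 ≤ t ∧ ENNReal.ofReal t ≤ u n}) ∪ {(⨆ n, u n).toReal} := by
      rintro t ⟨h0, ht⟩
      rcases ht.lt_or_eq with h | h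
      · obtain ⟨n, hn⟩ := lt_iSup_iff.1 h
        exact Or.inl (mem_iUnion.2 ⟨n, h0, hn.le⟩)
      · right
        simp [← h, h0]
    refine (LE.le.eventuallyLE hsub).antisymm ?_ |>.symm
    refine (LE.le.eventuallyLE hdiff).trans (union_ae_eq_left_of_ae_eq_empty ?_).le
    simp
  rw [key, setLIntegral_iUnion_of_directed]
  · rfl
  · refine (directed_of_isDirected_le fun m n h t ht => ⟨ht.1, ht.2.trans (hu h)⟩)

theorem IsNGenerator.nFun_top (hp : IsNGenerator p) : nFun p ∞ = ∞ :=
  DunklOrlicz.nFun_top hp.monotone (hp.pos 1 one_pos)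

theorem IsNGenerator.strictMono_nFun (hp : IsNGenerator p) : StrictMono (nFun p) := by
  intro x y hxy
  obtain ⟨m, hxm, hmy⟩ := ENNReal.lt_iff_exists_nnreal_btwn.1 hxy
  have h := nFun_supporting_line hp.monotone m y
  have hm : 0 < p m := hp.pos m (by exact_mod_cast zero_le.trans_lt hxm)
  have h1 : (p m : ℝ≥0∞) * m < p m * y :=
    ENNReal.mul_lt_mul_right (by exact_mod_cast hm.ne') (by simp) hmy
  have h2 := nFun_mono p hxm.le
  by_contra! hcon
  have h3 : nFun p m + p m * y ≤ nFun p m + p m * m :=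
    h.trans (by gcongr; exact hcon.trans h2)
  rw [ENNReal.add_le_add_iff_left (nFun_lt_top hp.monotone m).ne] at h3
  exact absurd h1 (not_lt.2 h3)

theorem IsNGenerator.nFun_eq_zero (hp : IsNGenerator p) {x : ℝ≥0∞} : nFun p x = 0 ↔ x = 0 := by
  constructor
  · intro h
    exact hp.strictMono_nFun.injective (h.trans (nFun_zero p).symm)
  · rintro rfl
    exact nFun_zero p

/-- This Galois connection lets every inequality between inverses be handled as an inequality
between modulars; its nontrivial half is right-continuity of `nFun p`. -/
theorem IsNGenerator.nInv_le_iff (hp : IsNGenerator p) {y z : ℝ≥0∞} :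
    nInv (nFun p) y ≤ z ↔ y ≤ nFun p z := by
  constructor
  · intro h
    by_contra! hlt
    induction z with
    | top => simp [hp.nFun_top] at hlt
    | coe z =>
      obtain ⟨η, hη, hη'⟩ : ∃ η : ℝ≥0, 0 < η ∧ nFun p z + η < y := by
        obtain ⟨w, hw1, hw2⟩ := ENNReal.lt_iff_exists_nnreal_btwn.1 hlt
        obtain ⟨η, hη, h'⟩ := ENNReal.lt_iff_exists_add_pos_lt.1 hw1
        exact ⟨η, hη, h'.trans hw2⟩
      -- `b` bounds the generator on `[z, z + 1]`, so a step `δ ≤ min 1 (η / b)` raises `nFun p` by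
      -- at most `η`.
      set b : ℝ≥0 := p (z + 1) + 1
      set δ : ℝ≥0 := min 1 (η / b)
      have hb : 0 < b := by positivity
      have hδ : 0 < δ := lt_min one_pos (by positivity)
      have hx : nFun p (z + δ : ℝ≥0) ≤ y := by
        have h1 := nFun_supporting_line hp.monotone (z + δ) z
        have h2 : (p (z + δ) : ℝ≥0∞) * δ ≤ η := by
          have : p (z + δ) * δ ≤ η := by
            calc p (z + δ) * δ ≤ b * (η / b) := by
                  gcongr
                  · exact (hp.monotone (add_le_add_right (min_le_left _ _) z)).trans (by simp [b])
                  · exact min_le_right _ _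
              _ = η := by field_simp
          exact_mod_cast this
        rw [ENNReal.coe_add, mul_add, ← ENNReal.coe_add, add_comm (_ * (z : ℝ≥0∞)), ← add_assoc,
          ENNReal.add_le_add_iff_right (by finiteness)] at h1
        exact (h1.trans (by gcongr)).trans hη'.le
      have h4 : ((z + δ : ℝ≥0) : ℝ≥0∞) ≤ z := (le_sSup (show _ ∈ {x | nFun p x ≤ y} from hx)).trans h
      have : z + δ ≤ z := by exact_mod_cast h4
      exact absurd this (not_le.2 (lt_add_of_pos_right z hδ))
  · intro h
    exact sSup_le fun x hx => hp.strictMono_nFun.le_iff_le.1 (le_trans hx h)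

theorem nInv_top (Φ : ℝ≥0∞ → ℝ≥0∞) : nInv Φ ∞ = ∞ := by
  simp [nInv, sSup_univ]

theorem nInv_mono (Φ : ℝ≥0∞ → ℝ≥0∞) : Monotone (nInv Φ) := fun _ _ h =>
  sSup_le_sSup fun _ hx => le_trans hx h

/-- `Prec` for sequences with values in `[0,∞]` indexed by the integers. -/
theorem Prec.tsum_int_le {Φ Ψ : ℝ≥0∞ → ℝ≥0∞} (hΨ : Ψ ∞ = ∞) (h : Prec Φ Ψ) :
    ∃ C : ℝ≥0, 1 ≤ C ∧ ∀ a : ℤ → ℝ≥0∞,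
      ∑' i, Ψ (nInv Φ (a i)) ≤ C * Ψ (nInv Φ (∑' i, a i)) := by
  obtain ⟨C, hC, h⟩ := h
  refine ⟨max C 1, le_max_right _ _, fun a => ?_⟩
  by_cases ha : ∃ i, a i = ∞
  · obtain ⟨i, hi⟩ := ha
    rw [ENNReal.tsum_eq_top_of_eq_top ⟨i, hi⟩, nInv_top, hΨ, ENNReal.mul_top]
    · exact le_top
    · have : 0 < max C 1 := by positivity
      exact_mod_cast this.ne'
  · push Not at ha
    have h1 := h fun n => (a (Equiv.intEquivNat.symm n)).toNNReal
    simp only [ENNReal.coe_toNNReal (ha _)] at h1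
    rw [Equiv.tsum_eq Equiv.intEquivNat.symm a,
      Equiv.tsum_eq Equiv.intEquivNat.symm fun i => Ψ (nInv Φ (a i))] at h1
    refine h1.trans ?_
    gcongr
    exact le_max_left _ _

/-! ### The complementary function and Young's inequality. -/

section Complementary

theorem IsNGenerator.bddAbove (hp : IsNGenerator p) (t : ℝ≥0) : BddAbove {s : ℝ≥0 | p s ≤ t} := by
  obtain ⟨b, hb⟩ := (hp.tendsto_atTop.eventually_gt_atTop t).exists
  refine ⟨b, fun s hs => ?_⟩
  by_contra! hlt
  exact absurd (hb.trans_le (hp.monotone hlt.le)) (not_lt.2 hs)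

theorem IsNGenerator.monotone_complGen (hp : IsNGenerator p) : Monotone (complGen p) := fun s t h =>
  csSup_le_csSup (hp.bddAbove t) ⟨0, by simp [hp.map_zero]⟩ fun _ hx => le_trans hx h

theorem IsNGenerator.le_complGen (hp : IsNGenerator p) {s t : ℝ≥0} (h : p s ≤ t) :
    s ≤ complGen p t := le_csSup (hp.bddAbove t) h

theorem IsNGenerator.nFun_complGen_top (hp : IsNGenerator p) : nFun (complGen p) ∞ = ∞ :=
  DunklOrlicz.nFun_top hp.monotone_complGen (s := p 1)
    (lt_of_lt_of_le one_pos (hp.le_complGen le_rfl))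

theorem IsNGenerator.nFun_comp_complGen_le (hp : IsNGenerator p) (t : ℝ≥0) :
    nFun p (complGen p t) ≤ t * complGen p t := by
  rw [nFun_coe, setLIntegral_congr Ico_ae_eq_Icc.symm]
  calc _ ≤ ∫⁻ _ in Ico (0 : ℝ) (complGen p t), (t : ℝ≥0∞) := by
        refine setLIntegral_mono measurable_const fun s hs => ?_
        have h1 : s.toNNReal < complGen p t := by
          rw [← NNReal.coe_lt_coe, Real.coe_toNNReal _ hs.1]; exact hs.2
        obtain ⟨u, hu, hlt⟩ := exists_lt_of_lt_csSup ⟨0, by simp [hp.map_zero]⟩ h1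
        exact_mod_cast (hp.monotone hlt.le).trans hu
    _ = _ := by rw [setLIntegral_const, Real.volume_Ico]; simp

/-- A form of Young's inequality. -/
theorem IsNGenerator.mul_le_nFun_add (hp : IsNGenerator p) (s t : ℝ≥0∞) :
    s * t ≤ 4 * (nFun p s + nFun (complGen p) t) := by
  rcases eq_or_ne s 0 with rfl | hs
  · simp
  rcases eq_or_ne t 0 with rfl | ht
  · simp
  rcases eq_or_ne s ∞ with rfl | hs'
  · simp [hp.nFun_top]
  rcases eq_or_ne t ∞ with rfl | ht'
  · simp [hp.nFun_complGen_top]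
  lift s to ℝ≥0 using hs'
  lift t to ℝ≥0 using ht'
  have key : ((s / 2 : ℝ≥0) : ℝ≥0∞) * ((t / 2 : ℝ≥0) : ℝ≥0∞)
      ≤ nFun p s + nFun (complGen p) t := by
    have e1 : (2 : ℝ≥0∞) * ((s / 2 : ℝ≥0) : ℝ≥0∞) = s := by norm_cast; field_simp
    have e2 : (2 : ℝ≥0∞) * ((t / 2 : ℝ≥0) : ℝ≥0∞) = t := by norm_cast; field_simp
    -- If `t/2 ≤ p(s/2)`, the product is at most `(s/2) p(s/2) ≤ Φ(s)`. Otherwise `s/2 ≤ p̃(t/2)`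
    -- and the same estimate applies to the complementary function. Halving both factors produces
    -- the constant `4`.
    rcases le_total (t / 2) (p (s / 2)) with h | h
    · refine le_trans ?_ le_self_add
      rw [← e1]
      refine le_trans ?_ (mul_generator_le hp.monotone _)
      rw [mul_comm]
      gcongr
    · refine le_trans ?_ le_add_self
      rw [← e2]
      refine le_trans ?_ (mul_generator_le hp.monotone_complGen _)
      gcongr
      exact hp.le_complGen h
  calc (s : ℝ≥0∞) * t = 4 * (((s / 2 : ℝ≥0) : ℝ≥0∞) * ((t / 2 : ℝ≥0) : ℝ≥0∞)) := by
        norm_cast; field_simp; norm_num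
    _ ≤ _ := by gcongr

end Complementary

/-- Iterating the `Δ₂` condition: polynomial growth. -/
theorem Delta2.exists_rpow_bound {Φ : ℝ≥0∞ → ℝ≥0∞} (hmono : Monotone Φ) (h0 : Φ 0 = 0)
    (h : Delta2 Φ) : ∃ m : ℕ, 0 < m ∧ ∀ (l : ℝ) (t : ℝ≥0), 1 ≤ l →
      Φ (ENNReal.ofReal l * t) ≤ 2 ^ m * ENNReal.ofReal (l ^ m) * Φ t := by
  obtain ⟨β, -, hβ⟩ := h
  obtain ⟨m, hm⟩ := pow_unbounded_of_one_lt β (one_lt_two (α := ℝ≥0))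
  have h2 : ∀ t : ℝ≥0, Φ (2 * t) ≤ 2 ^ (m + 1) * Φ t := by
    intro t
    rcases eq_or_ne t 0 with rfl | ht
    · simp [h0]
    · refine (hβ t (pos_iff_ne_zero.2 ht)).trans ?_
      gcongr
      exact_mod_cast hm.le.trans (pow_le_pow_right₀ one_le_two (Nat.le_succ m))
  have hn : ∀ (n : ℕ) (t : ℝ≥0), Φ (2 ^ n * t) ≤ 2 ^ ((m + 1) * n) * Φ t := by
    intro n
    induction n with
    | zero => simp
    | succ n ih =>
      intro t
      have := h2 (2 ^ n * t)
      push_cast at this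
      calc Φ (2 ^ (n + 1) * t) = Φ (2 * (2 ^ n * t)) := by ring_nf
        _ ≤ _ := this
        _ ≤ 2 ^ (m + 1) * (2 ^ ((m + 1) * n) * Φ t) := by gcongr; exact ih t
        _ = _ := by ring
  refine ⟨m + 1, Nat.succ_pos m, fun l t hl => ?_⟩
  -- With `2^n ≤ l < 2^(n+1)`, rounding up costs one extra doubling; this is the factor `2^(m+1)`.
  obtain ⟨n, hn1, hn2⟩ := exists_nat_pow_near hl one_lt_two
  have e1 : ENNReal.ofReal l ≤ 2 ^ (n + 1) := by
    refine (ENNReal.ofReal_le_ofReal hn2.le).trans ?_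
    rw [ENNReal.ofReal_pow (by norm_num)]; simp
  have e2 : (2 : ℝ≥0∞) ^ ((m + 1) * n) ≤ ENNReal.ofReal (l ^ (m + 1)) := by
    refine le_trans ?_ (ENNReal.ofReal_le_ofReal (pow_le_pow_left₀ (by positivity) hn1 (m + 1)))
    rw [← pow_mul, mul_comm n, ENNReal.ofReal_pow (by norm_num)]; simp
  calc Φ (ENNReal.ofReal l * t) ≤ Φ (2 ^ (n + 1) * t) := hmono (by gcongr)
    _ ≤ 2 ^ ((m + 1) * (n + 1)) * Φ t := hn _ t
    _ = 2 ^ (m + 1) * 2 ^ ((m + 1) * n) * Φ t := by ring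
    _ ≤ _ := by gcongr

end NFunction

end DunklOrlicz

namespace DunklOrlicz

/-! ### Monotone approximation by truncations. -/

section Truncation

/-- Truncation of `h` in height and to the set `s n`. -/
noncomputable def trunc (s : ℕ → Set ℝ) (h : ℝ → ℝ≥0∞) (n : ℕ) : ℝ → ℝ≥0∞ :=
  (s n).indicator fun x => min (h x) n

variable {s : ℕ → Set ℝ} {h : ℝ → ℝ≥0∞}

theorem measurable_trunc (hs : ∀ n, MeasurableSet (s n)) (hh : Measurable h) (n : ℕ) :
    Measurable (trunc s h n) := (hh.min measurable_const).indicator (hs n)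

theorem trunc_le_natCast (s : ℕ → Set ℝ) (h : ℝ → ℝ≥0∞) (n : ℕ) (x : ℝ) : trunc s h n x ≤ n := by
  by_cases hx : x ∈ s n <;> simp [trunc, hx]

theorem trunc_le (s : ℕ → Set ℝ) (h : ℝ → ℝ≥0∞) (n : ℕ) (x : ℝ) : trunc s h n x ≤ h x := by
  by_cases hx : x ∈ s n <;> simp [trunc, hx]

theorem trunc_of_notMem {n : ℕ} {x : ℝ} (hx : x ∉ s n) : trunc s h n x = 0 := by
  simp [trunc, hx]

theorem monotone_trunc (hs : Monotone s) (h : ℝ → ℝ≥0∞) : Monotone (trunc s h) := by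
  intro m n hmn x
  by_cases hx : x ∈ s m
  · have hx' : x ∈ s n := hs hmn hx
    simp only [trunc, hx, hx', indicator_of_mem]
    gcongr
  · rw [trunc_of_notMem hx]
    exact zero_le

theorem iSup_trunc (hs : Monotone s) {x : ℝ} (hx : ∃ n, x ∈ s n) : ⨆ n, trunc s h n x = h x := by
  obtain ⟨m, hm⟩ := hx
  refine le_antisymm (iSup_le fun n => trunc_le s h n x) ?_
  refine le_of_forall_lt fun c hc => ?_
  obtain ⟨n, hn⟩ := ENNReal.exists_nat_gt (hc.trans_le le_top).ne
  refine lt_of_lt_of_le ?_ (le_iSup _ (max m n))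
  have hx' : x ∈ s (max m n) := hs (le_max_left m n) hm
  simp only [trunc, hx', indicator_of_mem, lt_min_iff]
  exact ⟨hc, hn.trans_le (by exact_mod_cast le_max_right m n)⟩

end Truncation

/-! ### Duality for Luxemburg norms, and norm conditions versus test inequalities. -/

section Duality

/-- The Luxemburg norm with respect to a measure. -/
noncomputable def luxNormMeasure (Φ : ℝ≥0∞ → ℝ≥0∞) (ν : Measure ℝ) (h : ℝ → ℝ≥0∞) : ℝ≥0∞ :=
  ⨅ (τ : ℝ≥0) (_ : 0 < τ) (_ : ∫⁻ x, Φ (h x / τ) ∂ν ≤ 1), (τ : ℝ≥0∞)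

variable {p q : ℝ≥0 → ℝ≥0}

/-- Hölder's inequality in Orlicz spaces, with a non-optimal constant. -/
theorem lintegral_mul_le_luxNormMeasure (hp : IsNGenerator p) {ν : Measure ℝ}
    {h g : ℝ → ℝ≥0∞} (hg : Measurable g) (hg1 : ∫⁻ x, nFun p (g x) ∂ν ≤ 1) :
    ∫⁻ x, h x * g x ∂ν ≤ 8 * luxNormMeasure (nFun (complGen p)) ν h := by
  rw [luxNormMeasure]
  simp only [ENNReal.mul_iInf_of_ne (by norm_num : (8 : ℝ≥0∞) ≠ 0) (by norm_num : (8 : ℝ≥0∞) ≠ ∞)]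
  refine le_iInf fun τ => le_iInf fun hτ => le_iInf fun hmod => ?_
  have hτ0 : (τ : ℝ≥0∞) ≠ 0 := by exact_mod_cast hτ.ne'
  calc ∫⁻ x, h x * g x ∂ν
      ≤ ∫⁻ x, 4 * τ * (nFun p (g x) + nFun (complGen p) (h x / τ)) ∂ν := by
        refine lintegral_mono fun x => ?_
        calc h x * g x = τ * (g x * (h x / τ)) := by
              rw [mul_comm (g x), ← mul_assoc, ENNReal.mul_div_cancel hτ0 (by simp)]
          _ ≤ τ * (4 * (nFun p (g x) + nFun (complGen p) (h x / τ))) := by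
              exact mul_le_mul_right (hp.mul_le_nFun_add _ _) _
          _ = _ := by ring
    _ = 4 * τ * (∫⁻ x, nFun p (g x) ∂ν + ∫⁻ x, nFun (complGen p) (h x / τ) ∂ν) := by
        rw [lintegral_const_mul' _ _ (by finiteness),
          lintegral_add_left (show Measurable fun x => nFun p (g x) from
            (measurable_nFun p).comp hg)]
    _ ≤ 4 * τ * (1 + 1) := by gcongr
    _ = 8 * τ := by ring

/-- The extremal function is `p̃(k)`. If `M = ∫ k p̃(k) dν` exceeded `1`, then `p̃(k) / M` would
have modular at most `1`, by convexity and `Φ(p̃(t)) ≤ t p̃(t)`, yet pairing it with `N' k` would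
give `N' > N`. So `M ≤ 1`, and `Φ̃(k) ≤ k p̃(k)`. -/
theorem lintegral_nFun_complGen_le_one (hp : IsNGenerator p) {ν : Measure ℝ}
    {k : ℝ → ℝ≥0} (hk : Measurable k) {N : ℝ≥0∞} {N' : ℝ≥0} (hNN' : N < N')
    (hfin : ∫⁻ x, (k x : ℝ≥0∞) * complGen p (k x) ∂ν ≠ ∞)
    (hN : ∀ g : ℝ → ℝ≥0∞, Measurable g → ∫⁻ x, nFun p (g x) ∂ν ≤ 1 →
      ∫⁻ x, N' * k x * g x ∂ν ≤ N) :
    ∫⁻ x, nFun (complGen p) (k x) ∂ν ≤ 1 := by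
  set M := ∫⁻ x, (k x : ℝ≥0∞) * complGen p (k x) ∂ν with hM
  have hmeas : Measurable fun x => (complGen p (k x) : ℝ≥0∞) :=
    (hp.monotone_complGen.measurable.comp hk).coe_nnreal_ennreal
  suffices h : M ≤ 1 by
    refine le_trans (lintegral_mono fun x => ?_) h
    rw [mul_comm]
    exact nFun_le_mul hp.monotone_complGen _
  by_contra! hcon
  have hM0 : M ≠ 0 := (zero_lt_one.trans hcon).ne'
  have h1 := hN (fun x => complGen p (k x) / M) (hmeas.div_const _) (by
    have : M * ∫⁻ x, nFun p (complGen p (k x) / M) ∂ν ≤ M * 1 := by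
      rw [← lintegral_const_mul' _ _ hfin, mul_one, hM]
      refine lintegral_mono fun x => ?_
      refine (mul_nFun_le hp.monotone hcon.le _).trans ?_
      rw [ENNReal.mul_div_cancel hM0 hfin]
      exact hp.nFun_comp_complGen_le _
    exact (ENNReal.mul_le_mul_iff_right hM0 hfin).1 this)
  have h2 : ∫⁻ x, N' * k x * (complGen p (k x) / M) ∂ν = N' := by
    calc _ = ∫⁻ x, N' * M⁻¹ * (k x * complGen p (k x)) ∂ν := by
          refine lintegral_congr fun x => ?_
          rw [div_eq_mul_inv]; ring
      _ = N' * M⁻¹ * M := lintegral_const_mul' _ _ (by finiteness)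
      _ = N' := by rw [mul_assoc, ENNReal.inv_mul_cancel hM0 hfin, mul_one]
  rw [h2] at h1
  exact absurd hNN' (not_lt.2 h1)

/-- The Luxemburg norm is bounded by the dual norm. -/
theorem luxNormMeasure_le (hp : IsNGenerator p) {ν : Measure ℝ} (hν : ∀ x, ν (Iio x) < ∞)
    {h : ℝ → ℝ≥0∞} (hh : Measurable h) {N : ℝ≥0∞}
    (hN : ∀ g : ℝ → ℝ≥0∞, Measurable g → ∫⁻ x, nFun p (g x) ∂ν ≤ 1 → ∫⁻ x, h x * g x ∂ν ≤ N) :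
    luxNormMeasure (nFun (complGen p)) ν h ≤ N := by
  by_contra! hcon
  obtain ⟨N', hNN', hlt⟩ := ENNReal.lt_iff_exists_nnreal_btwn.1 hcon
  refine absurd hlt (not_lt.2 ?_)
  have hpos : 0 < N' := by exact_mod_cast zero_le.trans_lt hNN'
  have hN0 : (N' : ℝ≥0∞) ≠ 0 := by exact_mod_cast hpos.ne'
  refine iInf_le_of_le N' (iInf_le_of_le hpos (iInf_le_of_le ?_ le_rfl))
  -- Truncating in height and to `Iio n`, a set of finite measure, supplies the finiteness of `∫ k
  -- p̃(k)` needed by `lintegral_nFun_complGen_le_one`; monotone convergence then restores `h`.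
  set t : ℕ → ℝ → ℝ≥0∞ := trunc (fun n => Iio (n : ℝ)) h with ht
  have hs : Monotone fun n : ℕ => Iio (n : ℝ) := fun m n hmn => Iio_subset_Iio (by exact_mod_cast hmn)
  let k : ℕ → ℝ → ℝ≥0∞ := fun n x => t n x / N'
  have hkm : ∀ n, Measurable (k n) := fun n =>
    (measurable_trunc (fun _ => measurableSet_Iio) hh n).div_const _
  have hkle : ∀ n x, k n x ≤ n / N' := fun n x =>
    ENNReal.div_le_div_right (trunc_le_natCast _ h n x) _
  have hkfin : ∀ n x, k n x ≠ ∞ := fun n x =>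
    ((hkle n x).trans_lt (ENNReal.div_lt_top (by simp) hN0)).ne
  have hkmono : Monotone k := fun m n hmn x =>
    ENNReal.div_le_div_right (monotone_trunc hs h hmn x) _
  have hksup : ∀ x, h x / N' = ⨆ n, k n x := fun x => by
    rw [← iSup_trunc hs (h := h) (exists_nat_gt x)]
    simp only [k, div_eq_mul_inv, ENNReal.iSup_mul]
    rfl
  have hk1 : ∀ n, ∫⁻ x, nFun (complGen p) (k n x) ∂ν ≤ 1 := fun n => by
    have := lintegral_nFun_complGen_le_one hp (ν := ν) (k := fun x => (k n x).toNNReal)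
      (hkm n).ennreal_toNNReal hNN' ?_ fun g hg hg1 => ?_
    · simpa only [ENNReal.coe_toNNReal (hkfin n _)] using this
    · set b : ℝ≥0 := n / N' with hb
      refine ne_of_lt (lt_of_le_of_lt (b := ∫⁻ _ in Iio (n : ℝ), b * complGen p b ∂ν) ?_ ?_)
      · rw [← lintegral_indicator measurableSet_Iio]
        refine lintegral_mono fun x => ?_
        by_cases hx : x ∈ Iio (n : ℝ)
        · have h1 : (k n x).toNNReal ≤ b := by
            rw [← ENNReal.coe_le_coe, ENNReal.coe_toNNReal (hkfin n x), hb, ENNReal.coe_div hpos.ne']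
            exact hkle n x
          rw [indicator_of_mem hx]
          gcongr
          exact hp.monotone_complGen h1
        · have h0 : t n x = 0 := trunc_of_notMem (s := fun n : ℕ => Iio (n : ℝ)) hx
          simp [k, h0]
      · rw [setLIntegral_const]
        exact ENNReal.mul_lt_top (by finiteness) (hν _)
    · refine le_trans (lintegral_mono fun x => ?_) (hN g hg hg1)
      rw [ENNReal.coe_toNNReal (hkfin n x), ENNReal.mul_div_cancel hN0 (by simp)]
      gcongr
      exact trunc_le _ h n x
  calc ∫⁻ x, nFun (complGen p) (h x / N') ∂ν = ∫⁻ x, ⨆ n, nFun (complGen p) (k n x) ∂ν := by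
        refine lintegral_congr fun x => ?_
        rw [hksup, nFun_iSup _ fun m n hmn => hkmono hmn x]
    _ = ⨆ n, ∫⁻ x, nFun (complGen p) (k n x) ∂ν :=
        lintegral_iSup (fun n => (measurable_nFun _).comp (hkm n))
          fun m n hmn x => nFun_mono _ (hkmono hmn x)
    _ ≤ 1 := iSup_le hk1

/-- The norm is at most the supremum of the numbers `∫ h g dν`, none of which depends on the outer
variable `x`. One increasing sequence of such numbers therefore serves all `x`, and monotone
convergence takes the supremum out of the outer integral. -/
theorem lintegral_luxNormMeasure_le (hp : IsNGenerator p) {ν ω : Measure ℝ}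
    (hν : ∀ x, ν (Iio x) < ∞) {h c : ℝ → ℝ≥0∞} (hh : Measurable h) (hc : AEMeasurable c ω)
    {B : ℝ≥0∞}
    (hB : ∀ g : ℝ → ℝ≥0∞, Measurable g → ∫⁻ x, nFun p (g x) ∂ν ≤ 1 →
      ∫⁻ x, nFun q (c x * ∫⁻ y, h y * g y ∂ν) ∂ω ≤ B) :
    ∫⁻ x, nFun q (c x * luxNormMeasure (nFun (complGen p)) ν h) ∂ω ≤ B := by
  set S : Set ℝ≥0∞ := {a | ∃ g : ℝ → ℝ≥0∞, Measurable g ∧ ∫⁻ x, nFun p (g x) ∂ν ≤ 1 ∧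
    a = ∫⁻ x, h x * g x ∂ν} with hS
  obtain ⟨u, hu, hlim, huS⟩ := exists_seq_tendsto_sSup (S := S)
    ⟨_, 0, measurable_zero, by simp [nFun_zero], rfl⟩ (OrderTop.bddAbove S)
  have hsup : luxNormMeasure (nFun (complGen p)) ν h ≤ ⨆ n, u n := by
    rw [tendsto_nhds_unique (tendsto_atTop_iSup hu) hlim]
    exact luxNormMeasure_le hp hν hh fun g hg hg1 => le_sSup ⟨g, hg, hg1, rfl⟩
  calc _ ≤ ∫⁻ x, nFun q (⨆ n, c x * u n) ∂ω := by
        refine lintegral_mono fun x => nFun_mono q ?_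
        rw [← ENNReal.mul_iSup]
        gcongr
    _ = ∫⁻ x, ⨆ n, nFun q (c x * u n) ∂ω := by
        refine lintegral_congr fun x => nFun_iSup q fun m n hmn => ?_
        gcongr
        exact hu hmn
    _ = ⨆ n, ∫⁻ x, nFun q (c x * u n) ∂ω := by
        refine lintegral_iSup' (fun n => (measurable_nFun q).comp_aemeasurable (hc.mul_const _)) ?_
        refine ae_of_all _ fun x m n hmn => nFun_mono q ?_
        gcongr
        exact hu hmn
    _ ≤ B := by
        refine iSup_le fun n => ?_
        obtain ⟨g, hg, hg1, he⟩ := huS n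
        rw [he]
        exact hB g hg hg1

/-- A test inequality for the functional `g ↦ ∫ h g dμ` follows from its formulation with
Luxemburg norms. -/
theorem test_of_luxNorm (hp : IsNGenerator p) (hq : IsNGenerator q) {μ ω : Measure ℝ}
    {h c : ℝ → ℝ≥0∞}
    (H : ∀ ε : ℝ≥0, 0 < ε → ∫⁻ x, nFun q (c x *
      luxNormMeasure (nFun (complGen p)) ((ε : ℝ≥0∞) • μ) (fun y => h y / ε)) ∂ω
        ≤ nFun q (nInv (nFun p) (1 / ε)))
    {g : ℝ → ℝ≥0∞} (hg : Measurable g) :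
    ∫⁻ x, nFun q (c x / 8 * ∫⁻ y, h y * g y ∂μ) ∂ω
      ≤ nFun q (nInv (nFun p) (∫⁻ y, nFun p (g y) ∂μ)) := by
  set a := ∫⁻ y, nFun p (g y) ∂μ with ha
  rcases eq_or_ne a 0 with h0 | h0
  · have h1 : (fun y => nFun p (g y)) =ᵐ[μ] 0 :=
      (lintegral_eq_zero_iff ((measurable_nFun p).comp hg)).1 h0
    have h2 : ∫⁻ y, h y * g y ∂μ = 0 := by
      rw [lintegral_congr_ae (g := fun _ => 0), lintegral_zero]
      filter_upwards [h1] with y hy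
      rw [hp.nFun_eq_zero.1 hy, mul_zero]
    simp [h2, nFun_zero]
  rcases eq_or_ne a ∞ with h1 | h1
  · rw [h1, nInv_top, hq.nFun_top]; exact le_top
  -- With `ε = 1 / ∫ Φ(g) dμ`, `g` has modular exactly `1` under `ε μ`, so Hölder's inequality
  -- applies; its constant `8` is the one dividing `c`.
  have hε : 0 < a.toNNReal⁻¹ := inv_pos.2 (ENNReal.toNNReal_pos h0 h1)
  set ε : ℝ≥0 := a.toNNReal⁻¹ with hεdef
  have hεa : (ε : ℝ≥0∞) * a = 1 := by
    rw [hεdef, ENNReal.coe_inv (ENNReal.toNNReal_pos h0 h1).ne', ENNReal.coe_toNNReal h1,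
      ENNReal.inv_mul_cancel h0 h1]
  have hε0 : (ε : ℝ≥0∞) ≠ 0 := by exact_mod_cast hε.ne'
  have hinv : (1 : ℝ≥0∞) / ε = a := by
    rw [← hεa, mul_comm, ENNReal.mul_div_cancel_right hε0 (by simp)]
  have H1 := H ε hε
  rw [hinv] at H1
  refine le_trans (lintegral_mono fun x => nFun_mono q ?_) H1
  have h3 := lintegral_mul_le_luxNormMeasure hp (ν := (ε : ℝ≥0∞) • μ) (h := fun y => h y / ε) hg
    (by rw [lintegral_smul_measure, smul_eq_mul, hεa])
  have h4 : ∫⁻ y, h y / ε * g y ∂((ε : ℝ≥0∞) • μ) = ∫⁻ y, h y * g y ∂μ := by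
    rw [lintegral_smul_measure, smul_eq_mul, ← lintegral_const_mul' _ _ (by simp)]
    refine lintegral_congr fun y => ?_
    rw [← mul_assoc, ENNReal.mul_div_cancel hε0 (by simp)]
  rw [h4] at h3
  calc c x / 8 * ∫⁻ y, h y * g y ∂μ ≤ c x / 8 * (8 * _) := by gcongr
    _ = _ := by
      rw [← mul_assoc, ENNReal.div_mul_cancel (by norm_num) (by norm_num)]

/-- A `g` of modular at most `1` under `ε μ` has modular at most `1/ε` under `μ`, while the factors
`ε` in `h / ε` and in the measure cancel in the pairing. -/
theorem luxNorm_of_test (hp : IsNGenerator p) {μ ω : Measure ℝ}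
    (hμ : ∀ x, μ (Iio x) < ∞) {h c : ℝ → ℝ≥0∞} (hh : Measurable h) (hc : AEMeasurable c ω)
    (H : ∀ g : ℝ → ℝ≥0∞, Measurable g → ∫⁻ x, nFun q (c x * ∫⁻ y, h y * g y ∂μ) ∂ω
      ≤ nFun q (nInv (nFun p) (∫⁻ y, nFun p (g y) ∂μ)))
    {ε : ℝ≥0} (hε : 0 < ε) :
    ∫⁻ x, nFun q (c x *
      luxNormMeasure (nFun (complGen p)) ((ε : ℝ≥0∞) • μ) (fun y => h y / ε)) ∂ω
        ≤ nFun q (nInv (nFun p) (1 / ε)) := by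
  have hε0 : (ε : ℝ≥0∞) ≠ 0 := by exact_mod_cast hε.ne'
  refine lintegral_luxNormMeasure_le hp (fun x => ?_) (hh.div_const _) hc fun g hg hg1 => ?_
  · rw [Measure.smul_apply, smul_eq_mul]
    exact ENNReal.mul_lt_top (by simp) (hμ x)
  · rw [lintegral_smul_measure, smul_eq_mul] at hg1
    have h4 : ∫⁻ y, h y / ε * g y ∂((ε : ℝ≥0∞) • μ) = ∫⁻ y, h y * g y ∂μ := by
      rw [lintegral_smul_measure, smul_eq_mul, ← lintegral_const_mul' _ _ (by simp)]
      refine lintegral_congr fun y => ?_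
      rw [← mul_assoc, ENNReal.mul_div_cancel hε0 (by simp)]
    rw [h4]
    refine (H g hg).trans (nFun_mono q (nInv_mono _ ?_))
    rw [ENNReal.le_div_iff_mul_le (Or.inl hε0) (by simp), mul_comm]
    exact hg1

end Duality

end DunklOrlicz

namespace DunklOrlicz

/-! ### Intermediate values of tails of atomless measures. -/

section IntermediateValue

theorem continuous_of_le_add_measure_uIcc {ν : Measure ℝ} [IsLocallyFiniteMeasure ν]
    [NullSingletonClass ν] {F : ℝ → ℝ≥0∞} (hF : ∀ x, F x ≠ ∞)
    (h : ∀ x y, F y ≤ F x + ν (uIcc x y)) : Continuous F := by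
  refine continuous_iff_continuousAt.2 fun x => (ENNReal.tendsto_nhds (hF x)).2 fun ε hε => ?_
  obtain ⟨U, hxU, hU, hUε⟩ := ({x} : Set ℝ).exists_isOpen_lt_of_lt (μ := ν) ε (by simpa using hε)
  obtain ⟨δ, hδ, hball⟩ := Metric.isOpen_iff.1 hU x (hxU rfl)
  filter_upwards [Metric.ball_mem_nhds x hδ] with y hy
  have hsub : uIcc x y ⊆ U := by
    refine Subset.trans ?_ hball
    rw [← segment_eq_uIcc]
    exact (convex_ball x δ).segment_subset (Metric.mem_ball_self hδ) hy
  have hle : ν (uIcc x y) ≤ ε := (measure_mono hsub).trans hUε.le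
  refine ⟨?_, (h x y).trans (by gcongr)⟩
  rw [tsub_le_iff_right]
  refine (h y x).trans ?_
  rw [uIcc_comm]
  gcongr

/-- Used to place cutting points exactly on dyadic levels. Restricting to `Ioi x` gives a finite
measure, for which the tail is continuous and tends to `0`. -/
theorem exists_measure_Ioi_eq {ν : Measure ℝ} [NullSingletonClass ν] {x : ℝ}
    (hfin : ν (Ioi x) ≠ ∞) {s : ℝ≥0∞} (hs0 : 0 < s) (hs : s < ν (Ioi x)) :
    ∃ r, x < r ∧ ν (Ioi r) = s := by
  set η := ν.restrict (Ioi x) with hη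
  have : IsFiniteMeasure η := ⟨by simpa [hη] using hfin.lt_top⟩
  have hcont : Continuous fun r => η (Ioi r) := by
    refine continuous_of_le_add_measure_uIcc (ν := η) (fun _ => measure_ne_top _ _) fun a b => ?_
    refine (measure_mono fun t ht => ?_).trans (measure_union_le _ _)
    rcases lt_or_ge a t with h | h
    · exact Or.inl h
    · exact Or.inr (Icc_subset_uIcc' ⟨(mem_Ioi.1 ht).le, h⟩)
  have hx : η (Ioi x) = ν (Ioi x) := by simp [hη]
  obtain ⟨n, hn⟩ : ∃ n : ℕ, η (Ioi (n : ℝ)) < s := by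
    have h0 : ⋂ n : ℕ, Ioi (n : ℝ) = ∅ := by
      refine eq_empty_of_forall_notMem fun t ht => ?_
      obtain ⟨n, hn⟩ := exists_nat_gt t
      exact absurd (mem_iInter.1 ht n) (not_lt.2 hn.le)
    have h1 := tendsto_measure_iInter_atTop (μ := η) (s := fun n : ℕ => Ioi (n : ℝ))
      (fun _ => measurableSet_Ioi.nullMeasurableSet)
      (fun m n hmn => Ioi_subset_Ioi (by exact_mod_cast hmn)) ⟨0, measure_ne_top η _⟩
    rw [h0, measure_empty] at h1
    exact (h1.eventually_lt_const hs0).exists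
  obtain ⟨r, hr⟩ := mem_range_of_exists_le_of_exists_ge hcont ⟨n, hn.le⟩ ⟨x, hs.le.trans hx.ge⟩
  dsimp only at hr
  have hxr : x < r := by
    by_contra! hle
    have : η (Ioi x) ≤ η (Ioi r) := measure_mono (Ioi_subset_Ioi hle)
    rw [hr, hx] at this
    exact absurd hs (not_lt.2 this)
  refine ⟨r, hxr, ?_⟩
  rw [← hr, hη, Measure.restrict_apply measurableSet_Ioi,
    inter_eq_self_of_subset_left (Ioi_subset_Ioi hxr.le)]

theorem exists_measure_Iio_eq {ν : Measure ℝ} [NullSingletonClass ν] {x : ℝ}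
    (hfin : ν (Iio x) ≠ ∞) {s : ℝ≥0∞} (hs0 : 0 < s) (hs : s < ν (Iio x)) :
    ∃ r, r < x ∧ ν (Iio r) = s := by
  have key : ∀ r : ℝ, ν.map (fun t : ℝ => -t) (Ioi r) = ν (Iio (-r)) := fun r => by
    rw [Measure.map_apply measurable_neg measurableSet_Ioi]
    congr 1
    ext t
    simp
  have : NullSingletonClass (ν.map (fun t : ℝ => -t)) := ⟨fun y => by
    rw [Measure.map_apply measurable_neg (measurableSet_singleton y)]
    simp [measure_singleton]⟩
  obtain ⟨r, hr, he⟩ := exists_measure_Ioi_eq (ν := ν.map (fun t : ℝ => -t)) (x := -x) (s := s)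
    (by rwa [key, neg_neg]) hs0 (by rwa [key, neg_neg])
  exact ⟨-r, by linarith, by rw [← key, he]⟩

end IntermediateValue

/-! ### Admissible measures and the change of variable by the primitive. -/

/-- The measure `v(x) dx` of a weight `v` whose primitive is finite and tends to infinity. -/
structure IsAdmissible (μ : Measure ℝ) : Prop where
  sFinite : SFinite μ
  nullSingleton : NullSingletonClass μ
  Iic_zero : μ (Iic 0) = 0
  Iio_lt_top : ∀ x, μ (Iio x) < ∞
  measure_univ_eq_top : μ univ = ∞

namespace IsAdmissible

variable {μ : Measure ℝ}

theorem isLocallyFiniteMeasure (hμ : IsAdmissible μ) : IsLocallyFiniteMeasure μ :=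
  ⟨fun x => ⟨Iio (x + 1), Iio_mem_nhds (by linarith), hμ.Iio_lt_top _⟩⟩

theorem monotone_Iio (μ : Measure ℝ) : Monotone fun x => μ (Iio x) := fun _ _ h =>
  measure_mono (Iio_subset_Iio h)

theorem measurable_Iio (μ : Measure ℝ) : Measurable fun x => μ (Iio x) :=
  (monotone_Iio μ).measurable

theorem Iio_of_nonpos (hμ : IsAdmissible μ) {x : ℝ} (hx : x ≤ 0) : μ (Iio x) = 0 :=
  measure_mono_null (fun _ ht => (mem_Iio.1 ht).le.trans hx) hμ.Iic_zero

theorem continuous_Iio (hμ : IsAdmissible μ) : Continuous fun x => μ (Iio x) := by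
  have := hμ.isLocallyFiniteMeasure
  have := hμ.nullSingleton
  refine continuous_of_le_add_measure_uIcc (ν := μ) (fun x => (hμ.Iio_lt_top x).ne) fun a b => ?_
  refine (measure_mono fun t ht => ?_).trans (measure_union_le _ _)
  rcases lt_or_ge t a with h | h
  · exact Or.inl h
  · exact Or.inr (Icc_subset_uIcc ⟨h, (mem_Iio.1 ht).le⟩)

theorem exists_lt_Iio (hμ : IsAdmissible μ) {s : ℝ≥0∞} (hs : s < ∞) : ∃ x, s < μ (Iio x) := by
  by_contra! hcon
  have h1 : μ (⋃ n : ℕ, Iio (n : ℝ)) ≤ s := by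
    rw [Monotone.measure_iUnion fun m n hmn => Iio_subset_Iio (by exact_mod_cast hmn)]
    exact iSup_le fun n => hcon n
  have h2 : ⋃ n : ℕ, Iio (n : ℝ) = univ := by
    refine eq_univ_of_forall fun x => ?_
    obtain ⟨n, hn⟩ := exists_nat_gt x
    exact mem_iUnion.2 ⟨n, hn⟩
  rw [h2, hμ.measure_univ_eq_top] at h1
  exact absurd hs (not_lt.2 h1)

theorem exists_Iio_eq (hμ : IsAdmissible μ) {s : ℝ≥0∞} (hs : s < ∞) : ∃ x, μ (Iio x) = s := by
  obtain ⟨x, hx⟩ := hμ.exists_lt_Iio hs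
  exact mem_range_of_exists_le_of_exists_ge hμ.continuous_Iio
    ⟨0, by simp [hμ.Iio_of_nonpos le_rfl]⟩ ⟨x, hx.le⟩

/-- The primitive may be constant on intervals, so it need not be invertible. Its sublevel set is
nevertheless a closed half-line, and the value at the endpoint is squeezed between `s` and the value
at any point of level `s`. -/
theorem measure_setOf_Iio_le (hμ : IsAdmissible μ) {s : ℝ≥0∞} (hs : s < ∞) :
    μ {t | μ (Iio t) ≤ s} = s := by
  have := hμ.nullSingleton
  obtain ⟨z, hz⟩ := hμ.exists_Iio_eq hs
  obtain ⟨b, hb⟩ := hμ.exists_lt_Iio hs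
  set A := {t | μ (Iio t) ≤ s} with hA
  have hbdd : BddAbove A := ⟨b, fun t ht => by
    by_contra! hlt
    exact absurd (hb.trans_le (monotone_Iio μ hlt.le)) (not_lt.2 ht)⟩
  have hclosed : IsClosed A := isClosed_le hμ.continuous_Iio continuous_const
  have hmem : sSup A ∈ A := hclosed.csSup_mem ⟨z, hz.le⟩ hbdd
  have hAeq : A = Iic (sSup A) := Subset.antisymm (fun t ht => le_csSup hbdd ht)
    fun t ht => (monotone_Iio μ ht).trans hmem
  rw [hAeq, measure_congr Iio_ae_eq_Iic.symm]
  refine le_antisymm hmem ?_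
  rw [← hz]
  exact monotone_Iio μ (le_csSup hbdd hz.le)

/-- The real-valued primitive. -/
noncomputable def prim (μ : Measure ℝ) (x : ℝ) : ℝ := (μ (Iio x)).toReal

theorem ofReal_prim (hμ : IsAdmissible μ) (x : ℝ) : ENNReal.ofReal (prim μ x) = μ (Iio x) :=
  ENNReal.ofReal_toReal (hμ.Iio_lt_top x).ne

theorem measurable_prim (μ : Measure ℝ) : Measurable (prim μ) := (measurable_Iio μ).ennreal_toReal

theorem prim_nonneg (μ : Measure ℝ) (x : ℝ) : 0 ≤ prim μ x := ENNReal.toReal_nonneg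

theorem prim_mono (hμ : IsAdmissible μ) : Monotone (prim μ) := fun _ y h =>
  ENNReal.toReal_mono (hμ.Iio_lt_top y).ne (monotone_Iio μ h)

theorem measure_setOf_prim_le (hμ : IsAdmissible μ) (b : ℝ) :
    μ {t | prim μ t ≤ b} = ENNReal.ofReal b := by
  rcases lt_or_ge b 0 with hb | hb
  · rw [ENNReal.ofReal_of_nonpos hb.le]
    convert measure_empty (μ := μ)
    exact eq_empty_of_forall_notMem fun t ht => absurd (prim_nonneg μ t) (not_le.2 (lt_of_le_of_lt ht hb))
  · rw [← hμ.measure_setOf_Iio_le ENNReal.ofReal_lt_top]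
    congr 1
    ext t
    simp only [mem_ofPred_eq]
    rw [← hμ.ofReal_prim t, ENNReal.ofReal_le_ofReal_iff hb]

/-- The primitive pushes `v(x) dx` forward to Lebesgue measure on the half-line. -/
theorem map_prim (hμ : IsAdmissible μ) : μ.map (prim μ) = volume.restrict (Ioi 0) := by
  symm
  refine Measure.ext_of_Ioc _ _ fun a b hab => ?_
  rw [Measure.map_apply (measurable_prim μ) measurableSet_Ioc,
    Measure.restrict_apply measurableSet_Ioc]
  have h1 : prim μ ⁻¹' Ioc a b = {t | prim μ t ≤ b} \ {t | prim μ t ≤ a} := by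
    ext t; simp [and_comm]
  have h2 : Ioc a b ∩ Ioi 0 = Ioc (max a 0) b := by
    ext t
    simp only [mem_inter_iff, mem_Ioc, mem_Ioi, max_lt_iff]
    tauto
  rw [h1, measure_sdiff (show {t | prim μ t ≤ a} ⊆ {t | prim μ t ≤ b} from fun t ht => le_trans ht hab.le)
    (measurableSet_le (measurable_prim μ) measurable_const).nullMeasurableSet
    (by rw [hμ.measure_setOf_prim_le]; simp), hμ.measure_setOf_prim_le,
    hμ.measure_setOf_prim_le, h2, Real.volume_Ioc]
  rcases le_total a 0 with ha | ha
  · simp [ha, ENNReal.ofReal_of_nonpos ha]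
  · rw [max_eq_left ha, ENNReal.ofReal_sub _ ha]

theorem lintegral_comp_prim (hμ : IsAdmissible μ) {F : ℝ → ℝ≥0∞} (hF : Measurable F) :
    ∫⁻ t, F (prim μ t) ∂μ = ∫⁻ s in Ioi 0, F s := by
  rw [← hμ.map_prim, lintegral_map hF (measurable_prim μ)]

theorem ae_prim_pos (hμ : IsAdmissible μ) : ∀ᵐ t ∂μ, 0 < prim μ t := by
  have := hμ.measure_setOf_prim_le 0
  rw [ENNReal.ofReal_zero] at this
  rw [ae_iff]
  simpa only [not_lt] using this

theorem ae_pos (hμ : IsAdmissible μ) : ∀ᵐ t ∂μ, 0 < t := by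
  rw [ae_iff]
  simp only [not_lt]
  exact hμ.Iic_zero

end IsAdmissible

/-! ### The adjoint averaging operator and Hardy's inequality in modular form. -/

/-- The operator `g ↦ ∫ₓ^∞ g dμ / V` adjoint to averaging, where `V` is the primitive of `μ`. -/
noncomputable def adjAverage (μ : Measure ℝ) (g : ℝ → ℝ≥0∞) (x : ℝ) : ℝ≥0∞ :=
  ∫⁻ t in Ioi x, g t / μ (Iio t) ∂μ

open IsAdmissible

theorem lintegral_Ici_rpow {a δ : ℝ} (ha : 0 < a) (hδ : 0 < δ) :
    ∫⁻ s in Ici a, ENNReal.ofReal (s ^ (-δ - 1)) = ENNReal.ofReal (a ^ (-δ) / δ) := by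
  rw [setLIntegral_congr Ioi_ae_eq_Ici.symm, ← ofReal_integral_eq_lintegral_ofReal
    (integrableOn_Ioi_rpow_of_lt (by linarith) ha)]
  · rw [integral_Ioi_rpow_of_lt (by linarith) ha]
    congr 1
    rw [sub_add_cancel, neg_div_neg_eq]
  · filter_upwards [ae_restrict_mem measurableSet_Ioi] with s hs
    exact Real.rpow_nonneg (ha.trans hs).le _

theorem lintegral_Ioc_rpow {b γ : ℝ} (hb : 0 < b) (hγ : -1 < γ) :
    ∫⁻ s in Ioc 0 b, ENNReal.ofReal (s ^ γ) = ENNReal.ofReal (b ^ (γ + 1) / (γ + 1)) := by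
  rw [← ofReal_integral_eq_lintegral_ofReal]
  · rw [← intervalIntegral.integral_of_le hb.le, integral_rpow (Or.inl hγ),
      Real.zero_rpow (by linarith), sub_zero]
  · exact (intervalIntegrable_iff_integrableOn_Ioc_of_le hb.le).1
      (intervalIntegral.intervalIntegrable_rpow' hγ)
  · filter_upwards [ae_restrict_mem measurableSet_Ioc] with s hs
    exact Real.rpow_nonneg hs.1.le _

/-- Jensen's inequality for `nFun p`. -/
theorem nFun_lintegral_le {p : ℝ≥0 → ℝ≥0} (hp : Monotone p) {μ : Measure ℝ} {a w : ℝ → ℝ≥0∞}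
    (ha : Measurable a) (hw : Measurable w) (hw1 : ∫⁻ t, w t ∂μ = 1)
    (hfin : ∫⁻ t, a t * w t ∂μ ≠ ∞) :
    nFun p (∫⁻ t, a t * w t ∂μ) ≤ ∫⁻ t, nFun p (a t) * w t ∂μ := by
  set m := (∫⁻ t, a t * w t ∂μ).toNNReal with hm
  have hm' : ∫⁻ t, a t * w t ∂μ = m := (ENNReal.coe_toNNReal hfin).symm
  rw [hm']
  -- The supporting line at the mean `m`, integrated against the probability density `w`.
  have h1 : ∫⁻ t, (nFun p m * w t + p m * (a t * w t)) ∂μ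
      ≤ ∫⁻ t, (nFun p (a t) * w t + p m * m * w t) ∂μ := by
    refine lintegral_mono fun t => ?_
    have := mul_le_mul_left (nFun_supporting_line hp m (a t)) (w t)
    rwa [add_mul, add_mul, mul_assoc] at this
  rw [lintegral_add_left (hw.const_mul _), lintegral_add_left
    (show Measurable fun t => nFun p (a t) * w t from ((measurable_nFun p).comp ha).mul hw), lintegral_const_mul _ hw,
    lintegral_const_mul _ (show Measurable fun t => a t * w t from ha.mul hw), lintegral_const_mul _ hw, hw1, hm', mul_one, mul_one,
    ENNReal.add_le_add_iff_right (by finiteness)] at h1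
  exact h1

end DunklOrlicz

namespace DunklOrlicz
open IsAdmissible

section Hardy

variable {μ : Measure ℝ}

/-- Bounded functions supported where `V` is bounded away from zero and infinity. -/
def IsNice (μ : Measure ℝ) (g : ℝ → ℝ≥0∞) : Prop :=
  Measurable g ∧ ∃ n : ℕ, 0 < n ∧ (∀ t, g t ≤ n) ∧
    ∀ t, t ∉ {t : ℝ | t < n ∧ (n : ℝ≥0∞)⁻¹ ≤ μ (Iio t)} → g t = 0

theorem IsNice.ne_top {g : ℝ → ℝ≥0∞} (hg : IsNice μ g) (t : ℝ) : g t ≠ ∞ := by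
  obtain ⟨-, n, -, hn, -⟩ := hg
  exact ((hn t).trans_lt (by simp)).ne

theorem IsNice.const_mul {g : ℝ → ℝ≥0∞} (hg : IsNice μ g) (c : ℝ≥0) :
    IsNice μ (fun t => c * g t) := by
  obtain ⟨hm, n, hn, h1, h2⟩ := hg
  obtain ⟨k, hk⟩ := exists_nat_ge (max c 1)
  have hk1 : 1 ≤ k := by exact_mod_cast (le_max_right c 1).trans hk
  have hnk : n ≤ k * n := Nat.le_mul_of_pos_left n hk1
  refine ⟨hm.const_mul _, k * n, by positivity, fun t => ?_, fun t ht => ?_⟩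
  · push_cast
    gcongr
    · exact_mod_cast (le_max_left c 1).trans hk
    · exact h1 t
  · show c * g t = 0
    rw [h2 t fun h => ht ?_, mul_zero]
    refine ⟨h.1.trans_le (by exact_mod_cast hnk), le_trans ?_ h.2⟩
    rw [ENNReal.inv_le_inv]
    exact_mod_cast hnk

/-- On the support of `g` the quotient `g / V` is at most `n * n`, and that support lies in `Iio n`,
which has finite measure. -/
theorem IsNice.lintegral_mul_lt_top (hμ : IsAdmissible μ) {g : ℝ → ℝ≥0∞} (hg : IsNice μ g)
    {k : ℝ → ℝ≥0∞} {B : ℝ → ℝ≥0} (hk : ∀ n t, t < n → k t ≤ B n) :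
    ∫⁻ t, k t * (g t / μ (Iio t)) ∂μ < ∞ := by
  obtain ⟨-, n, hn, h1, h2⟩ := hg
  have hn' : (n : ℝ≥0∞) ≠ 0 := by exact_mod_cast hn.ne'
  calc ∫⁻ t, k t * (g t / μ (Iio t)) ∂μ
      ≤ ∫⁻ t, (Iio (n : ℝ)).indicator (fun _ => (B n * (n * n) : ℝ≥0∞)) t ∂μ := by
        refine lintegral_mono fun t => ?_
        by_cases ht : t ∈ {t : ℝ | t < n ∧ (n : ℝ≥0∞)⁻¹ ≤ μ (Iio t)}
        · rw [indicator_of_mem (show t ∈ Iio (n : ℝ) from ht.1)]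
          gcongr
          · exact hk n t ht.1
          · rw [div_eq_mul_inv]
            gcongr
            · exact h1 t
            · exact ENNReal.inv_le_iff_inv_le.1 ht.2
        · simp [h2 t ht]
    _ < ∞ := by
        rw [lintegral_indicator measurableSet_Iio, setLIntegral_const]
        exact ENNReal.mul_lt_top (by finiteness) (hμ.Iio_lt_top _)

theorem IsNice.lintegral_lt_top (hμ : IsAdmissible μ) {g : ℝ → ℝ≥0∞} (hg : IsNice μ g) :
    ∫⁻ t, g t / μ (Iio t) ∂μ < ∞ := by
  simpa using hg.lintegral_mul_lt_top hμ (k := 1) (B := 1) (by simp)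

theorem IsNice.adjAverage_lt_top (hμ : IsAdmissible μ) {g : ℝ → ℝ≥0∞} (hg : IsNice μ g) (x : ℝ) :
    adjAverage μ g x < ∞ :=
  (setLIntegral_le_lintegral _ _).trans_lt (hg.lintegral_lt_top hμ)

/-- The kernel of the averages used in the Jensen argument for `adjAverage`. -/
noncomputable def jensenKernel (μ : Measure ℝ) (δ x t : ℝ) : ℝ≥0∞ :=
  if prim μ x ≤ prim μ t then
    ENNReal.ofReal (δ * prim μ x ^ (δ - 1 / 2) * prim μ t ^ (-δ - 1 / 2)) else 0

theorem measurable_jensenKernel (μ : Measure ℝ) (δ : ℝ) :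
    Measurable (Function.uncurry (jensenKernel μ δ)) := by
  have h1 : Measurable fun z : ℝ × ℝ => prim μ z.1 := (measurable_prim μ).comp measurable_fst
  have h2 : Measurable fun z : ℝ × ℝ => prim μ z.2 := (measurable_prim μ).comp measurable_snd
  exact Measurable.ite (measurableSet_le h1 h2) (by fun_prop) measurable_const

/-- For `δ = 1/(2m)`, the density `δ V(x)^δ V(t)^(-δ-1)` on `{V(t) ≥ V(x)}` is a probability density
for `μ`, and averaging `(V(t)/V(x))^δ g(t)` against it dominates `δ` times `adjAverage`. Jensen's
inequality applies; polynomial growth then pulls out `(V(t)/V(x))^(δ m)`, the exponent being `1/2`,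
and leaves `jensenKernel`. -/
theorem nFun_adjAverage_le (hμ : IsAdmissible μ) {p : ℝ≥0 → ℝ≥0} (hp : Monotone p) {m : ℕ}
    (hm : 0 < m) (hgrowth : ∀ (l : ℝ) (t : ℝ≥0), 1 ≤ l →
      nFun p (ENNReal.ofReal l * t) ≤ 2 ^ m * ENNReal.ofReal (l ^ m) * nFun p t)
    {g : ℝ → ℝ≥0∞} (hg : IsNice μ g) {x : ℝ} (hx : 0 < prim μ x) :
    nFun p (ENNReal.ofReal (1 / (2 * m)) * adjAverage μ g x)
      ≤ 2 ^ m * ∫⁻ t, jensenKernel μ (1 / (2 * m)) x t * nFun p (g t) ∂μ := by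
  set δ : ℝ := 1 / (2 * m) with hδ
  have hm' : (0 : ℝ) < m := by exact_mod_cast hm
  have hδ0 : 0 < δ := by positivity
  set A : Set ℝ := {t | prim μ x ≤ prim μ t} with hA
  have hAm : MeasurableSet A := measurableSet_le measurable_const (measurable_prim μ)
  set w : ℝ → ℝ≥0∞ := A.indicator fun t =>
    ENNReal.ofReal (δ * prim μ x ^ δ * prim μ t ^ (-δ - 1)) with hw
  set a : ℝ → ℝ≥0∞ := fun t => ENNReal.ofReal ((prim μ t / prim μ x) ^ δ) * g t with ha
  have hpm := measurable_prim μ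
  have hgm := hg.1
  have hwm : Measurable w := Measurable.indicator (by fun_prop) hAm
  have ham : Measurable a := by fun_prop
  have hw1 : ∫⁻ t, w t ∂μ = 1 := by
    have h1 : ∀ t, w t = (Ici (prim μ x)).indicator
        (fun s => ENNReal.ofReal (δ * prim μ x ^ δ * s ^ (-δ - 1))) (prim μ t) := fun t => rfl
    simp only [h1]
    rw [hμ.lintegral_comp_prim (F := (Ici (prim μ x)).indicator
        (fun s => ENNReal.ofReal (δ * prim μ x ^ δ * s ^ (-δ - 1))))
        (Measurable.indicator (by fun_prop) measurableSet_Ici),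
      lintegral_indicator measurableSet_Ici, Measure.restrict_restrict measurableSet_Ici,
      inter_eq_self_of_subset_left (show Ici (prim μ x) ⊆ Ioi 0 from fun s hs => hx.trans_le hs)]
    simp only [ENNReal.ofReal_mul (show 0 ≤ δ * prim μ x ^ δ by positivity)]
    rw [lintegral_const_mul _ (by fun_prop), lintegral_Ici_rpow hx hδ0,
      ← ENNReal.ofReal_mul (by positivity), ← ENNReal.ofReal_one]
    congr 1
    rw [Real.rpow_neg hx.le]
    field_simp
  have haw : ∀ t, a t * w t = A.indicator (fun t => ENNReal.ofReal δ * (g t / μ (Iio t))) t := by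
    intro t
    by_cases ht : t ∈ A
    · have ht0 : 0 < prim μ t := hx.trans_le ht
      simp only [ha, hw, indicator_of_mem ht]
      rw [← hμ.ofReal_prim t, div_eq_mul_inv (g t), ← ENNReal.ofReal_inv_of_pos ht0, mul_right_comm,
        ← ENNReal.ofReal_mul (by positivity), mul_comm (g t),
        ← mul_assoc (ENNReal.ofReal δ), ← ENNReal.ofReal_mul (by positivity)]
      congr 2
      rw [Real.div_rpow ht0.le hx.le, Real.rpow_sub ht0, Real.rpow_neg ht0.le, Real.rpow_one]
      field_simp
    · simp [hw, ht]
  have haw' : ∫⁻ t, a t * w t ∂μ = ENNReal.ofReal δ * ∫⁻ t in A, g t / μ (Iio t) ∂μ := by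
    simp only [haw]
    rw [lintegral_indicator hAm, lintegral_const_mul' _ _ (by simp)]
  have hfin : ∫⁻ t, a t * w t ∂μ ≠ ∞ := by
    rw [haw']
    exact (ENNReal.mul_lt_top (by simp)
      ((setLIntegral_le_lintegral _ _).trans_lt (hg.lintegral_lt_top hμ))).ne
  calc nFun p (ENNReal.ofReal δ * adjAverage μ g x) ≤ nFun p (∫⁻ t, a t * w t ∂μ) := by
        rw [haw']
        refine nFun_mono p ?_
        gcongr
        exact lintegral_mono_set fun t ht => hμ.prim_mono (mem_Ioi.1 ht).le
    _ ≤ ∫⁻ t, nFun p (a t) * w t ∂μ := nFun_lintegral_le hp ham hwm hw1 hfin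
    _ ≤ ∫⁻ t, 2 ^ m * (jensenKernel μ δ x t * nFun p (g t)) ∂μ := by
        refine lintegral_mono fun t => ?_
        by_cases ht : t ∈ A
        · have ht0 : 0 < prim μ t := hx.trans_le ht
          have hl : 1 ≤ prim μ t / prim μ x := (one_le_div hx).2 ht
          have h1 := hgrowth ((prim μ t / prim μ x) ^ δ) (g t).toNNReal
            (Real.one_le_rpow hl hδ0.le)
          rw [ENNReal.coe_toNNReal (hg.ne_top t)] at h1
          simp only [hw, indicator_of_mem ht]
          refine (mul_le_mul_left h1 _).trans_eq ?_
          rw [jensenKernel, if_pos (show prim μ x ≤ prim μ t from ht), mul_right_comm, mul_assoc (2 ^ m), mul_assoc (2 ^ m),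
            ← ENNReal.ofReal_mul (by positivity)]
          congr 3
          have e1 : ((prim μ t / prim μ x) ^ δ) ^ m = (prim μ t / prim μ x) ^ (1 / 2 : ℝ) := by
            rw [← Real.rpow_natCast, ← Real.rpow_mul (by positivity)]
            congr 1
            rw [hδ]; field_simp
          rw [e1, Real.div_rpow ht0.le hx.le, Real.rpow_sub hx, 
            show -δ - 1 / 2 = (-δ - 1) + 1 / 2 by ring, Real.rpow_add ht0]
          field_simp
        · simp [hw, ht]
    _ = _ := by rw [lintegral_const_mul' _ _ (by finiteness)]

/-- In the variable `s = V(x)` the integrand is a multiple of `s^(δ - 1/2)`, integrable at `0`, and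
the integral equals `δ / (δ + 1/2)`. The choice of `δ` leaves exactly this integrable singularity.
-/
theorem lintegral_jensenKernel (hμ : IsAdmissible μ) {δ : ℝ} (hδ : 0 < δ) {t : ℝ}
    (ht : 0 < prim μ t) : ∫⁻ x, jensenKernel μ δ x t ∂μ ≤ 1 := by
  have h1 : ∀ x, jensenKernel μ δ x t = (Iic (prim μ t)).indicator
      (fun s => ENNReal.ofReal (δ * prim μ t ^ (-δ - 1 / 2) * s ^ (δ - 1 / 2))) (prim μ x) := by
    intro x
    by_cases hx : prim μ x ≤ prim μ t
    · simp [jensenKernel, hx, mul_right_comm]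
    · simp [jensenKernel, hx]
  simp only [h1]
  rw [hμ.lintegral_comp_prim (F := (Iic (prim μ t)).indicator
      (fun s => ENNReal.ofReal (δ * prim μ t ^ (-δ - 1 / 2) * s ^ (δ - 1 / 2))))
      (Measurable.indicator (by fun_prop) measurableSet_Iic),
    lintegral_indicator measurableSet_Iic, Measure.restrict_restrict measurableSet_Iic,
    inter_comm, Ioi_inter_Iic]
  simp only [ENNReal.ofReal_mul (show 0 ≤ δ * prim μ t ^ (-δ - 1 / 2) by positivity)]
  rw [lintegral_const_mul _ (by fun_prop), lintegral_Ioc_rpow ht (by linarith),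
    ← ENNReal.ofReal_mul (by positivity), ← ENNReal.ofReal_one]
  refine ENNReal.ofReal_le_ofReal ?_
  have e : prim μ t ^ (-δ - 1 / 2) * prim μ t ^ (δ - 1 / 2 + 1) = 1 := by
    rw [← Real.rpow_add ht]; ring_nf; exact Real.rpow_zero _
  calc δ * prim μ t ^ (-δ - 1 / 2) * (prim μ t ^ (δ - 1 / 2 + 1) / (δ - 1 / 2 + 1))
      = δ * (prim μ t ^ (-δ - 1 / 2) * prim μ t ^ (δ - 1 / 2 + 1)) / (δ - 1 / 2 + 1) := by ring
    _ = δ / (δ + 1 / 2) := by rw [e]; ring_nf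
    _ ≤ 1 := by rw [div_le_one (by positivity)]; linarith

/-- Hardy's inequality for `adjAverage`, in modular form. -/
theorem exists_lintegral_nFun_adjAverage_le (hμ : IsAdmissible μ) {p : ℝ≥0 → ℝ≥0}
    (hp : Monotone p) (h2 : Delta2 (nFun p)) :
    ∃ C : ℝ≥0, 0 < C ∧ ∀ g, IsNice μ g →
      ∫⁻ x, nFun p (adjAverage μ g x) ∂μ ≤ ∫⁻ x, nFun p (C * g x) ∂μ := by
  obtain ⟨m, hm, hgrowth⟩ := h2.exists_rpow_bound (nFun_mono p) (nFun_zero p)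
  have := hμ.sFinite
  have hm' : (0 : ℝ) < m := by exact_mod_cast hm
  set δ : ℝ := 1 / (2 * m) with hδ
  have hδ0 : 0 < δ := by positivity
  have main : ∀ g, IsNice μ g → ∫⁻ x, nFun p (ENNReal.ofReal δ * adjAverage μ g x) ∂μ
      ≤ ∫⁻ x, nFun p (2 ^ m * g x) ∂μ := by
    intro g hg
    have hΦg : Measurable fun t => nFun p (g t) := (measurable_nFun p).comp hg.1
    have hkm := measurable_jensenKernel μ δ
    calc ∫⁻ x, nFun p (ENNReal.ofReal δ * adjAverage μ g x) ∂μ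
        ≤ ∫⁻ x, 2 ^ m * ∫⁻ t, jensenKernel μ δ x t * nFun p (g t) ∂μ ∂μ := by
          refine lintegral_mono_ae ?_
          filter_upwards [hμ.ae_prim_pos] with x hx
          exact nFun_adjAverage_le hμ hp hm hgrowth hg hx
      _ = 2 ^ m * ∫⁻ t, ∫⁻ x, jensenKernel μ δ x t * nFun p (g t) ∂μ ∂μ := by
          rw [lintegral_const_mul' _ _ (by finiteness), lintegral_lintegral_swap]
          exact (hkm.mul (hΦg.comp measurable_snd)).aemeasurable
      _ ≤ 2 ^ m * ∫⁻ t, nFun p (g t) ∂μ := by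
          gcongr 2 ^ m * ?_
          refine lintegral_mono_ae ?_
          filter_upwards [hμ.ae_prim_pos] with t ht
          rw [lintegral_mul_const _ (show Measurable fun x => jensenKernel μ δ x t from
            hkm.comp (measurable_id.prodMk measurable_const))]
          exact mul_le_of_le_one_left' (lintegral_jensenKernel hμ hδ0 ht)
      _ ≤ _ := by
          rw [← lintegral_const_mul' _ _ (by finiteness)]
          refine lintegral_mono fun t => mul_nFun_le hp ?_ _
          exact one_le_pow₀ one_le_two
  -- `D = 1/δ`: applying the estimate to `D g` removes the factor `δ` in front of `adjAverage`.
  set D : ℝ≥0 := 2 * m with hD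
  have hD0 : 0 < D := by positivity
  refine ⟨2 ^ m * D, by positivity, fun g hg => ?_⟩
  have h3 := main _ (hg.const_mul D)
  have h4 : ∀ x, ENNReal.ofReal δ * adjAverage μ (fun t => D * g t) x = adjAverage μ g x := by
    intro x
    simp only [adjAverage, mul_div_assoc]
    rw [lintegral_const_mul' _ _ (by simp), ← mul_assoc]
    have : ENNReal.ofReal δ * D = 1 := by
      rw [← ENNReal.ofReal_coe_nnreal, ← ENNReal.ofReal_mul hδ0.le, ← ENNReal.ofReal_one]
      congr 1
      rw [hδ, hD]; push_cast; field_simp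
    rw [this, one_mul]
  simp only [h4] at h3
  refine h3.trans_eq (lintegral_congr fun x => ?_)
  push_cast
  rw [mul_assoc]

end Hardy

end DunklOrlicz

namespace DunklOrlicz
open IsAdmissible

/-! ### Discretization along dyadic levels. -/

section LevelSets

variable {μ ω : Measure ℝ} {p q : ℝ≥0 → ℝ≥0}

theorem two_zpow_lt_two_zpow {k l : ℤ} (h : k < l) : (2 : ℝ≥0∞) ^ k < 2 ^ l := by
  have hpos : (2 : ℝ≥0∞) ^ k ≠ 0 := (ENNReal.zpow_pos (by norm_num) (by norm_num) k).ne'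
  have htop : (2 : ℝ≥0∞) ^ k ≠ ∞ := (ENNReal.zpow_lt_top (by norm_num) (by norm_num) k).ne
  refine lt_of_lt_of_le ?_ (ENNReal.zpow_le_of_le one_le_two (Int.add_one_le_of_lt h))
  rw [ENNReal.zpow_add (by norm_num) (by norm_num), zpow_one, mul_two]
  exact ENNReal.lt_add_right htop hpos

theorem two_zpow_eq (k : ℤ) : (2 : ℝ≥0∞) ^ k = 2 * 2 ^ (k - 1) := by
  conv_lhs => rw [← sub_add_cancel k 1]
  rw [ENNReal.zpow_add (by norm_num) (by norm_num), zpow_one, mul_comm]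

/-- Discretization along the dyadic levels of a function `G` that is monotone for a strict linear
order `R`: the test inequalities on the blocks between consecutive levels add up. -/
theorem exists_majorant {C : ℝ≥0} (hC : ∀ a : ℤ → ℝ≥0∞,
      ∑' i, nFun q (nInv (nFun p) (a i)) ≤ C * nFun q (nInv (nFun p) (∑' i, a i)))
    (R : ℝ → ℝ → Prop) (hirr : ∀ x, ¬ R x x) (htrans : ∀ x y z, R x y → R y z → R x z)
    (htri : ∀ x y, R x y ∨ x = y ∨ R y x)
    (hRl : ∀ r, MeasurableSet {t | R r t}) (hRr : ∀ r, MeasurableSet {x | R x r})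
    {G : ℝ → ℝ≥0∞} (hanti : ∀ x y, 0 < x → 0 < y → R x y → G y ≤ G x)
    (hivt : ∀ x s, 0 < x → 0 < s → s < G x → ∃ r, 0 < r ∧ R x r ∧ G r = s)
    {c n : ℝ → ℝ → ℝ≥0∞} (hc : ∀ r, AEMeasurable (fun x => c x r) ω)
    {g : ℝ → ℝ≥0∞} (hg : Measurable g)
    (H : ∀ r, 0 < r → ∀ g' : ℝ → ℝ≥0∞, Measurable g' →
      ∫⁻ x in {x | R x r}, nFun q (c x r * ∫⁻ t in {t | R r t}, n r t * g' t ∂μ) ∂ω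
        ≤ nFun q (nInv (nFun p) (∫⁻ t, nFun p (g' t) ∂μ))) :
    ∃ S : ℝ → ℝ≥0∞, AEMeasurable S ω ∧
      ∫⁻ x, S x ∂ω ≤ C * nFun q (nInv (nFun p) (∫⁻ t, nFun p (g t) ∂μ)) ∧
      ∀ x ρ, 0 < ρ → (x = ρ ∨ R x ρ) → G ρ ≠ 0 → G ρ ≠ ∞ →
        ∃ r r', 0 < r ∧ 0 < r' ∧ R ρ r ∧ R r r' ∧ G ρ ≤ 4 * G r' ∧ G r = 2 * G r' ∧ G r' ≠ ∞ ∧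
          nFun q (c x r * ∫⁻ t in {t | R r t ∧ ¬ R r' t}, n r t * g t ∂μ) ≤ S x := by
  classical
  set good : ℤ → Prop := fun k => ∃ x, 0 < x ∧ (2 : ℝ≥0∞) ^ k < G x with hgood
  have hpos : ∀ k : ℤ, 0 < (2 : ℝ≥0∞) ^ k := ENNReal.zpow_pos (by norm_num) (by norm_num)
  have htop : ∀ k : ℤ, (2 : ℝ≥0∞) ^ k < ∞ := ENNReal.zpow_lt_top (by norm_num) (by norm_num)
  have hex : ∀ k, ∃ r, good k → 0 < r ∧ G r = 2 ^ k := by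
    intro k
    by_cases hk : good k
    · obtain ⟨x, hx, hlt⟩ := hk
      obtain ⟨r, hr, -, he⟩ := hivt x _ hx (hpos k) hlt
      exact ⟨r, fun _ => ⟨hr, he⟩⟩
    · exact ⟨0, fun h => absurd h hk⟩
  choose r hr using hex
  have hgood_pred : ∀ k, good k → good (k - 1) := fun k ⟨x, hx, hlt⟩ =>
    ⟨x, hx, (two_zpow_lt_two_zpow (by lia)).trans hlt⟩
  have hR_of_lt : ∀ x y, 0 < x → 0 < y → G y < G x → R x y := fun x y hx hy h => by
    rcases htri x y with h1 | h1 | h1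
    · exact h1
    · exact absurd h (by simp [h1])
    · exact absurd (hanti y x hy hx h1) (not_le.2 h)
  -- Moving forward along `R` decreases `G`, so the block runs from level `2^k` to level `2^(k-1)`,
  -- with each boundary point assigned so that blocks do not overlap.
  set block : ℤ → Set ℝ := fun k => {t | R (r k) t ∧ ¬ R (r (k - 1)) t} with hblock
  have hblockm : ∀ k, MeasurableSet (block k) := fun k => (hRl _).inter (hRl _).compl
  set D : ℤ → Set ℝ := fun k => if good k then block k else ∅ with hD
  have hDm : ∀ k, MeasurableSet (D k) := fun k => by
    by_cases hk : good k <;> simp [hD, hk, hblockm k]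
  have hdisj_lt : ∀ k l, k < l → Disjoint (D k) (D l) := by
    intro k l hkl
    by_cases hk : good k <;> by_cases hl : good l <;> simp only [hD, hk, hl, if_true, if_false,
      disjoint_empty, empty_disjoint]
    refine Set.disjoint_left.2 fun t ht ht' => ht'.2 ?_
    rcases htri (r (l - 1)) (r k) with h | h | h
    · exact htrans _ _ _ h ht.1
    · rw [h]; exact ht.1
    · exfalso
      have h1 := hanti _ _ (hr k hk).1 (hr _ (hgood_pred l hl)).1 h
      rw [(hr _ (hgood_pred l hl)).2, (hr k hk).2] at h1
      have h2 : ¬ k < l - 1 := fun h3 => absurd (two_zpow_lt_two_zpow h3) (not_lt.2 h1)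
      rw [show l - 1 = k by lia] at h
      exact hirr _ h
  have hdisj : Pairwise (Function.onFun Disjoint D) := fun k l hkl => by
    rcases hkl.lt_or_gt with h | h
    · exact hdisj_lt k l h
    · exact (hdisj_lt l k h).symm
  set U : ℤ → ℝ → ℝ≥0∞ := fun k => if good k then {x | R x (r k)}.indicator
    (fun x => nFun q (c x (r k) * ∫⁻ t in block k, n (r k) t * g t ∂μ)) else 0 with hU
  have hUm : ∀ k, AEMeasurable (U k) ω := fun k => by
    by_cases hk : good k
    · simp only [hU, hk, if_true]
      exact ((measurable_nFun q).comp_aemeasurable ((hc _).mul_const _)).indicator (hRr _)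
    · simp only [hU, hk, if_false]
      exact aemeasurable_const
  have hUle : ∀ k, ∫⁻ x, U k x ∂ω
      ≤ nFun q (nInv (nFun p) (∫⁻ t in D k, nFun p (g t) ∂μ)) := fun k => by
    by_cases hk : good k
    · simp only [hU, hD, hk, if_true]
      rw [lintegral_indicator (hRr _)]
      -- The test inequality at `r k` is applied to `g` cut down to the block, so that only the
      -- modular of that piece appears on the right.
      have h1 := H (r k) (hr k hk).1 _ (hg.indicator (hblockm k))
      have h2 : ∫⁻ t in {t | R (r k) t}, n (r k) t * (block k).indicator g t ∂μ
          = ∫⁻ t in block k, n (r k) t * g t ∂μ := by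
        have : ∀ t, n (r k) t * (block k).indicator g t
            = (block k).indicator (fun t => n (r k) t * g t) t := fun t => by
          by_cases ht : t ∈ block k <;> simp [ht]
        simp only [this]
        rw [lintegral_indicator (hblockm k), Measure.restrict_restrict (hblockm k),
          inter_eq_self_of_subset_left (show block k ⊆ {t | R (r k) t} from fun t ht => ht.1)]
      have h3 : ∫⁻ t, nFun p ((block k).indicator g t) ∂μ = ∫⁻ t in block k, nFun p (g t) ∂μ := by
        rw [← lintegral_indicator (hblockm k)]
        refine lintegral_congr fun t => ?_
        by_cases ht : t ∈ block k <;> simp [ht, nFun_zero]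
      rwa [h2, h3] at h1
    · simp [hU, hk]
  refine ⟨fun x => ∑' k, U k x, AEMeasurable.tsum hUm, ?_, ?_⟩
  · rw [lintegral_tsum hUm]
    -- The relation `Φ ≺ Ψ` acts here: it sums the block bounds, and disjointness recombines the
    -- pieces into the modular of `g`.
    refine (ENNReal.tsum_le_tsum hUle).trans ((hC _).trans ?_)
    rw [← lintegral_iUnion hDm hdisj]
    gcongr
    exact nFun_mono q (nInv_mono _ (setLIntegral_le_lintegral _ _))
  · intro x ρ hρ hxρ hG0 hGtop
    -- With `2^k < G ρ ≤ 2^(k+1)`, the block starts strictly beyond `ρ` and its lower level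
    -- `2^(k-1)` is at least `G ρ / 4`.
    obtain ⟨k, hk1, hk2⟩ := ENNReal.exists_mem_Ioc_zpow hG0 hGtop (y := 2) (by norm_num) (by norm_num)
    have hk : good k := ⟨ρ, hρ, hk1⟩
    obtain ⟨hr0, hrG⟩ := hr k hk
    obtain ⟨hr0', hrG'⟩ := hr _ (hgood_pred k hk)
    have hρr : R ρ (r k) := hR_of_lt _ _ hρ hr0 (by rwa [hrG])
    refine ⟨r k, r (k - 1), hr0, hr0', hρr,
      hR_of_lt _ _ hr0 hr0' (by rw [hrG, hrG']; exact two_zpow_lt_two_zpow (by lia)), ?_, ?_, ?_, ?_⟩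
    · refine hk2.trans_eq ?_
      rw [hrG', two_zpow_eq, add_sub_cancel_right, two_zpow_eq k]
      ring
    · rw [hrG, hrG', two_zpow_eq]
    · rw [hrG']; exact (htop _).ne
    · refine le_trans (le_of_eq ?_) (ENNReal.le_tsum k)
      have hx : x ∈ {x | R x (r k)} := by
        rcases hxρ with rfl | h
        · exact hρr
        · exact htrans _ _ _ h hρr
      simp only [hU, hk, if_true]
      rw [indicator_of_mem hx]

end LevelSets

end DunklOrlicz

namespace DunklOrlicz
open IsAdmissible

/-! ### The composed kernel and its three parts. -/

section Kernel

variable {μ : Measure ℝ}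

theorem lintegral_Ioo_inv {x t : ℝ} (hx : 0 < x) (hxt : x ≤ t) :
    ∫⁻ s in Ioo x t, ENNReal.ofReal s⁻¹ = ENNReal.ofReal (Real.log (t / x)) := by
  rw [setLIntegral_congr Ioo_ae_eq_Ioc, ← ofReal_integral_eq_lintegral_ofReal]
  · rw [← intervalIntegral.integral_of_le hxt, integral_inv_of_pos hx (hx.trans_le hxt)]
  · refine (intervalIntegrable_iff_integrableOn_Ioc_of_le hxt).1 ?_
    refine intervalIntegral.intervalIntegrable_inv (fun s hs => ?_) continuousOn_id
    rw [uIcc_of_le hxt] at hs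
    exact (hx.trans_le hs.1).ne'
  · filter_upwards [ae_restrict_mem measurableSet_Ioc] with s hs
    exact inv_nonneg.2 (hx.trans hs.1).le

/-- The kernel `∫₀ᵗ dy / max x y`. -/
noncomputable def calderonKernel (x t : ℝ) : ℝ≥0∞ :=
  ENNReal.ofReal (min t x / x) + ENNReal.ofReal (Real.log (t / x))

theorem measurable_calderonKernel : Measurable (Function.uncurry calderonKernel) := by
  unfold calderonKernel Function.uncurry
  fun_prop

theorem lintegral_Ioo_inv_max {x t : ℝ} (hx : 0 < x) (ht : 0 < t) :
    ∫⁻ s in Ioo 0 t, ENNReal.ofReal (max x s)⁻¹ = calderonKernel x t := by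
  have h1 : ∀ b, 0 ≤ b → b ≤ x → ∫⁻ s in Ioo 0 b, ENNReal.ofReal (max x s)⁻¹
      = ENNReal.ofReal (b / x) := fun b hb hbx => by
    calc _ = ∫⁻ _ in Ioo 0 b, ENNReal.ofReal x⁻¹ := by
          refine setLIntegral_congr_fun measurableSet_Ioo fun s hs => ?_
          rw [max_eq_left (hs.2.le.trans hbx)]
      _ = _ := by
          rw [setLIntegral_const, Real.volume_Ioo, sub_zero, ← ENNReal.ofReal_mul (by positivity)]
          congr 1
          ring
  rw [calderonKernel]
  rcases le_total t x with h | h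
  · rw [h1 t ht.le h, min_eq_left h, ENNReal.ofReal_of_nonpos (p := Real.log _), add_zero]
    exact Real.log_nonpos (by positivity) ((div_le_one hx).2 h)
  · rw [min_eq_right h, ← h1 x hx.le le_rfl, ← lintegral_Ioo_inv hx h,
      setLIntegral_congr (Ioo_ae_eq_Ico (a := x) (b := t)),
      ← setLIntegral_congr_fun (f := fun s => ENNReal.ofReal (max x s)⁻¹) measurableSet_Ico
        fun s hs => by dsimp only; rw [max_eq_right hs.1],
      ← lintegral_union measurableSet_Ico]
    · rw [Ioo_union_Ico_eq_Ioo hx h]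
    · exact Set.disjoint_left.2 fun s hs hs' => absurd hs.2 (not_lt.2 hs'.1)

theorem lintegral_mul_tail (hμ : IsAdmissible μ) {k h : ℝ → ℝ≥0∞} (hk : Measurable k)
    (hh : Measurable h) :
    ∫⁻ s in Ioi 0, k s * ∫⁻ t in Ioi s, h t ∂μ = ∫⁻ t, (∫⁻ s in Ioo 0 t, k s) * h t ∂μ := by
  have := hμ.sFinite
  set F : ℝ → ℝ → ℝ≥0∞ := fun s t => {z : ℝ × ℝ | z.1 < z.2}.indicator (fun z => k z.1 * h z.2) (s, t)
    with hF
  have hset : MeasurableSet {z : ℝ × ℝ | z.1 < z.2} := measurableSet_lt measurable_fst measurable_snd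
  have hFm : Measurable (Function.uncurry F) :=
    ((hk.comp measurable_fst).mul (hh.comp measurable_snd)).indicator hset
  have hF1 : ∀ s t, F s t = (Ioi s).indicator (fun t => k s * h t) t := fun s t => by
    by_cases hst : s < t <;> simp [hF, hst]
  have hF2 : ∀ s t, F s t = (Iio t).indicator (fun s => k s * h t) s := fun s t => by
    by_cases hst : s < t <;> simp [hF, hst]
  calc _ = ∫⁻ s in Ioi 0, ∫⁻ t, F s t ∂μ := by
        refine lintegral_congr fun s => ?_
        simp only [hF1]
        rw [lintegral_indicator measurableSet_Ioi, lintegral_const_mul _ hh]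
    _ = ∫⁻ t, (∫⁻ s in Ioi 0, F s t) ∂μ := lintegral_lintegral_swap hFm.aemeasurable
    _ = _ := by
        refine lintegral_congr fun t => ?_
        simp only [hF2]
        rw [lintegral_indicator measurableSet_Iio, Measure.restrict_restrict measurableSet_Iio,
          inter_comm, Ioi_inter_Iio, lintegral_mul_const _ hk]

/-- The composition of the Calderón operator with `adjAverage`. -/
theorem lintegral_inv_max_mul_adjAverage (hμ : IsAdmissible μ) {g : ℝ → ℝ≥0∞} (hg : Measurable g)
    {x : ℝ} (hx : 0 < x) :
    ∫⁻ s in Ioi 0, ENNReal.ofReal (max x s)⁻¹ * adjAverage μ g s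
      = ∫⁻ t, calderonKernel x t * (g t / μ (Iio t)) ∂μ := by
  simp only [adjAverage]
  rw [lintegral_mul_tail hμ (h := fun t => g t / μ (Iio t)) (by fun_prop)
    (hg.div (measurable_Iio μ))]
  refine lintegral_congr_ae ?_
  filter_upwards [hμ.ae_pos] with t ht
  rw [lintegral_Ioo_inv_max hx ht]

/-- Tonelli applied to `log(t/x) = ∫ₓᵗ ds/s`. It exhibits the logarithmic average as the tail of a
measure with a Lebesgue density, so the intermediate value lemma applies to it. -/
theorem setLIntegral_log_mul (hμ : IsAdmissible μ) {h : ℝ → ℝ≥0∞} (hh : Measurable h) {x : ℝ}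
    (hx : 0 < x) :
    ∫⁻ t in Ioi x, ENNReal.ofReal (Real.log (t / x)) * h t ∂μ
      = ∫⁻ s in Ioi x, ENNReal.ofReal s⁻¹ * ∫⁻ t in Ioi s, h t ∂μ := by
  have h1 := lintegral_mul_tail hμ (k := (Ioi x).indicator fun s => ENNReal.ofReal s⁻¹)
    (Measurable.indicator (by fun_prop) measurableSet_Ioi) hh
  have h2 : ∀ s, (Ioi x).indicator (fun s => ENNReal.ofReal s⁻¹) s * ∫⁻ t in Ioi s, h t ∂μ
      = (Ioi x).indicator (fun s => ENNReal.ofReal s⁻¹ * ∫⁻ t in Ioi s, h t ∂μ) s := fun s => by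
    by_cases hs : s ∈ Ioi x <;> simp [hs]
  simp only [h2] at h1
  rw [lintegral_indicator measurableSet_Ioi, Measure.restrict_restrict measurableSet_Ioi,
    inter_eq_self_of_subset_left (Ioi_subset_Ioi hx.le)] at h1
  rw [h1, ← lintegral_indicator measurableSet_Ioi]
  refine lintegral_congr fun t => ?_
  rw [lintegral_indicator measurableSet_Ioi, Measure.restrict_restrict measurableSet_Ioi,
    Ioi_inter_Ioo, max_eq_left hx.le]
  rcases lt_or_ge x t with ht | ht
  · rw [indicator_of_mem (mem_Ioi.2 ht), lintegral_Ioo_inv hx ht.le]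
  · rw [indicator_of_notMem (notMem_Ioi.2 ht), Ioo_eq_empty (not_lt.2 ht)]
    simp

/-- Splitting of the integral against `calderonKernel`. -/
theorem lintegral_calderonKernel_mul_eq (hμ : IsAdmissible μ) {h : ℝ → ℝ≥0∞} (hh : Measurable h)
    {x : ℝ} (hx : 0 < x) :
    ∫⁻ t, calderonKernel x t * h t ∂μ
      = ENNReal.ofReal x⁻¹ * ∫⁻ t in Iio x, ENNReal.ofReal t * h t ∂μ
        + (∫⁻ t in Ioi x, h t ∂μ + ∫⁻ t in Ioi x, ENNReal.ofReal (Real.log (t / x)) * h t ∂μ) := by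
  have := hμ.nullSingleton
  rw [← lintegral_add_compl _ measurableSet_Iio (A := Iio x), compl_Iio,
    setLIntegral_congr Ioi_ae_eq_Ici.symm]
  congr 1
  · rw [← lintegral_const_mul' _ _ (by simp)]
    refine lintegral_congr_ae ?_
    filter_upwards [ae_restrict_of_ae hμ.ae_pos, ae_restrict_mem measurableSet_Iio] with t ht htx
    -- For `t < x` the logarithm is negative and `ENNReal.ofReal` discards it.
    rw [calderonKernel, min_eq_left (mem_Iio.1 htx).le, ENNReal.ofReal_of_nonpos (p := Real.log _),
      add_zero, ← mul_assoc, ← ENNReal.ofReal_mul (by positivity)]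
    · congr 2; ring
    · exact Real.log_nonpos (by positivity) ((div_le_one hx).2 (mem_Iio.1 htx).le)
  · rw [← lintegral_add_left hh]
    refine setLIntegral_congr_fun measurableSet_Ioi fun t ht => ?_
    simp only [calderonKernel]
    rw [min_eq_right (mem_Ioi.1 ht).le, div_self hx.ne', add_mul, ENNReal.ofReal_one, one_mul]

end Kernel

/-! ### Majorants for the head and the tail. -/

section Sufficiency

variable {μ ω : Measure ℝ} {p q : ℝ≥0 → ℝ≥0}

/-- The head increases in `x`, so the discretization runs with the order reversed. Since `G r = 2 G
r'`, the block `[r', r)` carries exactly `G r'`, at least a quarter of `G x`. -/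
theorem exists_majorant_head {C : ℝ≥0} (hC : ∀ a : ℤ → ℝ≥0∞,
      ∑' i, nFun q (nInv (nFun p) (a i)) ≤ C * nFun q (nInv (nFun p) (∑' i, a i)))
    (hμ : IsAdmissible μ) {W : ℝ → ℝ≥0∞} (hW : AEMeasurable W ω) {g : ℝ → ℝ≥0∞} (hg : IsNice μ g)
    (H : ∀ r, 0 < r → ∀ g' : ℝ → ℝ≥0∞, Measurable g' →
      ∫⁻ x in Ioi r, nFun q (W x * ∫⁻ t in Iio r, ENNReal.ofReal t * (g' t / μ (Iio t)) ∂μ) ∂ω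
        ≤ nFun q (nInv (nFun p) (∫⁻ t, nFun p (g' t) ∂μ))) :
    ∃ S : ℝ → ℝ≥0∞, AEMeasurable S ω ∧
      ∫⁻ x, S x ∂ω ≤ C * nFun q (nInv (nFun p) (∫⁻ t, nFun p (g t) ∂μ)) ∧
      ∀ x, 0 < x →
        nFun q (W x * ((∫⁻ t in Iio x, ENNReal.ofReal t * (g t / μ (Iio t)) ∂μ) / 4)) ≤ S x := by
  have := hμ.nullSingleton
  have hgm := hg.1
  have hVm := measurable_Iio μ
  set G : ℝ → ℝ≥0∞ := fun x => ∫⁻ t in Iio x, ENNReal.ofReal t * (g t / μ (Iio t)) ∂μ with hG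
  set ν := μ.withDensity fun t => ENNReal.ofReal t * (g t / μ (Iio t)) with hν
  have hGν : ∀ x, ν (Iio x) = G x := fun x => withDensity_apply _ measurableSet_Iio
  have hfin : ∀ x, G x ≠ ∞ := fun x => ((setLIntegral_le_lintegral _ _).trans_lt
    (hg.lintegral_mul_lt_top hμ (B := fun n => n.toNNReal) fun n t ht => by
      exact ENNReal.ofReal_le_ofReal ht.le)).ne
  obtain ⟨S, hS, hS1, hS2⟩ := exists_majorant (μ := μ) (ω := ω) hC (fun x y => y < x)
    (fun x => lt_irrefl x) (fun x y z h1 h2 => h2.trans h1)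
    (fun x y => (lt_trichotomy y x).imp_right (Or.imp_left Eq.symm))
    (fun r => measurableSet_Iio) (fun r => measurableSet_Ioi) (G := G)
    (fun x y _ _ h => lintegral_mono_set (Iio_subset_Iio h.le))
    (fun x s _ hs0 hs => by
      rw [← hGν] at hs
      obtain ⟨r, hr, he⟩ := exists_measure_Iio_eq (hGν x ▸ hfin x) hs0 hs
      refine ⟨r, ?_, hr, hGν r ▸ he⟩
      by_contra! hr0
      rw [hGν, hG] at he
      simp only [Measure.restrict_eq_zero.2 (hμ.Iio_of_nonpos hr0), lintegral_zero_measure] at he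
      exact hs0.ne he)
    (c := fun x _ => W x) (n := fun _ t => ENNReal.ofReal t / μ (Iio t)) (fun _ => hW) hgm
    (fun r hr g' hg' => by
      refine le_trans (le_of_eq ?_) (H r hr g' hg')
      refine lintegral_congr fun x => ?_
      congr 2
      refine lintegral_congr fun t => ?_
      simp only [div_eq_mul_inv]
      ring)
  refine ⟨S, hS, hS1, fun x hx => ?_⟩
  rcases eq_or_ne (G x) 0 with h0 | h0
  · simp only [hG] at h0
    simp [h0, nFun_zero]
  obtain ⟨r, r', hr, hr', hxr, hrr, h4, h2, hr'top, hle⟩ := hS2 x x hx (Or.inl rfl) h0 (hfin x)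
  refine le_trans (nFun_mono q ?_) hle
  gcongr
  refine ENNReal.div_le_of_le_mul' (h4.trans ?_)
  gcongr
  have h5 : G r = G r' + ∫⁻ t in Ico r' r, ENNReal.ofReal t * (g t / μ (Iio t)) ∂μ := by
    simp only [hG]
    rw [← lintegral_union measurableSet_Ico, Iio_union_Ico_eq_Iio (le_of_lt hrr)]
    exact Set.disjoint_left.2 fun t ht ht' => absurd ht (not_lt.2 ht'.1)
  rw [h2, two_mul, ENNReal.add_right_inj hr'top] at h5
  rw [h5]
  have h6 : {t | t < r ∧ ¬ t < r'} = Ico r' r := by ext t; simp [and_comm]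
  rw [h6]
  refine lintegral_mono fun t => ?_
  simp only [div_eq_mul_inv]
  rw [mul_assoc, mul_comm (g t), ]

/-- The coefficient may depend on the cutting point; monotonicity lets it be replaced by its value
at the point `r` beyond `ρ` that the discretization supplies. Allowing `ρ` to differ from `x` is
needed for the logarithmic part, where the tail is evaluated at a later cut. -/
theorem exists_majorant_tail {C : ℝ≥0} (hC : ∀ a : ℤ → ℝ≥0∞,
      ∑' i, nFun q (nInv (nFun p) (a i)) ≤ C * nFun q (nInv (nFun p) (∑' i, a i)))
    (hμ : IsAdmissible μ) {c : ℝ → ℝ → ℝ≥0∞} (hc : ∀ r, AEMeasurable (fun x => c x r) ω)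
    (hcmono : ∀ x r r', 0 < x → x ≤ r → r ≤ r' → c x r ≤ c x r')
    {g : ℝ → ℝ≥0∞} (hg : IsNice μ g)
    (H : ∀ r, 0 < r → ∀ g' : ℝ → ℝ≥0∞, Measurable g' →
      ∫⁻ x in Iio r, nFun q (c x r * ∫⁻ t in Ioi r, g' t / μ (Iio t) ∂μ) ∂ω
        ≤ nFun q (nInv (nFun p) (∫⁻ t, nFun p (g' t) ∂μ))) :
    ∃ S : ℝ → ℝ≥0∞, AEMeasurable S ω ∧
      ∫⁻ x, S x ∂ω ≤ C * nFun q (nInv (nFun p) (∫⁻ t, nFun p (g t) ∂μ)) ∧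
      ∀ x ρ, 0 < x → x ≤ ρ → nFun q (c x ρ * (adjAverage μ g ρ / 4)) ≤ S x := by
  have := hμ.nullSingleton
  have hgm := hg.1
  have hVm := measurable_Iio μ
  set G : ℝ → ℝ≥0∞ := adjAverage μ g with hG
  set ν := μ.withDensity fun t => g t / μ (Iio t) with hν
  have hGν : ∀ x, ν (Ioi x) = G x := fun x => withDensity_apply _ measurableSet_Ioi
  have hfin : ∀ x, G x ≠ ∞ := fun x => (hg.adjAverage_lt_top hμ x).ne
  obtain ⟨S, hS, hS1, hS2⟩ := exists_majorant (μ := μ) (ω := ω) hC (fun x y => x < y)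
    (fun x => lt_irrefl x) (fun x y z h1 h2 => h1.trans h2) lt_trichotomy
    (fun r => measurableSet_Ioi) (fun r => measurableSet_Iio) (G := G)
    (fun x y _ _ h => lintegral_mono_set (Ioi_subset_Ioi h.le))
    (fun x s hx hs0 hs => by
      rw [← hGν] at hs
      obtain ⟨r, hr, he⟩ := exists_measure_Ioi_eq (hGν x ▸ hfin x) hs0 hs
      exact ⟨r, hx.trans hr, hr, hGν r ▸ he⟩)
    (n := fun _ t => (μ (Iio t))⁻¹) hc hgm
    (fun r hr g' hg' => by
      refine le_trans (le_of_eq ?_) (H r hr g' hg')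
      refine lintegral_congr fun x => ?_
      congr 2
      refine lintegral_congr fun t => ?_
      rw [div_eq_mul_inv, mul_comm])
  refine ⟨S, hS, hS1, fun x ρ hx hxρ => ?_⟩
  rcases eq_or_ne (G ρ) 0 with h0 | h0
  · simp [h0, nFun_zero]
  obtain ⟨r, r', hr, hr', hxr, hrr, h4, h2, hr'top, hle⟩ :=
    hS2 x ρ (hx.trans_le hxρ) hxρ.eq_or_lt h0 (hfin ρ)
  refine le_trans (nFun_mono q ?_) hle
  refine mul_le_mul' (hcmono x ρ r hx hxρ (le_of_lt hxr)) ?_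
  refine ENNReal.div_le_of_le_mul' (h4.trans ?_)
  gcongr
  have h5 : G r = G r' + ∫⁻ t in Ioc r r', g t / μ (Iio t) ∂μ := by
    simp only [hG, adjAverage]
    rw [add_comm, ← lintegral_union measurableSet_Ioi, Ioc_union_Ioi_eq_Ioi (le_of_lt hrr)]
    exact Set.disjoint_left.2 fun t ht ht' => absurd (mem_Ioi.1 ht') (not_lt.2 ht.2)
  rw [h2, two_mul, ENNReal.add_right_inj hr'top] at h5
  rw [h5]
  have h6 : {t | r < t ∧ ¬ r' < t} = Ioc r r' := by ext t; simp
  rw [h6]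
  refine lintegral_mono fun t => ?_
  rw [div_eq_mul_inv, mul_comm]

end Sufficiency

end DunklOrlicz

namespace DunklOrlicz
open IsAdmissible

/-! ### The logarithmic part, and all three parts together. -/

section LogKernel

variable {μ ω : Measure ℝ} {p q : ℝ≥0 → ℝ≥0}

theorem log_div_le_log_div {x y t : ℝ} (hx : 0 < x) (hxy : x ≤ y) (ht : 0 < t) :
    Real.log (t / y) ≤ Real.log (t / x) :=
  Real.log_le_log (div_pos ht (hx.trans_le hxy)) (div_le_div_of_nonneg_left ht.le hx hxy)

theorem log_div_mono {x r r' : ℝ} (hx : 0 < x) (hr : 0 < r) (h : r ≤ r') :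
    Real.log (r / x) ≤ Real.log (r' / x) :=
  Real.log_le_log (div_pos hr hx) (div_le_div_of_nonneg_right h hx.le)

/-- `∫ₓ^∞ log(t/x) g(t)/V(t) dμ(t)`. -/
noncomputable def logAverage (μ : Measure ℝ) (g : ℝ → ℝ≥0∞) (x : ℝ) : ℝ≥0∞ :=
  ∫⁻ t in Ioi x, ENNReal.ofReal (Real.log (t / x)) * (g t / μ (Iio t)) ∂μ

theorem IsNice.logAverage_lt_top (hμ : IsAdmissible μ) {g : ℝ → ℝ≥0∞} (hg : IsNice μ g) {x : ℝ}
    (hx : 0 < x) : logAverage μ g x < ∞ := by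
  have h := hg.lintegral_mul_lt_top hμ
    (k := (Ioi x).indicator fun t => ENNReal.ofReal (Real.log (t / x)))
    (B := fun n => (Real.log (n / x)).toNNReal) fun n t ht => by
      by_cases htx : t ∈ Ioi x
      · rw [indicator_of_mem htx]
        exact ENNReal.ofReal_le_ofReal (log_div_mono hx (hx.trans htx) ht.le)
      · rw [indicator_of_notMem htx]; exact zero_le
  refine lt_of_le_of_lt (le_of_eq ?_) h
  rw [logAverage, ← lintegral_indicator measurableSet_Ioi]
  refine lintegral_congr fun t => ?_
  by_cases htx : t ∈ Ioi x <;> simp [htx]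

theorem logAverage_antitone {g : ℝ → ℝ≥0∞} {x y : ℝ} (hx : 0 < x) (hxy : x ≤ y) :
    logAverage μ g y ≤ logAverage μ g x := by
  refine (setLIntegral_mono' measurableSet_Ioi fun t ht => ?_).trans
    (lintegral_mono_set (Ioi_subset_Ioi hxy))
  gcongr ENNReal.ofReal ?_ * _
  exact log_div_le_log_div hx hxy (hx.trans_le (hxy.trans (mem_Ioi.1 ht).le))

/-- Beyond `r'` the identity `log(t/r) = log(r'/r) + log(t/r')` separates a plain tail from the
logarithmic one. -/
theorem logAverage_eq {g : ℝ → ℝ≥0∞} (hg : Measurable g) {r r' : ℝ} (hr : 0 < r) (h : r < r') :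
    logAverage μ g r
      = ∫⁻ t in Ioc r r', ENNReal.ofReal (Real.log (t / r)) * (g t / μ (Iio t)) ∂μ
        + ENNReal.ofReal (Real.log (r' / r)) * adjAverage μ g r' + logAverage μ g r' := by
  have hVm := measurable_Iio μ
  have h1 : ∫⁻ t in Ioi r', ENNReal.ofReal (Real.log (t / r)) * (g t / μ (Iio t)) ∂μ
      = ENNReal.ofReal (Real.log (r' / r)) * adjAverage μ g r' + logAverage μ g r' := by
    rw [adjAverage, ← lintegral_const_mul' _ _ (by simp), logAverage,
      ← lintegral_add_left (show Measurable fun t => ENNReal.ofReal (Real.log (r' / r)) *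
        (g t / μ (Iio t)) from (hg.div hVm).const_mul _)]
    refine setLIntegral_congr_fun measurableSet_Ioi fun t ht => ?_
    have hr' : 0 < r' := hr.trans h
    have ht0 : 0 < t := hr'.trans ht
    rw [← add_mul, ← ENNReal.ofReal_add]
    · rw [← Real.log_mul (by positivity) (by positivity)]
      congr 3
      field_simp
    · exact Real.log_nonneg ((one_le_div hr).2 h.le)
    · exact Real.log_nonneg ((one_le_div hr').2 (mem_Ioi.1 ht).le)
  rw [add_assoc, ← h1, logAverage, ← lintegral_union measurableSet_Ioi,
    Ioc_union_Ioi_eq_Ioi h.le]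
  exact Set.disjoint_left.2 fun t ht ht' => absurd (mem_Ioi.1 ht') (not_lt.2 ht.2)

/-- Between cuts with `G r = 2 G r'`, cancelling one `G r'` leaves a block integral, controlled by
`H3` through the discretization of `G`, plus `log(r'/r)` times the tail at `r'`. The latter is
controlled by `H4` through a second discretization, along the levels of the tail. -/
theorem exists_majorant_log {C : ℝ≥0} (hC : ∀ a : ℤ → ℝ≥0∞,
      ∑' i, nFun q (nInv (nFun p) (a i)) ≤ C * nFun q (nInv (nFun p) (∑' i, a i)))
    (hμ : IsAdmissible μ) {W : ℝ → ℝ≥0∞} (hW : AEMeasurable W ω) {g : ℝ → ℝ≥0∞} (hg : IsNice μ g)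
    (H3 : ∀ r, 0 < r → ∀ g' : ℝ → ℝ≥0∞, Measurable g' →
      ∫⁻ x in Iio r, nFun q (W x *
        ∫⁻ t in Ioi r, ENNReal.ofReal (Real.log (t / r)) * (g' t / μ (Iio t)) ∂μ) ∂ω
        ≤ nFun q (nInv (nFun p) (∫⁻ t, nFun p (g' t) ∂μ)))
    (H4 : ∀ r, 0 < r → ∀ g' : ℝ → ℝ≥0∞, Measurable g' →
      ∫⁻ x in Iio r, nFun q (W x * ENNReal.ofReal (Real.log (r / x)) *
        ∫⁻ t in Ioi r, g' t / μ (Iio t) ∂μ) ∂ω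
        ≤ nFun q (nInv (nFun p) (∫⁻ t, nFun p (g' t) ∂μ))) :
    ∃ S : ℝ → ℝ≥0∞, AEMeasurable S ω ∧
      ∫⁻ x, S x ∂ω ≤ 2 * C * nFun q (nInv (nFun p) (∫⁻ t, nFun p (g t) ∂μ)) ∧
      ∀ x, 0 < x → nFun q (W x * (logAverage μ g x / 32)) ≤ S x := by
  have hgm := hg.1
  have hVm := measurable_Iio μ
  obtain ⟨S', hSm', hS', hle'⟩ := exists_majorant_tail hC hμ (ω := ω)
    (c := fun x r => W x * ENNReal.ofReal (Real.log (r / x)))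
    (fun r => hW.mul (by fun_prop))
    (fun x r r' hx hxr hrr => by
      gcongr W x * ENNReal.ofReal ?_
      exact log_div_mono hx (hx.trans_le hxr) hrr) hg H4
  have hAm : Measurable (adjAverage μ g) := Antitone.measurable fun x y h =>
    lintegral_mono_set (Ioi_subset_Ioi h)
  set ν := (volume : Measure ℝ).withDensity fun s => ENNReal.ofReal s⁻¹ * adjAverage μ g s with hν
  have hGν : ∀ x, 0 < x → ν (Ioi x) = logAverage μ g x := fun x hx => by
    rw [hν, withDensity_apply _ measurableSet_Ioi, logAverage,
      setLIntegral_log_mul hμ (h := fun t => g t / μ (Iio t)) (hgm.div hVm) hx]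
    rfl
  obtain ⟨S, hSm, hS, hle⟩ := exists_majorant (μ := μ) (ω := ω) hC (fun x y => x < y)
    (fun x => lt_irrefl x) (fun x y z h1 h2 => h1.trans h2) lt_trichotomy
    (fun r => measurableSet_Ioi) (fun r => measurableSet_Iio) (G := logAverage μ g)
    (fun x y hx _ h => logAverage_antitone hx h.le)
    (fun x s hx hs0 hs => by
      rw [← hGν x hx] at hs
      obtain ⟨r, hr, he⟩ := exists_measure_Ioi_eq
        (hGν x hx ▸ (hg.logAverage_lt_top hμ hx).ne) hs0 hs
      exact ⟨r, hx.trans hr, hr, hGν r (hx.trans hr) ▸ he⟩)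
    (c := fun x _ => W x)
    (n := fun r t => ENNReal.ofReal (Real.log (t / r)) * (μ (Iio t))⁻¹) (fun _ => hW) hgm
    (fun r hr g' hg' => by
      refine le_trans (le_of_eq ?_) (H3 r hr g' hg')
      refine lintegral_congr fun x => ?_
      congr 2
      refine lintegral_congr fun t => ?_
      rw [div_eq_mul_inv (g' t), mul_assoc, mul_comm (g' t)])
  refine ⟨fun x => S x + S' x, hSm.add hSm', ?_, fun x hx => ?_⟩
  · rw [lintegral_add_left' hSm]
    refine (add_le_add hS hS').trans_eq ?_
    ring
  rcases eq_or_ne (logAverage μ g x) 0 with h0 | h0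
  · simp [h0, nFun_zero]
  obtain ⟨r, r', hr, hr', hxr, hrr, h4, h2, hr'top, hle1⟩ :=
    hle x x hx (Or.inl rfl) h0 (hg.logAverage_lt_top hμ hx).ne
  set L := ∫⁻ t in Ioc r r', ENNReal.ofReal (Real.log (t / r)) * (g t / μ (Iio t)) ∂μ with hL
  set M := ENNReal.ofReal (Real.log (r' / x)) * adjAverage μ g r' with hM
  have hLM : logAverage μ g r' ≤ L + M := by
    have h5 := logAverage_eq (μ := μ) hgm hr hrr
    rw [h2, two_mul, ENNReal.add_left_inj hr'top] at h5
    rw [h5, hM]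
    gcongr _ + ENNReal.ofReal ?_ * _
    exact log_div_le_log_div hx (le_of_lt hxr) hr'
  have hLS : nFun q (W x * L) ≤ S x := by
    refine le_trans (nFun_mono q ?_) hle1
    have h6 : {t | r < t ∧ ¬ r' < t} = Ioc r r' := by ext t; simp
    rw [h6]
    gcongr
    refine lintegral_mono fun t => ?_
    rw [div_eq_mul_inv (g t), mul_assoc, mul_comm (g t)]
  have hMS : nFun q (W x * M / 4) ≤ S' x := by
    refine le_trans (le_of_eq ?_) (hle' x r' hx ((le_of_lt hxr).trans (le_of_lt hrr)))
    congr 1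
    simp only [hM, div_eq_mul_inv]
    ring
  -- `32 = 4 * 2 * 4`: the level comparison, the splitting of a sum inside `nFun q`, and the quarter
  -- in the tail majorant.
  have e : (32 : ℝ≥0∞)⁻¹ * 8 = 4⁻¹ := by
    rw [show (32 : ℝ≥0∞) = 4 * 8 by norm_num, ENNReal.mul_inv (by norm_num) (by norm_num), mul_assoc,
      ENNReal.inv_mul_cancel (by norm_num) (by norm_num), mul_one]
  calc nFun q (W x * (logAverage μ g x / 32))
      ≤ nFun q (W x * (4 * (L + M) / 32)) := by
        refine nFun_mono q ?_
        gcongr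
        exact h4.trans (by gcongr)
    _ = nFun q (W x * (4 * L / 32) + W x * (4 * M / 32)) := by
        rw [← mul_add, ← ENNReal.add_div, ← mul_add]
    _ ≤ nFun q (2 * (W x * (4 * L / 32))) + nFun q (2 * (W x * (4 * M / 32))) := nFun_add_le q _ _
    _ ≤ S x + S' x := by
        have e1 : ∀ z, 2 * (W x * (4 * z / 32)) = W x * z / 4 := fun z => by
          rw [div_eq_mul_inv, div_eq_mul_inv, ← e]; ring
        rw [e1, e1]
        gcongr
        refine le_trans (nFun_mono q ?_) hLS
        exact ENNReal.div_le_of_le_mul (le_mul_of_one_le_right' (by norm_num))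

/-- The test inequalities imply the modular inequality for the Calderón kernel, for nice functions. -/
theorem lintegral_calderonKernel_le_of_test {C : ℝ≥0} (hC1 : 1 ≤ C) (hC : ∀ a : ℤ → ℝ≥0∞,
      ∑' i, nFun q (nInv (nFun p) (a i)) ≤ C * nFun q (nInv (nFun p) (∑' i, a i)))
    (hq : Monotone q) (hμ : IsAdmissible μ) (hω : ∀ᵐ x ∂ω, 0 < x)
    {W : ℝ → ℝ≥0∞} (hW : AEMeasurable W ω)
    (H1 : ∀ r, 0 < r → ∀ g' : ℝ → ℝ≥0∞, Measurable g' →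
      ∫⁻ x in Ioi r, nFun q (W x * ENNReal.ofReal x⁻¹ *
        ∫⁻ t in Iio r, ENNReal.ofReal t * (g' t / μ (Iio t)) ∂μ) ∂ω
        ≤ nFun q (nInv (nFun p) (∫⁻ t, nFun p (g' t) ∂μ)))
    (H2 : ∀ r, 0 < r → ∀ g' : ℝ → ℝ≥0∞, Measurable g' →
      ∫⁻ x in Iio r, nFun q (W x * ∫⁻ t in Ioi r, g' t / μ (Iio t) ∂μ) ∂ω
        ≤ nFun q (nInv (nFun p) (∫⁻ t, nFun p (g' t) ∂μ)))
    (H3 : ∀ r, 0 < r → ∀ g' : ℝ → ℝ≥0∞, Measurable g' →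
      ∫⁻ x in Iio r, nFun q (W x *
        ∫⁻ t in Ioi r, ENNReal.ofReal (Real.log (t / r)) * (g' t / μ (Iio t)) ∂μ) ∂ω
        ≤ nFun q (nInv (nFun p) (∫⁻ t, nFun p (g' t) ∂μ)))
    (H4 : ∀ r, 0 < r → ∀ g' : ℝ → ℝ≥0∞, Measurable g' →
      ∫⁻ x in Iio r, nFun q (W x * ENNReal.ofReal (Real.log (r / x)) *
        ∫⁻ t in Ioi r, g' t / μ (Iio t) ∂μ) ∂ω
        ≤ nFun q (nInv (nFun p) (∫⁻ t, nFun p (g' t) ∂μ)))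
    {g : ℝ → ℝ≥0∞} (hg : IsNice μ g) :
    ∫⁻ x, nFun q (W x / (512 * C) * ∫⁻ t, calderonKernel x t * (g t / μ (Iio t)) ∂μ) ∂ω
      ≤ nFun q (nInv (nFun p) (∫⁻ t, nFun p (g t) ∂μ)) := by
  have hgm := hg.1
  have hVm := measurable_Iio μ
  obtain ⟨S1, hm1, hS1, h1⟩ := exists_majorant_head hC hμ
    (W := fun x => W x * ENNReal.ofReal x⁻¹) (hW.mul (by fun_prop)) hg H1
  obtain ⟨S2, hm2, hS2, h2⟩ := exists_majorant_tail hC hμ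
    (c := fun x _ => W x) (fun _ => hW) (fun _ _ _ _ _ _ => le_rfl) hg H2
  obtain ⟨S3, hm3, hS3, h3⟩ := exists_majorant_log hC hμ hW hg H3 H4
  set T := nFun q (nInv (nFun p) (∫⁻ t, nFun p (g t) ∂μ)) with hT
  have hC0 : (C : ℝ≥0∞) ≠ 0 := by exact_mod_cast (zero_lt_one.trans_le hC1).ne'
  have hsum : ∫⁻ x, (S1 x + (S2 x + S3 x)) ∂ω ≤ 4 * C * T := by
    rw [lintegral_add_left' hm1, lintegral_add_left' hm2]
    calc _ ≤ C * T + (C * T + 2 * C * T) := by gcongr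
      _ = _ := by ring
  -- `512 C = 4 C * 128`. The integrals of the majorants add up to `C + C + 2C = 4C` times the right
  -- side. Two successive splittings turn `1/128` into `1/64` for the head and `1/32` for both
  -- tails, as small as each majorant requires.
  have hpt : ∀ x, 0 < x → 4 * C * nFun q (W x / (512 * C) *
      ∫⁻ t, calderonKernel x t * (g t / μ (Iio t)) ∂μ) ≤ S1 x + (S2 x + S3 x) := by
    intro x hx
    refine (mul_nFun_le hq ?_ _).trans ?_
    · exact one_le_mul (by norm_num) (by exact_mod_cast hC1)
    rw [lintegral_calderonKernel_mul_eq hμ (h := fun t => g t / μ (Iio t)) (hgm.div hVm) hx]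
    set a := ∫⁻ t in Iio x, ENNReal.ofReal t * (g t / μ (Iio t)) ∂μ
    change nFun q (4 * C * (W x / (512 * C) * (ENNReal.ofReal x⁻¹ * a +
      (adjAverage μ g x + logAverage μ g x)))) ≤ _
    have e0 : 4 * C * (W x / (512 * C) * (ENNReal.ofReal x⁻¹ * a +
        (adjAverage μ g x + logAverage μ g x)))
        = W x * (ENNReal.ofReal x⁻¹ * a) / 128
          + (W x * adjAverage μ g x / 128 + W x * logAverage μ g x / 128) := by
      have : (4 * (C : ℝ≥0∞)) * (512 * (C : ℝ≥0∞))⁻¹ = 128⁻¹ := by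
        rw [show (512 * (C : ℝ≥0∞)) = 128 * (4 * C) by ring,
          ENNReal.mul_inv (Or.inl (by norm_num)) (Or.inl (by norm_num)), mul_comm, mul_assoc,
          ENNReal.inv_mul_cancel (by positivity) (by finiteness), mul_one]
      simp only [div_eq_mul_inv]
      rw [← this]
      ring
    rw [e0]
    refine (nFun_add_le q _ _).trans ?_
    have half : ∀ (z : ℝ≥0∞), 2 * (z / 128) = z / 64 := fun z => by
      rw [← mul_div_assoc, show (128 : ℝ≥0∞) = 2 * 64 by norm_num,
        ENNReal.mul_div_mul_left _ _ (by norm_num) (by norm_num)]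
    have half' : ∀ (z : ℝ≥0∞), 2 * (z / 64) = z / 32 := fun z => by
      rw [← mul_div_assoc, show (64 : ℝ≥0∞) = 2 * 32 by norm_num,
        ENNReal.mul_div_mul_left _ _ (by norm_num) (by norm_num)]
    rw [half, mul_add, half, half]
    refine add_le_add (le_trans (nFun_mono q ?_) (h1 x hx)) ((nFun_add_le q _ _).trans ?_)
    · rw [mul_assoc, ← mul_div_assoc, ← mul_div_assoc]
      gcongr
      norm_num
    rw [half', half']
    refine add_le_add (le_trans (nFun_mono q ?_) (h2 x x hx le_rfl)) (le_trans (nFun_mono q ?_) (h3 x hx))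
    · rw [← mul_div_assoc]
      gcongr
      norm_num
    · rw [← mul_div_assoc]
  have h5 : 4 * C * ∫⁻ x, nFun q (W x / (512 * C) *
      ∫⁻ t, calderonKernel x t * (g t / μ (Iio t)) ∂μ) ∂ω ≤ 4 * C * T := by
    rw [← lintegral_const_mul' _ _ (by finiteness)]
    refine (lintegral_mono_ae ?_).trans hsum
    filter_upwards [hω] with x hx using hpt x hx
  exact (ENNReal.mul_le_mul_iff_right (by positivity) (by finiteness)).1 h5

/-- The modular inequality for the Calderón kernel extends from nice to measurable functions. -/
theorem lintegral_calderonKernel_le_of_nice (hμ : IsAdmissible μ)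
    {W : ℝ → ℝ≥0∞} (hW : AEMeasurable W ω)
    (H : ∀ g : ℝ → ℝ≥0∞, IsNice μ g →
      ∫⁻ x, nFun q (W x * ∫⁻ t, calderonKernel x t * (g t / μ (Iio t)) ∂μ) ∂ω
        ≤ nFun q (nInv (nFun p) (∫⁻ t, nFun p (g t) ∂μ)))
    {g : ℝ → ℝ≥0∞} (hg : Measurable g) :
    ∫⁻ x, nFun q (W x * ∫⁻ t, calderonKernel x t * (g t / μ (Iio t)) ∂μ) ∂ω
      ≤ nFun q (nInv (nFun p) (∫⁻ t, nFun p (g t) ∂μ)) := by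
  have := hμ.sFinite
  have hVm := measurable_Iio μ
  set s : ℕ → Set ℝ := fun n => {t : ℝ | t < n ∧ (n : ℝ≥0∞)⁻¹ ≤ μ (Iio t)} with hs
  have hsm : ∀ n, MeasurableSet (s n) := fun n =>
    measurableSet_Iio.inter (measurableSet_le measurable_const hVm)
  have hsmono : Monotone s := fun m n hmn t ht =>
    ⟨ht.1.trans_le (by exact_mod_cast hmn), le_trans (by gcongr) ht.2⟩
  have hnice : ∀ n, IsNice μ (trunc s g n) := fun n => by
    refine ⟨measurable_trunc hsm hg n, ?_⟩
    rcases Nat.eq_zero_or_pos n with rfl | hn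
    · have h0 : ∀ t, trunc s g 0 t = 0 := fun t => by simpa using trunc_le_natCast s g 0 t
      exact ⟨1, one_pos, fun t => by simp [h0], fun t _ => h0 t⟩
    · exact ⟨n, hn, trunc_le_natCast s g n, fun t ht => trunc_of_notMem ht⟩
  -- Truncations recover `g` only where `V > 0`, which is `μ`-almost everywhere.
  have hsup : ∀ᵐ t ∂μ, ⨆ n, trunc s g n t = g t := by
    filter_upwards [hμ.ae_prim_pos] with t ht
    refine iSup_trunc hsmono ?_
    have hVt : μ (Iio t) ≠ 0 := by
      rw [← hμ.ofReal_prim t]; simpa using ht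
    obtain ⟨n, hn⟩ := ENNReal.exists_inv_nat_lt hVt
    obtain ⟨k, hk⟩ := exists_nat_gt t
    refine ⟨max n k, hk.trans_le (by exact_mod_cast le_max_right n k), le_trans ?_ hn.le⟩
    rw [ENNReal.inv_le_inv]
    exact_mod_cast le_max_left n k
  have htm := fun n => measurable_trunc hsm hg n
  have hKm := measurable_calderonKernel
  have hmono : ∀ x, Monotone fun n => W x * ∫⁻ t, calderonKernel x t *
      (trunc s g n t / μ (Iio t)) ∂μ := fun x m n hmn => by
    dsimp only
    gcongr
    exact monotone_trunc hsmono g hmn _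
  have hinner : ∀ x, ∫⁻ t, calderonKernel x t * (g t / μ (Iio t)) ∂μ
      = ⨆ n, ∫⁻ t, calderonKernel x t * (trunc s g n t / μ (Iio t)) ∂μ := fun x => by
    rw [← lintegral_iSup]
    · refine lintegral_congr_ae ?_
      filter_upwards [hsup] with t ht
      simp only [div_eq_mul_inv]
      rw [← ENNReal.mul_iSup, ← ENNReal.iSup_mul, ht]
    · exact fun n => (hKm.comp (measurable_const.prodMk measurable_id)).mul ((htm n).div hVm)
    · intro m n hmn t
      dsimp only
      gcongr
      exact monotone_trunc hsmono g hmn _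
  calc ∫⁻ x, nFun q (W x * ∫⁻ t, calderonKernel x t * (g t / μ (Iio t)) ∂μ) ∂ω
      = ∫⁻ x, ⨆ n, nFun q (W x * ∫⁻ t, calderonKernel x t * (trunc s g n t / μ (Iio t)) ∂μ) ∂ω := by
        refine lintegral_congr fun x => ?_
        rw [hinner, ENNReal.mul_iSup, nFun_iSup q (hmono x)]
    _ = ⨆ n, ∫⁻ x, nFun q (W x *
          ∫⁻ t, calderonKernel x t * (trunc s g n t / μ (Iio t)) ∂μ) ∂ω := by
        refine lintegral_iSup' (fun n => ?_) (ae_of_all _ fun x m n hmn => nFun_mono q (hmono x hmn))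
        refine (measurable_nFun q).comp_aemeasurable (hW.mul ?_)
        have h1 : Measurable (Function.uncurry fun x t =>
            calderonKernel x t * (trunc s g n t / μ (Iio t))) :=
          hKm.mul (((htm n).div hVm).comp measurable_snd)
        exact h1.lintegral_prod_right'.aemeasurable
    _ ≤ _ := by
        refine iSup_le fun n => (H _ (hnice n)).trans (nFun_mono q (nInv_mono _ ?_))
        exact lintegral_mono fun t => nFun_mono p (trunc_le s g n t)

end LogKernel

end DunklOrlicz

namespace DunklOrlicz
open IsAdmissible

/-! ### Passing between monotone functions and arbitrary ones. -/

section Monotone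

variable {μ ω : Measure ℝ} {p q : ℝ≥0 → ℝ≥0}

/-- The Calderón operator `f ↦ ∫₀^∞ f(s) / max(x, s) ds`. -/
noncomputable def calderon (f : ℝ → ℝ≥0∞) (x : ℝ) : ℝ≥0∞ :=
  ∫⁻ s in Ioi 0, ENNReal.ofReal (max x s)⁻¹ * f s

theorem calderon_mono {f g : ℝ → ℝ≥0∞} (h : ∀ s, 0 < s → f s ≤ g s) (x : ℝ) :
    calderon f x ≤ calderon g x :=
  setLIntegral_mono' measurableSet_Ioi fun s hs => by gcongr; exact h s hs

/-- Inserting `f = adjAverage μ (E g)` turns the Calderón operator into the composed kernel. The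
scaling `E = (C D)⁻¹` cancels both `C` and the Hardy constant `D`; niceness of `g` keeps `f` finite.
-/
theorem lintegral_calderonKernel_le_of_antitone (hμ : IsAdmissible μ) (hp : Monotone p)
    (h2 : Delta2 (nFun p)) {W : ℝ → ℝ≥0∞} (hW : AEMeasurable W ω) (hω : ∀ᵐ x ∂ω, 0 < x)
    {C : ℝ≥0} (hC : 0 < C)
    (H : ∀ f : ℝ → ℝ≥0, AntitoneOn f (Ioi 0) →
      ∫⁻ x, nFun q (W x * calderon (fun s => f s) x) ∂ω
        ≤ nFun q (nInv (nFun p) (∫⁻ t, nFun p (C * f t) ∂μ))) :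
    ∃ c : ℝ≥0, 0 < c ∧ ∀ g : ℝ → ℝ≥0∞, Measurable g →
      ∫⁻ x, nFun q (c * W x * ∫⁻ t, calderonKernel x t * (g t / μ (Iio t)) ∂μ) ∂ω
        ≤ nFun q (nInv (nFun p) (∫⁻ t, nFun p (g t) ∂μ)) := by
  obtain ⟨D, hD, hardy⟩ := exists_lintegral_nFun_adjAverage_le hμ hp h2
  have hcD : (D : ℝ≥0∞) * (C * ((C * D)⁻¹ : ℝ≥0)) = 1 := by
    norm_cast
    field_simp
  refine ⟨(C * D)⁻¹, by positivity, fun g hg =>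
    lintegral_calderonKernel_le_of_nice hμ (hW.const_mul _) (fun g hg => ?_) hg⟩
  set E : ℝ≥0 := (C * D)⁻¹ with hE
  have hEg := hg.const_mul E
  set f : ℝ → ℝ≥0 := fun x => (adjAverage μ (fun t => E * g t) x).toNNReal with hf
  have hfc : ∀ x, (f x : ℝ≥0∞) = adjAverage μ (fun t => E * g t) x := fun x =>
    ENNReal.coe_toNNReal (hEg.adjAverage_lt_top hμ x).ne
  have hfanti : AntitoneOn f (Ioi 0) := fun x _ y _ hxy => by
    rw [← ENNReal.coe_le_coe, hfc, hfc]
    exact lintegral_mono_set (Ioi_subset_Ioi hxy)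
  refine le_trans (le_of_eq (lintegral_congr_ae ?_)) ((H f hfanti).trans
    (nFun_mono q (nInv_mono _ ?_)))
  · filter_upwards [hω] with x hx
    congr 1
    simp only [hfc, calderon]
    rw [lintegral_inv_max_mul_adjAverage hμ hEg.1 hx, mul_comm (E : ℝ≥0∞), mul_assoc]
    congr 1
    rw [← lintegral_const_mul' _ _ (by simp)]
    refine lintegral_congr fun t => ?_
    rw [mul_div_assoc]
    ring
  · simp only [hfc]
    have h3 : ∀ x, C * adjAverage μ (fun t => E * g t) x
        = adjAverage μ (fun t => C * (E * g t)) x := fun x => by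
      simp only [adjAverage]
      rw [← lintegral_const_mul' _ _ (by simp)]
      simp only [mul_div_assoc]
    simp only [h3]
    refine (hardy _ (hEg.const_mul C)).trans_eq (lintegral_congr fun t => ?_)
    rw [← mul_assoc (C : ℝ≥0∞), ← mul_assoc (D : ℝ≥0∞), hcD, one_mul]

theorem lintegral_Ioi_comp_div_two {F : ℝ → ℝ≥0∞} (hF : Measurable F) :
    ∫⁻ s in Ioi 0, F (s / 2) = 2 * ∫⁻ s in Ioi 0, F s := by
  have h := Real.smul_map_volume_mul_left (a := 1 / 2) (by norm_num)
  have h1 : ∫⁻ s, (Ioi 0).indicator F s ∂(volume.map fun s : ℝ => 1 / 2 * s)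
      = ∫⁻ s in Ioi 0, F (s / 2) := by
    rw [lintegral_map (hF.indicator measurableSet_Ioi) (by fun_prop),
      ← lintegral_indicator measurableSet_Ioi]
    refine lintegral_congr fun s => ?_
    have e : 1 / 2 * s = s / 2 := by ring
    by_cases hs : 0 < s
    · rw [e, indicator_of_mem (show s / 2 ∈ Ioi 0 from half_pos hs), indicator_of_mem (mem_Ioi.2 hs)]
    · rw [e, indicator_of_notMem (by simp; linarith), indicator_of_notMem (by simpa using hs)]
  rw [← lintegral_indicator measurableSet_Ioi F]
  conv_rhs => rw [← h]
  rw [lintegral_smul_measure, h1, smul_eq_mul, ← mul_assoc]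
  have : (2 : ℝ≥0∞) * ENNReal.ofReal |1 / 2| = 1 := by
    rw [abs_of_pos (by norm_num), one_div, ENNReal.ofReal_inv_of_pos (by norm_num)]
    simp [ENNReal.mul_inv_cancel]
  rw [this, one_mul]

/-- The largest function of the primitive that is dominated by the non-increasing function `f`. -/
noncomputable def primEnvelope (μ : Measure ℝ) (f : ℝ → ℝ≥0) (s : ℝ) : ℝ≥0∞ :=
  ⨅ (y : ℝ) (_ : 0 < y) (_ : prim μ y ≤ s), (f y : ℝ≥0∞)

theorem primEnvelope_antitone (μ : Measure ℝ) (f : ℝ → ℝ≥0) : Antitone (primEnvelope μ f) :=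
  fun _ _ h => le_iInf fun y => le_iInf fun hy => le_iInf fun hys =>
    iInf_le_of_le y (iInf_le_of_le hy (iInf_le _ (hys.trans h)))

theorem primEnvelope_prim_le (f : ℝ → ℝ≥0) {t : ℝ} (ht : 0 < t) :
    primEnvelope μ f (prim μ t) ≤ f t :=
  iInf_le_of_le t (iInf_le_of_le ht (iInf_le _ le_rfl))

/-- The set `{V(x) < V < 2 V(x)}` lies to the right of `x` and has mass `V(x)`, and there `1/V ≥
1/(2 V(x))`. For `t` in it, `V(y) ≤ V(t)/2 < V(x)` forces `y ≤ x`, so the envelope at `V(t)/2` is at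
least `f x`. -/
theorem le_adjAverage_primEnvelope (hμ : IsAdmissible μ) {f : ℝ → ℝ≥0} (hf : AntitoneOn f (Ioi 0))
    {x : ℝ} (hx : 0 < x) (hx' : 0 < prim μ x) :
    (f x : ℝ≥0∞) ≤ adjAverage μ (fun t => 2 * primEnvelope μ f (prim μ t / 2)) x := by
  set v := prim μ x with hv
  set B : Set ℝ := prim μ ⁻¹' Ioo v (2 * v) with hB
  have hBm : MeasurableSet B := measurable_prim μ measurableSet_Ioo
  have hμB : μ B = ENNReal.ofReal v := by
    rw [hB, ← Measure.map_apply (measurable_prim μ) measurableSet_Ioo, hμ.map_prim,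
      Measure.restrict_apply measurableSet_Ioo, Ioo_inter_Ioi, max_eq_left hx'.le, Real.volume_Ioo]
    congr 1
    ring
  have hBx : B ⊆ Ioi x := fun t ht => by
    by_contra! hle
    exact absurd ht.1 (not_lt.2 (hμ.prim_mono (not_lt.1 hle)))
  have h2v : ENNReal.ofReal (2 * v) = 2 * ENNReal.ofReal v := by
    rw [ENNReal.ofReal_mul (by norm_num)]; simp
  have hv0 : ENNReal.ofReal v ≠ 0 := by simpa using hx'
  calc (f x : ℝ≥0∞) = ∫⁻ _ in B, 2 * f x / ENNReal.ofReal (2 * v) ∂μ := by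
        rw [setLIntegral_const, hμB, h2v, ENNReal.mul_div_mul_left _ _ (by norm_num) (by norm_num),
          ENNReal.div_mul_cancel hv0 (by simp)]
    _ ≤ ∫⁻ t in B, 2 * primEnvelope μ f (prim μ t / 2) / μ (Iio t) ∂μ := by
        refine setLIntegral_mono' hBm fun t ht => ?_
        rw [← hμ.ofReal_prim t]
        refine ENNReal.div_le_div ?_ (ENNReal.ofReal_le_ofReal (le_of_lt ht.2))
        gcongr
        refine le_iInf fun y => le_iInf fun hy => le_iInf fun hyt => ?_
        have hyx : y ≤ x := by
          by_contra! hlt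
          have h1 := hμ.prim_mono hlt.le
          have h2 := ht.2
          linarith
        exact_mod_cast hf hy hx hyx
    _ ≤ _ := lintegral_mono_set hBx

/-- Because the envelope is a function of the primitive, its modular is a Lebesgue integral in `s =
V(t)`. The dilation `s / 2` then costs a factor `2`, absorbed into the argument by convexity. -/
theorem lintegral_nFun_primEnvelope_le (hμ : IsAdmissible μ) (hp : Monotone p) (f : ℝ → ℝ≥0) :
    ∫⁻ t, nFun p (2 * primEnvelope μ f (prim μ t / 2)) ∂μ ≤ ∫⁻ t, nFun p (4 * f t) ∂μ := by
  set F : ℝ → ℝ≥0∞ := fun s => nFun p (2 * primEnvelope μ f s) with hF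
  have hFm : Measurable F :=
    (measurable_nFun p).comp ((primEnvelope_antitone μ f).measurable.const_mul 2)
  calc ∫⁻ t, F (prim μ t / 2) ∂μ = ∫⁻ s in Ioi 0, F (s / 2) :=
        hμ.lintegral_comp_prim (F := fun s => F (s / 2)) (hFm.comp (measurable_id.div_const 2))
    _ = 2 * ∫⁻ s in Ioi 0, F s := lintegral_Ioi_comp_div_two hFm
    _ = 2 * ∫⁻ t, F (prim μ t) ∂μ := by rw [hμ.lintegral_comp_prim hFm]
    _ ≤ 2 * ∫⁻ t, nFun p (2 * f t) ∂μ := by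
        gcongr 2 * ?_
        refine lintegral_mono_ae ?_
        filter_upwards [hμ.ae_pos] with t ht
        refine nFun_mono p ?_
        gcongr
        exact primEnvelope_prim_le f ht
    _ = ∫⁻ t, 2 * nFun p (2 * f t) ∂μ := (lintegral_const_mul' _ _ (by norm_num)).symm
    _ ≤ _ := by
        refine lintegral_mono fun t => (mul_nFun_le hp one_le_two _).trans_eq ?_
        rw [← mul_assoc]
        norm_num

/-- If the primitive vanishes near zero, then `adjAverage` of a function that does not vanish near
the left end of the support is infinite near zero. -/
theorem adjAverage_eq_top (hμ : IsAdmissible μ) {x : ℝ} (hx : prim μ x = 0) {η : ℝ≥0} (hη : 0 < η) :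
    adjAverage μ ({t | prim μ t ≤ 1}.indicator fun _ => (η : ℝ≥0∞)) x = ∞ := by
  have := hμ.nullSingleton
  have hη0 : (η : ℝ≥0∞) ≠ 0 := by exact_mod_cast hη.ne'
  have hset : MeasurableSet {t | prim μ t ≤ 1} := measurableSet_le (measurable_prim μ) measurable_const
  have hx0 : μ (Iic x) = 0 := by
    rw [measure_congr Iio_ae_eq_Iic.symm, ← hμ.ofReal_prim x, hx, ENNReal.ofReal_zero]
  have hrestr : μ.restrict (Ioi x) = μ := by
    refine Measure.restrict_eq_self_of_ae_mem ?_
    rw [ae_iff]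
    convert hx0 using 2
    ext t; simp
  have h1 : adjAverage μ ({t | prim μ t ≤ 1}.indicator fun _ => (η : ℝ≥0∞)) x
      = ∫⁻ s in Ioi 0, (Iic 1).indicator (fun s => η / ENNReal.ofReal s) s := by
    rw [adjAverage, hrestr, ← hμ.lintegral_comp_prim
      (Measurable.indicator (by fun_prop) measurableSet_Iic)]
    refine lintegral_congr fun t => ?_
    rw [← hμ.ofReal_prim t]
    by_cases ht : prim μ t ≤ 1
    · rw [indicator_of_mem (show t ∈ {t | prim μ t ≤ 1} from ht), indicator_of_mem (mem_Iic.2 ht)]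
    · rw [indicator_of_notMem (show t ∉ {t | prim μ t ≤ 1} from ht), ENNReal.zero_div,
        indicator_of_notMem (by simpa using ht)]
  rw [h1, lintegral_indicator measurableSet_Iic, Measure.restrict_restrict measurableSet_Iic]
  -- Divergence of `∫₀¹ ds/s`: the part over `(e^(-r), 1)` already contributes `r`.
  have h2 : ∀ r : ℝ≥0, η * (r : ℝ≥0∞)
      ≤ ∫⁻ s in Iic 1 ∩ Ioi 0, η / ENNReal.ofReal s := fun r => by
    have he : Real.exp (-r) ≤ 1 := Real.exp_le_one_iff.2 (by simp)
    have h3 := lintegral_Ioo_inv (Real.exp_pos (-r)) he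
    rw [one_div, Real.log_inv, Real.log_exp, neg_neg, ENNReal.ofReal_coe_nnreal] at h3
    rw [← h3, ← lintegral_const_mul' _ _ (by simp)]
    refine le_trans (setLIntegral_mono' measurableSet_Ioo fun s hs => ?_)
      (lintegral_mono_set fun s hs => ⟨hs.2.le, (Real.exp_pos _).trans hs.1⟩)
    rw [ENNReal.ofReal_inv_of_pos ((Real.exp_pos _).trans hs.1), div_eq_mul_inv]
  refine ENNReal.eq_top_of_forall_nnreal_le fun r => ?_
  refine le_trans ?_ (h2 (r / η))
  rw [← ENNReal.coe_mul, mul_div_cancel₀ r hη.ne']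

/-- The degenerate case. The function `η` on `{V ≤ 1}` has modular `Φ(η)`, but its transform is
infinite at every `x > 0`. The left side is thus at most `Ψ(η)` for every `η > 0`, and convexity
gives `Ψ(1/(n+1)) ≤ Ψ(1)/(n+1)`. -/
theorem lintegral_mul_top_eq_zero (hμ : IsAdmissible μ) (hp : IsNGenerator p)
    (hq : IsNGenerator q) (hω : ∀ᵐ x ∂ω, 0 < x) {W : ℝ → ℝ≥0∞}
    (H : ∀ g : ℝ → ℝ≥0∞, Measurable g →
      ∫⁻ x, nFun q (W x * ∫⁻ t, calderonKernel x t * (g t / μ (Iio t)) ∂μ) ∂ω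
        ≤ nFun q (nInv (nFun p) (∫⁻ t, nFun p (g t) ∂μ)))
    {x₀ : ℝ} (hx₀ : 0 < x₀) (hx₀' : prim μ x₀ = 0) :
    ∫⁻ x, nFun q (W x * ∞) ∂ω = 0 := by
  have hset : MeasurableSet {t | prim μ t ≤ 1} := measurableSet_le (measurable_prim μ) measurable_const
  have key : ∀ η : ℝ≥0, 0 < η → ∫⁻ x, nFun q (W x * ∞) ∂ω ≤ nFun q η := by
    intro η hη
    set g : ℝ → ℝ≥0∞ := {t | prim μ t ≤ 1}.indicator fun _ => (η : ℝ≥0∞) with hg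
    have hgm : Measurable g := measurable_const.indicator hset
    refine le_trans (lintegral_mono_ae ?_) ((H g hgm).trans (nFun_mono q (hp.nInv_le_iff.2 ?_)))
    · filter_upwards [hω] with x hx
      rw [← lintegral_inv_max_mul_adjAverage hμ hgm hx]
      refine nFun_mono q (mul_le_mul_right (le_of_eq ?_) _)
      symm
      rw [eq_top_iff]
      set b := ENNReal.ofReal (max x x₀)⁻¹ with hb
      have hb0 : b ≠ 0 := by
        rw [hb]
        simp only [ne_eq, ENNReal.ofReal_eq_zero, not_le]
        positivity
      calc (∞ : ℝ≥0∞) = ∫⁻ _ in Ioo 0 x₀, b * ∞ := by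
            rw [setLIntegral_const, ENNReal.mul_top hb0, ENNReal.top_mul]
            simpa using hx₀
        _ ≤ ∫⁻ s in Ioo 0 x₀, ENNReal.ofReal (max x s)⁻¹ * adjAverage μ g s := by
            refine setLIntegral_mono' measurableSet_Ioo fun s hs => ?_
            rw [hg, adjAverage_eq_top hμ (le_antisymm ((hμ.prim_mono hs.2.le).trans hx₀'.le)
              (prim_nonneg μ s)) hη, hb]
            gcongr
            exact hs.2.le
        _ ≤ _ := lintegral_mono_set fun s hs => hs.1
    · have h1 : ∀ t, nFun p (g t) = {t | prim μ t ≤ 1}.indicator (fun _ => nFun p η) t := fun t => by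
        by_cases ht : t ∈ {t | prim μ t ≤ 1} <;> simp only [hg, ht, indicator_of_mem,
          indicator_of_notMem, not_false_eq_true, nFun_zero]
      simp only [h1]
      rw [lintegral_indicator hset, setLIntegral_const, hμ.measure_setOf_prim_le]
      simp
  refine le_antisymm (ENNReal.le_of_forall_pos_le_add fun ε hε _ => ?_) zero_le
  rw [zero_add]
  obtain ⟨n, hn⟩ := exists_nat_gt ((nFun q 1).toNNReal / ε)
  have hn' : (0 : ℝ≥0) < n + 1 := by positivity
  have h1 := mul_nFun_le hq.monotone (c := ((n + 1 : ℝ≥0) : ℝ≥0∞)) (by simp)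
    (((n + 1 : ℝ≥0)⁻¹ : ℝ≥0) : ℝ≥0∞)
  rw [← ENNReal.coe_mul, mul_inv_cancel₀ hn'.ne', ENNReal.coe_one] at h1
  refine (key (n + 1)⁻¹ (by positivity)).trans ?_
  have h2 : nFun q 1 ≤ ((n + 1 : ℝ≥0) : ℝ≥0∞) * ε := by
    have hfin : nFun q 1 ≠ ∞ := by
      have := nFun_lt_top hq.monotone 1
      simpa using this.ne
    rw [← ENNReal.coe_toNNReal hfin, ← ENNReal.coe_mul, ENNReal.coe_le_coe]
    rw [div_lt_iff₀ hε] at hn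
    refine hn.le.trans ?_
    gcongr
    simp
  exact (ENNReal.mul_le_mul_iff_right (by exact_mod_cast hn'.ne') (by simp)).1 (h1.trans h2)

/-- The modular inequality for the Calderón kernel implies the one for the Calderón operator on
non-increasing functions. -/
theorem lintegral_calderon_le_of_kernel (hμ : IsAdmissible μ) (hp : IsNGenerator p)
    (hq : IsNGenerator q) (hω : ∀ᵐ x ∂ω, 0 < x) {W : ℝ → ℝ≥0∞}
    (H : ∀ g : ℝ → ℝ≥0∞, Measurable g →
      ∫⁻ x, nFun q (W x * ∫⁻ t, calderonKernel x t * (g t / μ (Iio t)) ∂μ) ∂ω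
        ≤ nFun q (nInv (nFun p) (∫⁻ t, nFun p (g t) ∂μ)))
    {f : ℝ → ℝ≥0} (hf : AntitoneOn f (Ioi 0)) :
    ∫⁻ x, nFun q (W x * calderon (fun s => f s) x) ∂ω
      ≤ nFun q (nInv (nFun p) (∫⁻ t, nFun p (4 * f t) ∂μ)) := by
  by_cases hV : ∃ x₀, 0 < x₀ ∧ prim μ x₀ = 0
  · obtain ⟨x₀, hx₀, hx₀'⟩ := hV
    refine le_trans (lintegral_mono fun x => ?_)
      ((lintegral_mul_top_eq_zero hμ hp hq hω H hx₀ hx₀').trans_le zero_le)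
    exact nFun_mono q (by gcongr; exact le_top)
  · push Not at hV
    set g : ℝ → ℝ≥0∞ := fun t => 2 * primEnvelope μ f (prim μ t / 2) with hg
    have hgm : Measurable g := ((primEnvelope_antitone μ f).measurable.comp
      ((measurable_prim μ).div_const 2)).const_mul 2
    refine le_trans (lintegral_mono_ae ?_) ((H g hgm).trans
      (nFun_mono q (nInv_mono _ (lintegral_nFun_primEnvelope_le hμ hp.monotone f))))
    filter_upwards [hω] with x hx
    rw [← lintegral_inv_max_mul_adjAverage hμ hgm hx]
    refine nFun_mono q (mul_le_mul_right ?_ _)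
    exact calderon_mono (fun s hs => le_adjAverage_primEnvelope hμ hf hs
      (lt_of_le_of_ne (prim_nonneg μ s) (hV s hs).symm)) x

end Monotone

end DunklOrlicz

namespace DunklOrlicz
open IsAdmissible

/-! ### Weights as measures. -/

section Weights

/-- The measure `v(x) dx` on `(0,∞)`. -/
noncomputable def weightMeasure (v : ℝ → ℝ≥0) : Measure ℝ :=
  (volume.restrict (Ioi 0)).withDensity fun x => (v x : ℝ≥0∞)

variable {v w : ℝ → ℝ≥0} {p q : ℝ≥0 → ℝ≥0}

/-- The density is finite-valued, so the integrand `F` needs no measurability. -/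
theorem setLIntegral_weightMeasure (hv : IsWeight v) {X : Set ℝ} (hX : MeasurableSet X)
    (hX0 : X ⊆ Ioi 0) (F : ℝ → ℝ≥0∞) :
    ∫⁻ x in X, F x ∂weightMeasure v = ∫⁻ x in X, F x * v x := by
  rw [weightMeasure, restrict_withDensity hX, Measure.restrict_restrict hX,
    inter_eq_self_of_subset_left hX0, lintegral_withDensity_eq_lintegral_mul_non_measurable₀]
  · simp [mul_comm]
  · exact (hv.mono_measure (Measure.restrict_mono hX0 le_rfl)).coe_nnreal_ennreal
  · exact ae_of_all _ fun x => by simp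

theorem weightMeasure_Iic_zero (v : ℝ → ℝ≥0) : weightMeasure v (Iic 0) = 0 := by
  rw [weightMeasure, withDensity_apply _ measurableSet_Iic,
    Measure.restrict_restrict measurableSet_Iic, inter_comm, Ioi_inter_Iic, Ioc_self]
  simp

theorem ae_weightMeasure_pos (v : ℝ → ℝ≥0) : ∀ᵐ x ∂weightMeasure v, 0 < x := by
  rw [ae_iff]
  simp only [not_lt]
  exact weightMeasure_Iic_zero v

theorem restrict_Ioi_weightMeasure (v : ℝ → ℝ≥0) :
    (weightMeasure v).restrict (Ioi 0) = weightMeasure v :=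
  Measure.restrict_eq_self_of_ae_mem (ae_weightMeasure_pos v)

theorem lintegral_weightMeasure (hv : IsWeight v) (F : ℝ → ℝ≥0∞) :
    ∫⁻ x, F x ∂weightMeasure v = ∫⁻ x in Ioi 0, F x * v x := by
  rw [← setLIntegral_weightMeasure hv measurableSet_Ioi Subset.rfl,
    restrict_Ioi_weightMeasure]

theorem weightMeasure_Iio (v : ℝ → ℝ≥0) (x : ℝ) : weightMeasure v (Iio x) = primitive v x := by
  rw [weightMeasure, withDensity_apply _ measurableSet_Iio,
    Measure.restrict_restrict measurableSet_Iio, inter_comm, Ioi_inter_Iio, primitive]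

theorem restrict_Ioo_weightMeasure (v : ℝ → ℝ≥0) (r : ℝ) :
    (weightMeasure v).restrict (Ioo 0 r) = (weightMeasure v).restrict (Iio r) := by
  rw [← Ioi_inter_Iio, inter_comm, ← Measure.restrict_restrict measurableSet_Iio,
    restrict_Ioi_weightMeasure]

theorem isAdmissible_weightMeasure (hv_fin : ∀ x : ℝ, 0 < x → primitive v x < ∞)
    (hv_inf : Tendsto (primitive v) atTop (𝓝 ∞)) : IsAdmissible (weightMeasure v) where
  sFinite := by unfold weightMeasure; infer_instance
  nullSingleton := by unfold weightMeasure; infer_instance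
  Iic_zero := weightMeasure_Iic_zero v
  Iio_lt_top x := by
    refine (measure_mono (Iio_subset_Iio (le_max_left x 1))).trans_lt ?_
    rw [weightMeasure_Iio]
    exact hv_fin _ (by positivity)
  measure_univ_eq_top := by
    refine top_le_iff.1 (le_of_tendsto' hv_inf fun x => ?_)
    rw [← weightMeasure_Iio]
    exact measure_mono (subset_univ _)

theorem luxNorm_eq_luxNormMeasure (hv : IsWeight v) (Φ : ℝ≥0∞ → ℝ≥0∞) (ε : ℝ≥0) (h : ℝ → ℝ≥0∞) :
    luxNorm Φ (fun y => ε * v y) h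
      = luxNormMeasure Φ ((ε : ℝ≥0∞) • weightMeasure v) h := by
  have hmod : ∀ τ : ℝ≥0, modular Φ (fun y => ε * v y) (fun x => h x / τ)
      = ∫⁻ x, Φ (h x / τ) ∂((ε : ℝ≥0∞) • weightMeasure v) := fun τ => by
    rw [modular, lintegral_smul_measure, smul_eq_mul, lintegral_weightMeasure hv,
      ← lintegral_const_mul' _ _ (by simp)]
    refine lintegral_congr fun x => ?_
    ring
  simp only [luxNorm, luxNormMeasure, hmod]

theorem indicator_div_mul {s : Set ℝ} {a V : ℝ → ℝ≥0∞} {ε : ℝ≥0} (hε : 0 < ε) :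
    (s.indicator fun y => a y / (ε * V y)) = fun y => s.indicator (fun y => a y / V y) y / ε := by
  have hε0 : (ε : ℝ≥0∞) ≠ 0 := by exact_mod_cast hε.ne'
  ext y
  by_cases hy : y ∈ s
  · simp only [indicator_of_mem hy, div_eq_mul_inv]
    rw [ENNReal.mul_inv (Or.inl hε0) (Or.inl (by simp))]
    ring
  · simp [indicator_of_notMem hy]

theorem lintegral_indicator_div_mul {μ : Measure ℝ} {s : Set ℝ} (hs : MeasurableSet s)
    (a V g : ℝ → ℝ≥0∞) :
    ∫⁻ y, s.indicator (fun y => a y / V y) y * g y ∂μ = ∫⁻ y in s, a y * (g y / V y) ∂μ := by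
  rw [← lintegral_indicator hs]
  refine lintegral_congr fun y => ?_
  by_cases hy : y ∈ s
  · simp only [indicator_of_mem hy, div_eq_mul_inv]
    ring
  · simp [indicator_of_notMem hy]

/-- From a norm condition to the corresponding test inequality. -/
theorem test_of_nInv_le (hp : IsNGenerator p) (hq : IsNGenerator q) (hv : IsWeight v)
    (hw : IsWeight w) {X s : Set ℝ} (hX : MeasurableSet X) (hX0 : X ⊆ Ioi 0)
    (hs : MeasurableSet s) {a c : ℝ → ℝ≥0∞}
    (H : ∀ ε : ℝ≥0, 0 < ε → nInv (nFun q) (∫⁻ x in X, nFun q (c x *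
        luxNorm (nFun (complGen p)) (fun y => ε * v y)
          (s.indicator fun y => a y / (ε * primitive v y))) * w x) ≤ nInv (nFun p) (1 / ε))
    {g : ℝ → ℝ≥0∞} (hg : Measurable g) :
    ∫⁻ x in X, nFun q (c x / 8 * ∫⁻ t in s, a t * (g t / weightMeasure v (Iio t)) ∂weightMeasure v)
        ∂weightMeasure w
      ≤ nFun q (nInv (nFun p) (∫⁻ t, nFun p (g t) ∂weightMeasure v)) := by
  have h := test_of_luxNorm (ω := (weightMeasure w).restrict X) (μ := weightMeasure v) (c := c)
    (h := s.indicator fun y => a y / primitive v y) hp hq (fun ε hε => by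
      rw [setLIntegral_weightMeasure hw hX hX0, ← hq.nInv_le_iff]
      refine le_trans (le_of_eq ?_) (H ε hε)
      rw [indicator_div_mul hε, luxNorm_eq_luxNormMeasure hv]) hg
  rw [lintegral_indicator_div_mul hs] at h
  simpa only [weightMeasure_Iio] using h

/-- From a test inequality to the corresponding norm condition. -/
theorem nInv_le_of_test (hp : IsNGenerator p) (hq : IsNGenerator q) (hv : IsWeight v)
    (hvμ : IsAdmissible (weightMeasure v))
    (hw : IsWeight w) {X s : Set ℝ} (hX : MeasurableSet X) (hX0 : X ⊆ Ioi 0)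
    (hs : MeasurableSet s) {a c : ℝ → ℝ≥0∞} (ha : Measurable a)
    (hc : AEMeasurable c (weightMeasure w))
    (H : ∀ g : ℝ → ℝ≥0∞, Measurable g → ∫⁻ x in X, nFun q (c x *
        ∫⁻ t in s, a t * (g t / weightMeasure v (Iio t)) ∂weightMeasure v) ∂weightMeasure w
      ≤ nFun q (nInv (nFun p) (∫⁻ t, nFun p (g t) ∂weightMeasure v)))
    {ε : ℝ≥0} (hε : 0 < ε) :
    nInv (nFun q) (∫⁻ x in X, nFun q (c x * luxNorm (nFun (complGen p)) (fun y => ε * v y)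
          (s.indicator fun y => a y / (ε * primitive v y))) * w x) ≤ nInv (nFun p) (1 / ε) := by
  have hVm := measurable_Iio (weightMeasure v)
  rw [hq.nInv_le_iff, indicator_div_mul hε, luxNorm_eq_luxNormMeasure hv,
    ← setLIntegral_weightMeasure hw hX hX0]
  refine luxNorm_of_test hp hvμ.Iio_lt_top ?_ hc.restrict (fun g hg => ?_) hε
  · simp only [← weightMeasure_Iio]
    exact (ha.div hVm).indicator hs
  · rw [lintegral_indicator_div_mul hs]
    simpa only [weightMeasure_Iio] using H g hg

end Weights

/-! ### Comparison with the Calderón operator. -/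

section DunklHausdorff

variable {α : ℝ} {φ : ℝ → ℝ≥0} {C₁ C₂ C₃ C₄ : ℝ}

/-- `d` is the quotient bounded by hypothesis at `y / x`; after cancellation of powers the remaining
factor is `1/y` when `x ≤ y` and `1/x` otherwise. -/
theorem exists_kernel_eq
    (hφ_ge : ∀ x : ℝ, 1 ≤ x → C₁ ≤ φ x / x ^ (2 * α) ∧ φ x / x ^ (2 * α) ≤ C₂)
    (hφ_lt : ∀ x : ℝ, 0 < x → x < 1 →
      C₃ ≤ φ x / x ^ (2 * α + 1) ∧ φ x / x ^ (2 * α + 1) ≤ C₄)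
    {x y : ℝ} (hx : 0 < x) (hy : 0 < y) :
    ∃ d, min C₁ C₃ ≤ d ∧ d ≤ max C₂ C₄ ∧
      x ^ (2 * α) * (φ (y / x) / y ^ (2 * α + 1)) = d * (max x y)⁻¹ := by
  rcases le_or_gt x y with h | h
  · obtain ⟨h1, h2⟩ := hφ_ge (y / x) ((one_le_div hx).2 h)
    refine ⟨_, (min_le_left _ _).trans h1, h2.trans (le_max_left _ _), ?_⟩
    rw [max_eq_right h, Real.div_rpow hy.le hx.le, Real.rpow_add hy, Real.rpow_one]
    have := Real.rpow_pos_of_pos hy (2 * α)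
    have := Real.rpow_pos_of_pos hx (2 * α)
    field_simp
  · obtain ⟨h1, h2⟩ := hφ_lt (y / x) (by positivity) ((div_lt_one hx).2 h)
    refine ⟨_, (min_le_right _ _).trans h1, h2.trans (le_max_right _ _), ?_⟩
    rw [max_eq_left h.le, Real.div_rpow hy.le hx.le, Real.rpow_add hx, Real.rpow_one]
    have := Real.rpow_pos_of_pos hy (2 * α + 1)
    have := Real.rpow_pos_of_pos hx (2 * α)
    field_simp

theorem quasiDunklHausdorff_eq (α : ℝ) (φ f : ℝ → ℝ≥0) {x : ℝ} (hx : 0 < x) :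
    quasiDunklHausdorff α φ f x
      = ∫⁻ y in Ioi 0, ENNReal.ofReal (x ^ (2 * α) * (φ (y / x) / y ^ (2 * α + 1))) * f y := by
  rw [quasiDunklHausdorff, ← lintegral_const_mul' _ _ (by simp)]
  refine setLIntegral_congr_fun measurableSet_Ioi fun y hy => ?_
  have hy0 : 0 < y ^ (2 * α + 1) := Real.rpow_pos_of_pos hy _
  rw [ENNReal.ofReal_mul (by positivity), ENNReal.ofReal_div_of_pos hy0, ENNReal.ofReal_coe_nnreal,
    mul_assoc]

/-- The quasi Dunkl–Hausdorff operator is comparable to the Calderón operator. -/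
theorem quasiDunklHausdorff_bounds (hC₁ : 0 < C₁) (hC₃ : 0 < C₃)
    (hφ_ge : ∀ x : ℝ, 1 ≤ x → C₁ ≤ φ x / x ^ (2 * α) ∧ φ x / x ^ (2 * α) ≤ C₂)
    (hφ_lt : ∀ x : ℝ, 0 < x → x < 1 →
      C₃ ≤ φ x / x ^ (2 * α + 1) ∧ φ x / x ^ (2 * α + 1) ≤ C₄)
    (f : ℝ → ℝ≥0) {x : ℝ} (hx : 0 < x) :
    ENNReal.ofReal (min C₁ C₃) * calderon (fun s => f s) x ≤ quasiDunklHausdorff α φ f x ∧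
    quasiDunklHausdorff α φ f x ≤ ENNReal.ofReal (max C₂ C₄) * calderon (fun s => f s) x := by
  rw [quasiDunklHausdorff_eq α φ f hx, calderon, ← lintegral_const_mul' _ _ (by simp),
    ← lintegral_const_mul' _ _ (by simp)]
  have hmin : 0 < min C₁ C₃ := lt_min hC₁ hC₃
  constructor <;> refine setLIntegral_mono' measurableSet_Ioi fun y hy => ?_ <;>
    obtain ⟨d, hd1, hd2, he⟩ := exists_kernel_eq hφ_ge hφ_lt hx hy <;>
    rw [he, ← mul_assoc, ← ENNReal.ofReal_mul (by linarith)] <;> gcongr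

end DunklHausdorff

end DunklOrlicz

/-! ### The characterization. -/

open DunklOrlicz
theorem theorem2p2
    (p q : ℝ≥0 → ℝ≥0) (hp : IsNGenerator p) (hq : IsNGenerator q)
    (Φ Φc Ψ : ℝ≥0∞ → ℝ≥0∞)
    (hΦ : Φ = nFun p) (hΦc : Φc = nFun (complGen p)) (hΨ : Ψ = nFun q)
    (hΦ2 : Delta2 Φ) (hΦc2 : Delta2 Φc) (hprec : Prec Φ Ψ)
    (v w₀ w₁ : ℝ → ℝ≥0) (hv : IsWeight v) (hw₀ : IsWeight w₀) (hw₁ : IsWeight w₁)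
    (hv_fin : ∀ x : ℝ, 0 < x → primitive v x < ∞)
    (hv_inf : Tendsto (primitive v) atTop (𝓝 ∞))
    (α : ℝ) (φ : ℝ → ℝ≥0)
    (hφ : LocallyIntegrableOn (fun x => (φ x : ℝ)) (Ioi 0) volume)
    (C₁ C₂ C₃ C₄ : ℝ) (hC₁ : 0 < C₁) (hC₂ : 0 < C₂) (hC₃ : 0 < C₃) (hC₄ : 0 < C₄)
    (hφ_ge : ∀ x : ℝ, 1 ≤ x → C₁ ≤ φ x / x ^ (2 * α) ∧ φ x / x ^ (2 * α) ≤ C₂)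
    (hφ_lt : ∀ x : ℝ, 0 < x → x < 1 →
      C₃ ≤ φ x / x ^ (2 * α + 1) ∧ φ x / x ^ (2 * α + 1) ≤ C₄) :
    (∃ C : ℝ≥0, 0 < C ∧ ∀ f : ℝ → ℝ≥0, AntitoneOn f (Ioi 0) →
      nInv Ψ (∫⁻ x in Ioi (0 : ℝ), Ψ (w₁ x * quasiDunklHausdorff α φ f x) * w₀ x)
        ≤ nInv Φ (∫⁻ x in Ioi (0 : ℝ), Φ (C * f x) * v x))
    ↔
    (∃ A₁ A₂ A₃ : ℝ≥0, 0 < A₁ ∧ 0 < A₂ ∧ 0 < A₃ ∧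
      ∀ (r : ℝ) (ε : ℝ≥0), 0 < r → 0 < ε →
        nInv Ψ (∫⁻ x in Ioi r,
            Ψ (w₁ x / (A₁ * ENNReal.ofReal x) *
              luxNorm Φc (fun y => ε * v y)
                ((Ioo 0 r).indicator fun y => ENNReal.ofReal y / (ε * primitive v y))) * w₀ x)
          ≤ nInv Φ (1 / ε) ∧
        nInv Ψ (∫⁻ x in Ioo 0 r,
            Ψ (w₁ x / A₂ *
              luxNorm Φc (fun y => ε * v y)
                ((Ioi r).indicator fun y => 1 / (ε * primitive v y))) * w₀ x)
          ≤ nInv Φ (1 / ε) ∧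
        nInv Ψ (∫⁻ x in Ioo 0 r,
            Ψ (w₁ x / A₃ *
              luxNorm Φc (fun y => ε * v y)
                ((Ioi r).indicator fun y =>
                  ENNReal.ofReal (Real.log (y / r)) / (ε * primitive v y))) * w₀ x)
          ≤ nInv Φ (1 / ε) ∧
        nInv Ψ (∫⁻ x in Ioo 0 r,
            Ψ (w₁ x / A₃ *
              luxNorm Φc (fun y => ε * v y)
                ((Ioi r).indicator fun y => 1 / (ε * primitive v y)) *
              ENNReal.ofReal (Real.log (r / x))) * w₀ x)
          ≤ nInv Φ (1 / ε)) := by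
  subst hΦ hΦc hΨ
  have hμ := isAdmissible_weightMeasure hv_fin hv_inf
  set μ := weightMeasure v with hμdef
  set ω := weightMeasure w₀ with hωdef
  have hωpos : ∀ᵐ x ∂ω, 0 < x := ae_weightMeasure_pos w₀
  have hw₁m : AEMeasurable (fun x => (w₁ x : ℝ≥0∞)) ω :=
    (hw₁.mono_ac (withDensity_absolutelyContinuous _ _)).coe_nnreal_ennreal
  have hVm : Measurable fun x => μ (Iio x) := IsAdmissible.measurable_Iio μ
  set c₀ : ℝ≥0 := (min C₁ C₃).toNNReal with hc₀
  set c₁ : ℝ≥0 := (max C₂ C₄).toNNReal with hc₁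
  have hc₀pos : 0 < c₀ := Real.toNNReal_pos.2 (lt_min hC₁ hC₃)
  have hc₁pos : 0 < c₁ := Real.toNNReal_pos.2 (lt_max_of_lt_left hC₂)
  have hbounds := fun (f : ℝ → ℝ≥0) {x : ℝ} (hx : 0 < x) =>
    quasiDunklHausdorff_bounds hC₁ hC₃ hφ_ge hφ_lt f hx
  constructor
  · rintro ⟨C, hC, hI⟩
    obtain ⟨c, hc, hJ⟩ := lintegral_calderonKernel_le_of_antitone (q := q) (ω := ω)
      (W := fun x => c₀ * w₁ x) hμ hp.monotone hΦ2 (hw₁m.const_mul _) hωpos hC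
      (fun f hf => by
        rw [← hq.nInv_le_iff]
        refine le_trans (nInv_mono _ ?_) ((hI f hf).trans_eq ?_)
        · rw [← lintegral_weightMeasure hw₀]
          refine lintegral_mono_ae ?_
          filter_upwards [hωpos] with x hx
          refine nFun_mono q ?_
          rw [mul_comm (c₀ : ℝ≥0∞), mul_assoc]
          gcongr
          exact (hbounds f hx).1
        · rw [← lintegral_weightMeasure hv])
    set κ : ℝ≥0 := c * c₀ with hκ
    have hκpos : 0 < κ := by positivity
    have hκinv : ((κ⁻¹ : ℝ≥0) : ℝ≥0∞)⁻¹ = κ := by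
      rw [ENNReal.coe_inv hκpos.ne', inv_inv]
    -- Any functional dominated on `X` by the composed kernel inherits its inequality; the four
    -- conditions are four choices of `X`, `b` and `L`.
    have hJ' : ∀ (X : Set ℝ) (b : ℝ → ℝ≥0∞) (L : ℝ → (ℝ → ℝ≥0∞) → ℝ≥0∞), MeasurableSet X →
        (∀ x ∈ X, 0 < x → ∀ h : ℝ → ℝ≥0∞, Measurable h →
          b x * L x h ≤ ∫⁻ t, calderonKernel x t * h t ∂μ) →
        ∀ g : ℝ → ℝ≥0∞, Measurable g →
        ∫⁻ x in X, nFun q (κ * w₁ x * b x * L x fun t => g t / μ (Iio t)) ∂ω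
          ≤ nFun q (nInv (nFun p) (∫⁻ t, nFun p (g t) ∂μ)) := by
      intro X b L hX hL g hg
      refine le_trans (lintegral_mono_ae ?_) ((setLIntegral_le_lintegral X _).trans (hJ g hg))
      filter_upwards [ae_restrict_mem hX, ae_restrict_of_ae hωpos] with x hxX hx
      refine nFun_mono q ?_
      rw [hκ, ENNReal.coe_mul, mul_assoc (c : ℝ≥0∞), mul_assoc _ (b x)]
      gcongr
      exact hL x hxX hx _ (hg.div hVm)
    refine ⟨κ⁻¹, κ⁻¹, κ⁻¹, by positivity, by positivity, by positivity, fun r ε hr hε => ?_⟩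
    have hX1 : Ioi r ⊆ Ioi 0 := Ioi_subset_Ioi hr.le
    have hX2 : Ioo 0 r ⊆ Ioi 0 := fun x hx => hx.1
    have hdivA : ∀ x, (w₁ x : ℝ≥0∞) / (κ⁻¹ : ℝ≥0) = κ * w₁ x * 1 := fun x => by
      rw [div_eq_mul_inv, hκinv, mul_comm, mul_one]
    refine ⟨?_, ?_, ?_, ?_⟩
    · refine nInv_le_of_test (c := fun x => (w₁ x : ℝ≥0∞) / ((κ⁻¹ : ℝ≥0) * ENNReal.ofReal x))
        hp hq hv hμ hw₀ measurableSet_Ioi hX1 measurableSet_Ioo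
        ENNReal.measurable_ofReal (hw₁m.div (by fun_prop)) (fun g hg => ?_) hε
      refine le_trans (le_of_eq ?_) (hJ' (Ioi r) (fun x => ENNReal.ofReal x⁻¹)
        (fun x h => ∫⁻ t in Ioo 0 r, ENNReal.ofReal t * h t ∂μ) measurableSet_Ioi
        (fun x hxr hx h hh => ?_) g hg)
      · refine setLIntegral_congr_fun measurableSet_Ioi fun x hx => ?_
        have hx0 : 0 < x := hr.trans hx
        congr 2
        rw [div_eq_mul_inv, ENNReal.mul_inv (Or.inl (by simpa using hκpos.ne'))
          (Or.inl (by simp)), hκinv, ENNReal.ofReal_inv_of_pos hx0]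
        ring
      · rw [lintegral_calderonKernel_mul_eq hμ hh hx]
        refine le_trans ?_ le_self_add
        gcongr
        exact fun t ht => ht.2.trans hxr
    · refine nInv_le_of_test (c := fun x => (w₁ x : ℝ≥0∞) / (κ⁻¹ : ℝ≥0))
        hp hq hv hμ hw₀ measurableSet_Ioo hX2 measurableSet_Ioi
        measurable_const (hw₁m.div (by fun_prop)) (fun g hg => ?_) hε
      simp only [hdivA]
      refine hJ' (Ioo 0 r) (fun _ => 1) (fun x h => ∫⁻ t in Ioi r, 1 * h t ∂μ) measurableSet_Ioo
        (fun x hxr hx h hh => ?_) g hg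
      rw [lintegral_calderonKernel_mul_eq hμ hh hx]
      simp only [one_mul]
      refine le_trans ?_ (le_self_add.trans le_add_self)
      exact lintegral_mono_set (Ioi_subset_Ioi hxr.2.le)
    · refine nInv_le_of_test (c := fun x => (w₁ x : ℝ≥0∞) / (κ⁻¹ : ℝ≥0))
        hp hq hv hμ hw₀ measurableSet_Ioo hX2 measurableSet_Ioi
        (a := fun y => ENNReal.ofReal (Real.log (y / r))) (by fun_prop)
        (hw₁m.div (by fun_prop)) (fun g hg => ?_) hε
      simp only [hdivA]
      refine hJ' (Ioo 0 r) (fun _ => 1)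
        (fun x h => ∫⁻ t in Ioi r, ENNReal.ofReal (Real.log (t / r)) * h t ∂μ) measurableSet_Ioo
        (fun x hxr hx h hh => ?_) g hg
      rw [lintegral_calderonKernel_mul_eq hμ hh hx, one_mul]
      refine le_trans ?_ (le_add_self.trans le_add_self)
      refine (setLIntegral_mono' measurableSet_Ioi fun t ht => ?_).trans
        (lintegral_mono_set (Ioi_subset_Ioi hxr.2.le))
      -- Here `x < r < t`, so `log(t/r) ≤ log(t/x)`.
      gcongr ENNReal.ofReal ?_ * _
      exact log_div_le_log_div hx hxr.2.le (hr.trans ht)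
    · simp only [mul_right_comm _ (luxNorm _ _ _)]
      refine nInv_le_of_test (c := fun x => (w₁ x : ℝ≥0∞) / (κ⁻¹ : ℝ≥0) * ENNReal.ofReal (Real.log (r / x)))
        hp hq hv hμ hw₀ measurableSet_Ioo hX2 measurableSet_Ioi
        measurable_const ((hw₁m.div (by fun_prop)).mul (by fun_prop)) (fun g hg => ?_) hε
      simp only [hdivA, mul_one]
      refine hJ' (Ioo 0 r) (fun x => ENNReal.ofReal (Real.log (r / x)))
        (fun x h => ∫⁻ t in Ioi r, 1 * h t ∂μ) measurableSet_Ioo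
        (fun x hxr hx h hh => ?_) g hg
      rw [lintegral_calderonKernel_mul_eq hμ hh hx]
      simp only [one_mul]
      refine le_trans ?_ (le_add_self.trans le_add_self)
      rw [← lintegral_const_mul' _ _ (by simp)]
      refine (setLIntegral_mono' measurableSet_Ioi fun t ht => ?_).trans
        (lintegral_mono_set (Ioi_subset_Ioi hxr.2.le))
      -- Here `x < r < t`, so `log(r/x) ≤ log(t/x)`.
      gcongr ENNReal.ofReal ?_ * _
      exact log_div_mono hx hr (mem_Ioi.1 ht).le
  · rintro ⟨A₁, A₂, A₃, hA₁, hA₂, hA₃, hA⟩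
    obtain ⟨C, hC1, hC⟩ := hprec.tsum_int_le hq.nFun_top
    set A : ℝ≥0 := max A₁ (max A₂ A₃) with hAdef
    have hA₁A : A₁ ≤ A := le_max_left _ _
    have hA₂A : A₂ ≤ A := (le_max_left _ _).trans (le_max_right _ _)
    have hA₃A : A₃ ≤ A := (le_max_right _ _).trans (le_max_right _ _)
    have hApos : 0 < A := hA₁.trans_le hA₁A
    have hCpos : 0 < C := zero_lt_one.trans_le hC1
    -- One constant `A` dominates all three, and the `8` is the loss in Hölder's inequality.
    set W : ℝ → ℝ≥0∞ := fun x => w₁ x / A / 8 with hW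
    have hWm : AEMeasurable W ω := (hw₁m.div_const _).div_const _
    have hX1 : ∀ {r : ℝ}, 0 < r → Ioi r ⊆ Ioi 0 := fun hr => Ioi_subset_Ioi hr.le
    have hX2 : ∀ r : ℝ, Ioo 0 r ⊆ Ioi 0 := fun r => Ioo_subset_Ioi_self
    have hWle : ∀ B : ℝ≥0, B ≤ A → ∀ x, W x ≤ w₁ x / B / 8 := fun B hB x =>
      ENNReal.div_le_div_right (ENNReal.div_le_div_left (by exact_mod_cast hB) _) _
    have hJ : ∀ g : ℝ → ℝ≥0∞, IsNice μ g →
        ∫⁻ x, nFun q (W x / (512 * C) * ∫⁻ t, calderonKernel x t * (g t / μ (Iio t)) ∂μ) ∂ω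
          ≤ nFun q (nInv (nFun p) (∫⁻ t, nFun p (g t) ∂μ)) := fun g hg =>
      lintegral_calderonKernel_le_of_test (g := g) (W := W) (ω := ω) hC1 hC
      hq.monotone hμ hωpos hWm
      (fun r hr g' hg' => by
        refine le_trans ?_ (test_of_nInv_le hp hq hv hw₀ measurableSet_Ioi (hX1 hr)
          measurableSet_Ioo (fun ε hε => (hA r ε hr hε).1) hg')
        refine setLIntegral_mono' measurableSet_Ioi fun x hx => nFun_mono q ?_
        have hx0 : 0 < x := hr.trans hx
        rw [restrict_Ioo_weightMeasure]
        refine mul_le_mul' ?_ le_rfl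
        have h1 : (w₁ x : ℝ≥0∞) / (A₁ * ENNReal.ofReal x) = w₁ x / A₁ * ENNReal.ofReal x⁻¹ := by
          rw [div_eq_mul_inv, ENNReal.mul_inv (Or.inl (by simpa using hA₁.ne')) (Or.inl (by simp)),
            ENNReal.ofReal_inv_of_pos hx0, ← mul_assoc, div_eq_mul_inv]
        rw [h1, ENNReal.mul_div_right_comm]
        exact mul_le_mul' (hWle A₁ hA₁A x) le_rfl)
      (fun r hr g' hg' => by
        have h1 := test_of_nInv_le hp hq hv hw₀ measurableSet_Ioo (hX2 r)
          measurableSet_Ioi (a := fun _ => 1) (fun ε hε => (hA r ε hr hε).2.1) hg'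
        rw [restrict_Ioo_weightMeasure] at h1
        simp only [one_mul] at h1
        exact le_trans (lintegral_mono fun x => nFun_mono q
          (mul_le_mul' (hWle A₂ hA₂A x) le_rfl)) h1)
      (fun r hr g' hg' => by
        have h1 := test_of_nInv_le hp hq hv hw₀ measurableSet_Ioo (hX2 r)
          measurableSet_Ioi (a := fun y => ENNReal.ofReal (Real.log (y / r)))
          (fun ε hε => (hA r ε hr hε).2.2.1) hg'
        rw [restrict_Ioo_weightMeasure] at h1
        exact le_trans (lintegral_mono fun x => nFun_mono q
          (mul_le_mul' (hWle A₃ hA₃A x) le_rfl)) h1)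
      (fun r hr g' hg' => by
        have h1 := test_of_nInv_le hp hq hv hw₀ measurableSet_Ioo (hX2 r)
          measurableSet_Ioi (a := fun _ => 1)
          (c := fun x => w₁ x / A₃ * ENNReal.ofReal (Real.log (r / x))) (fun ε hε => by
            have h2 := (hA r ε hr hε).2.2.2
            simp only [mul_right_comm _ (luxNorm _ _ _)] at h2
            exact h2) hg'
        rw [restrict_Ioo_weightMeasure] at h1
        simp only [one_mul] at h1
        refine le_trans (lintegral_mono fun x => nFun_mono q (mul_le_mul' ?_ le_rfl)) h1
        rw [ENNReal.mul_div_right_comm]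
        exact mul_le_mul' (hWle A₃ hA₃A x) le_rfl) hg
    have hJ' := fun g hg => lintegral_calderonKernel_le_of_nice (p := p) (q := q) (ω := ω) (g := g)
      (W := fun x => W x / (512 * C)) hμ (hWm.div_const _) hJ hg
    -- Scaling `f` by `κ` undoes the divisions of the weight by `A`, `8` and `512 C` and supplies
    -- the upper comparison constant `c₁`. The further factor `4` in the final constant comes from
    -- the envelope.
    set κ : ℝ≥0 := c₁ * (A * 8 * (512 * C)) with hκ
    have hκpos : 0 < κ := by positivity
    refine ⟨4 * κ, by positivity, fun f hf => ?_⟩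
    have hκf : AntitoneOn (fun x => κ * f x) (Ioi 0) := fun x hx y hy hxy =>
      mul_le_mul_right (hf hx hy hxy) κ
    have h1 := lintegral_calderon_le_of_kernel hμ hp hq hωpos hJ' hκf
    rw [hq.nInv_le_iff, ← lintegral_weightMeasure hw₀, ← lintegral_weightMeasure hv]
    refine le_trans (lintegral_mono_ae ?_) (h1.trans_eq ?_)
    · filter_upwards [hωpos] with x hx
      refine nFun_mono q ?_
      have h3 : calderon (fun s => ((κ * f s : ℝ≥0) : ℝ≥0∞)) x = κ * calderon (fun s => f s) x := by
        simp only [calderon]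
        rw [← lintegral_const_mul' _ _ (by simp)]
        refine lintegral_congr fun s => ?_
        push_cast
        ring
      rw [h3]
      have h4 : W x / (512 * C) * κ = w₁ x * c₁ := by
        have hB : ((A * 8 * (512 * C) : ℝ≥0) : ℝ≥0∞) ≠ 0 := by
          have : 0 < A * 8 * (512 * C) := by positivity
          exact_mod_cast this.ne'
        have h5 : W x / (512 * C) = w₁ x / ((A * 8 * (512 * C) : ℝ≥0) : ℝ≥0∞) := by
          have hA0 : (A : ℝ≥0∞) ≠ 0 := by exact_mod_cast hApos.ne'
          push_cast
          simp only [hW, div_eq_mul_inv]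
          rw [ENNReal.mul_inv (Or.inl (mul_ne_zero hA0 (by norm_num))) (Or.inl (by finiteness)),
            ENNReal.mul_inv (Or.inl hA0) (Or.inl (by finiteness))]
          simp only [mul_assoc]
        rw [h5, hκ, ENNReal.coe_mul c₁, mul_comm (c₁ : ℝ≥0∞), ← mul_assoc,
          ENNReal.div_mul_cancel hB ENNReal.coe_ne_top]
      rw [← mul_assoc, h4, mul_assoc]
      gcongr
      exact (hbounds f hx).2
    · refine congrArg _ (congrArg _ (lintegral_congr fun x => ?_))
      push_cast
      rw [mul_assoc]
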